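/- Let $\sigma,\vartheta_2,\vartheta_1,\vartheta_0\in\mathbb R$ with $\sigma^2>0$, $\vartheta_2>0$ and $\Gamma+\pi^2>0$, where $\kappa:=\vartheta_1/\vartheta_2$ and $\Gamma:=\frac{\vartheta_1^2}{4\vartheta_2^2}-\frac{\vartheta_0}{\vartheta_2}$. Equip $L^2([0,1])$ with the inner product $\langle u,v\rangle:=\int_0^1u(x)v(x)\mathrm e^{\kappa x}\,dx$, and for $\ell\ge1$ put $e_\ell(y):=\sqrt2\sin(\pi\ell y)\mathrm e^{-\kappa y/2}$ and $\lambda_\ell:=\vartheta_2(\pi^2\ell^2+\Gamma)$. Let $W$ be a cylindrical Brownian motion on $(L^2([0,1]),\langle\cdot,\cdot\rangle)$, i.e. $u\mapsto W_\cdot(u)$ is linear, $W_\cdot(u)$ is a standard Brownian motion for every $u$ with $\langle u,u\rangle=1$, and $\mathrm{Cov}(W_s(u),W_t(v))=(s\wedge t)\langle u,v\rangle$. Let $X=(X_t(x))_{t\ge0,\,x\in[0,1]}$ be the continuous version of the weak solution of $$dX_t=A_\vartheta X_t\,dt+\sigma\,dW_t,\qquad A_\vartheta=\vartheta_2\tfrac{\partial^2}{\partial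 x^2}+\vartheta_1\tfrac{\partial}{\partial x}+\vartheta_0,\qquad X_t(0)=X_t(1)=0,$$ that is, for every $\varphi\in C^2([0,1])$ with $\varphi(0)=\varphi(1)=0$ and every $t\ge0$, almost surely $$\langle X_t,\varphi\rangle=\langle X_0,\varphi\rangle+\int_0^t\langle X_s,A_\vartheta\varphi\rangle\,ds+\sigma W_t(\varphi).$$ Assume that the processes $W_\cdot(e_\ell)$ and the random variables $\langle X_0,e_\ell\rangle$, $\ell\ge1$, form an independent family and that $\langle X_0,e_\ell\rangle\sim\mathcal N(0,\sigma^2/(2\lambda_\ell))$ for every $\ell\geq 1$. Fix $T>0$ and $b\in[0,1/2)$. For $M,N\in\mathbb N$ let $\delta:=(1-2b)/M$, $y_k:=b+k\delta$, $t_i:=iT/N$, and $$V_{\mathrm{sp}}:=\frac1{NM\delta}\sum_{i=0}^{N-1}\sum_{k=0}^{M-1}\mathrm e^{\kappa y_k}\bigl(X_{t_i}(y_{k+1})-X_{t_i}(y_k)\bigr)^2 .$$ If $M,N\to\infty$ such that $N/M\to0$, then $$\sqrt{MN}\Bigl(V_{\mathrm{sp}}-\frac{\sigma^2}{2\vartheta_2}\Bigr)\overset{\mathcal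 D}{\longrightarrow}\mathcal N\Bigl(0,\frac{\sigma^4}{2\vartheta_2^2}\Bigr).$$ -/

import Mathlib

open MeasureTheory ProbabilityTheory Filter Topology Set
open scoped NNReal ENNReal

noncomputable section

namespace SPDE

/-- `κ = ϑ₁ / ϑ₂`. -/
def kappa (ϑ₂ ϑ₁ : ℝ) : ℝ := ϑ₁ / ϑ₂

/-- `Γ = ϑ₁² / (4 ϑ₂²) - ϑ₀ / ϑ₂`. -/
def Gam (ϑ₂ ϑ₁ ϑ₀ : ℝ) : ℝ := ϑ₁ ^ 2 / (4 * ϑ₂ ^ 2) - ϑ₀ / ϑ₂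

/-- `λ_ℓ = ϑ₂ (π² ℓ² + Γ)`, where `-λ_ℓ` is the `ℓ`-th eigenvalue of `A_ϑ` (for `ℓ ≥ 1`). -/
def eigval (ϑ₂ ϑ₁ ϑ₀ : ℝ) (ℓ : ℕ) : ℝ :=
  ϑ₂ * (Real.pi ^ 2 * (ℓ : ℝ) ^ 2 + Gam ϑ₂ ϑ₁ ϑ₀)

/-- The eigenfunction `e_ℓ(y) = √2 sin(π ℓ y) exp(-κ y / 2)` of `A_ϑ` (for `ℓ ≥ 1`). -/
def eigfun (κ : ℝ) (ℓ : ℕ) (y : ℝ) : ℝ :=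
  √2 * Real.sin (Real.pi * ℓ * y) * Real.exp (-κ * y / 2)

lemma continuous_eigfun (κ : ℝ) (ℓ : ℕ) : Continuous (eigfun κ ℓ) := by
  unfold eigfun
  fun_prop

/-- The differential operator `A_ϑ φ = ϑ₂ φ'' + ϑ₁ φ' + ϑ₀ φ`, applied to `C²` functions. -/
def opA (ϑ₂ ϑ₁ ϑ₀ : ℝ) (φ : ℝ → ℝ) (x : ℝ) : ℝ :=
  ϑ₂ * deriv (deriv φ) x + ϑ₁ * deriv φ x + ϑ₀ * φ x

/-- The weighted inner product `⟨f, g⟩_ϑ = ∫₀¹ f(x) g(x) e^{κ x} dx`. -/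
def wInner (κ : ℝ) (f g : ℝ → ℝ) : ℝ :=
  ∫ x in (0 : ℝ)..1, f x * g x * Real.exp (κ * x)

/-- The measure `e^{κ x} dx` on `[0,1]`. -/
def wMeasure (κ : ℝ) : Measure ℝ :=
  (volume.restrict (Icc (0 : ℝ) 1)).withDensity (fun x => ENNReal.ofReal (Real.exp (κ * x)))

/-- `L²([0,1])` with the weighted inner product `⟨·,·⟩_ϑ`. -/
abbrev wL2 (κ : ℝ) : Type := Lp ℝ 2 (wMeasure κ)

lemma memLp_of_continuous (κ : ℝ) {f : ℝ → ℝ} (hf : Continuous f) :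
    MemLp f 2 (wMeasure κ) := by
  have hfin : IsFiniteMeasure (wMeasure κ) := by
    refine isFiniteMeasure_withDensity_ofReal (Integrable.hasFiniteIntegral ?_)
    exact (Continuous.continuousOn (by fun_prop)).integrableOn_compact isCompact_Icc
  obtain ⟨C, hC⟩ := isCompact_Icc.exists_bound_of_continuousOn
    (s := Icc (0 : ℝ) 1) hf.continuousOn
  refine MemLp.of_bound hf.aestronglyMeasurable C ?_
  refine (withDensity_absolutelyContinuous _ _).ae_le ?_
  filter_upwards [ae_restrict_mem measurableSet_Icc] with x hx using hC x hx

/-- A continuous function, regarded as an element of (weighted) `L²([0,1])`. -/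
def toL2 (κ : ℝ) (f : ℝ → ℝ) (hf : Continuous f) : wL2 κ :=
  (memLp_of_continuous κ hf).toLp f

/-- `W` is a cylindrical Brownian motion on the real Hilbert space `H`: `u ↦ W(u)` is linear
(almost surely), `t ↦ W_t(u)` is a standard Brownian motion for every unit vector `u`, and
`Cov(W_s(u), W_t(v)) = (s ∧ t) ⟨u, v⟩`. -/
structure IsCylindricalBrownian {Ω H : Type*} [MeasurableSpace Ω] [NormedAddCommGroup H]
    [InnerProductSpace ℝ H] (W : H → ℝ≥0 → Ω → ℝ) (P : Measure Ω) : Prop where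
  measurable : ∀ u t, Measurable (W u t)
  linear : ∀ (a b : ℝ) (u v : H) (t : ℝ≥0),
    ∀ᵐ ω ∂P, W (a • u + b • v) t ω = a * W u t ω + b * W v t ω
  brownian : ∀ u : H, ‖u‖ = 1 → IsBrownianReal (W u) P
  cov : ∀ (u v : H) (s t : ℝ≥0),
    cov[W u s, W v t; P] = ((min s t : ℝ≥0) : ℝ) * inner ℝ u v

/-- `X` (where `X t x ω` is relevant for `t ≥ 0`, `x ∈ [0,1]`) is a continuous random field which is
a weak solution of `dX_t = A_ϑ X_t dt + σ dW_t` on `[0,1]` with Dirichlet boundary conditions.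
The operator `A_ϑ` is self-adjoint for `⟨·,·⟩_ϑ`. The equation is only tested against `C²` functions
vanishing at `0` and `1`, which all lie in the domain `H² ∩ H¹₀` of `A_ϑ`. -/
structure IsWeakSolution {Ω : Type*} [MeasurableSpace Ω] (σ ϑ₂ ϑ₁ ϑ₀ : ℝ)
    (W : wL2 (kappa ϑ₂ ϑ₁) → ℝ≥0 → Ω → ℝ) (X : ℝ → ℝ → Ω → ℝ) (P : Measure Ω) : Prop where
  measurable : ∀ t, 0 ≤ t → ∀ x ∈ Icc (0 : ℝ) 1, Measurable (X t x)
  continuous : ∀ ω, ContinuousOn (fun p : ℝ × ℝ => X p.1 p.2 ω) (Ici 0 ×ˢ Icc 0 1)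
  boundary : ∀ t, 0 ≤ t → ∀ ω, X t 0 ω = 0 ∧ X t 1 ω = 0
  weak : ∀ (φ : ℝ → ℝ) (hφ : ContDiff ℝ 2 φ), φ 0 = 0 → φ 1 = 0 → ∀ t : ℝ≥0, ∀ᵐ ω ∂P,
    wInner (kappa ϑ₂ ϑ₁) (fun x => X t x ω) φ
      = wInner (kappa ϑ₂ ϑ₁) (fun x => X 0 x ω) φ
        + (∫ s in (0 : ℝ)..t,
            wInner (kappa ϑ₂ ϑ₁) (fun x => X s x ω) (opA ϑ₂ ϑ₁ ϑ₀ φ))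
        + σ * W (toL2 (kappa ϑ₂ ϑ₁) φ hφ.continuous) t ω

/-- The Fourier mode `u_ℓ(t) = ⟨X_t, e_ℓ⟩_ϑ`. -/
def mode {Ω : Type*} (κ : ℝ) (X : ℝ → ℝ → Ω → ℝ) (ℓ : ℕ) (t : ℝ) (ω : Ω) : ℝ :=
  wInner κ (fun x => X t x ω) (eigfun κ ℓ)

/-- The coordinate process `β_ℓ = W(e_ℓ)` of the cylindrical Brownian motion. -/
def coordBM {Ω : Type*} (κ : ℝ) (W : wL2 κ → ℝ≥0 → Ω → ℝ) (ℓ : ℕ) : ℝ≥0 → Ω → ℝ :=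
  W (toL2 κ (eigfun κ ℓ) (continuous_eigfun κ ℓ))

/-- Stationary initial condition: `{β_ℓ, u_ℓ(0) : ℓ ≥ 1}` is an independent family and
`u_ℓ(0) ∼ N(0, σ² / (2 λ_ℓ))`. The index `ℓ : ℕ` below stands for `ℓ + 1 ≥ 1`. -/
structure IsStationaryStart {Ω : Type*} [MeasurableSpace Ω] (σ ϑ₂ ϑ₁ ϑ₀ : ℝ)
    (W : wL2 (kappa ϑ₂ ϑ₁) → ℝ≥0 → Ω → ℝ) (X : ℝ → ℝ → Ω → ℝ) (P : Measure Ω) : Prop where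
  law : ∀ ℓ : ℕ, HasLaw (mode (kappa ϑ₂ ϑ₁) X (ℓ + 1) 0)
    (gaussianReal 0 (σ ^ 2 / (2 * eigval ϑ₂ ϑ₁ ϑ₀ (ℓ + 1))).toNNReal) P
  indep : iIndep
    (Sum.elim
      (fun ℓ : ℕ => ⨆ t : ℝ≥0, MeasurableSpace.comap
        (coordBM (kappa ϑ₂ ϑ₁) W (ℓ + 1) t) inferInstance)
      (fun ℓ : ℕ => MeasurableSpace.comap
        (mode (kappa ϑ₂ ϑ₁) X (ℓ + 1) 0) inferInstance)) P

/-- Spatial mesh `δ = (1 - 2b) / M`. -/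
def meshSp (b : ℝ) (M : ℕ) : ℝ := (1 - 2 * b) / M

/-- Spatial grid point `y_k = b + k δ`. -/
def gridSp (b : ℝ) (M k : ℕ) : ℝ := b + k * meshSp b M

/-- Temporal grid point `t_i = i Δ`, `Δ = T / N`. -/
def gridT (T : ℝ) (N i : ℕ) : ℝ := i * (T / N)

/-- Rescaled realized spatial quadratic variation at time `t`:
`(1 / (M δ)) ∑_{k < M} e^{κ y_k} (X_t(y_{k+1}) - X_t(y_k))²`. -/
def VspAt {Ω : Type*} (κ b : ℝ) (X : ℝ → ℝ → Ω → ℝ) (M : ℕ) (t : ℝ) (ω : Ω) : ℝ :=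
  1 / (M * meshSp b M) * ∑ k ∈ Finset.range M,
    Real.exp (κ * gridSp b M k) * (X t (gridSp b M (k + 1)) ω - X t (gridSp b M k) ω) ^ 2

/-- Time average `V_sp = (1 / N) ∑_{i < N} V_sp(t_i)`. -/
def Vsp {Ω : Type*} (κ b T : ℝ) (X : ℝ → ℝ → Ω → ℝ) (M N : ℕ) (ω : Ω) : ℝ :=
  1 / N * ∑ i ∈ Finset.range N, VspAt κ b X M (gridT T N i) ω

end SPDE

end

noncomputable section

namespace SPDE

/-! ### A central limit theorem for quadratic forms of Gaussian vectors -/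

/-! The statistic is a multiple of the squared norm of a centred Gaussian vector, so everything is
read off its covariance matrix S. In an orthonormal eigenbasis of S the squared norm is a sum of
independent variables d_j Z_j², with d_j the eigenvalues. After scaling by γ it is asymptotically
normal with variance 2v once γ‖S‖ → 0, γ²‖S‖_F² → v and γ tr S has the right limit: no single term
dominates, and a normalised χ² variable agrees with a Gaussian to second order. This is
`tendstoInDistribution_sum_sq`.

The vector consists of the weighted increments e^{κ y_k/2}(X_{t_i}(y_{k+1}) - X_{t_i}(y_k)). The
modes of X are independent stationary Ornstein-Uhlenbeck processes, so the covariance at lag τ is ∑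
σ²/λ_ℓ e^{-λ_ℓ τ} a_{ℓk} a_{ℓl}, with a_{ℓk} the sine coefficients of the increment. A continuous
path need not have a pointwise convergent sine series; Riemann summation, which is averaging against
a tent function, recovers its values and transfers Gaussianity from finite sums of modes
(`hasGaussTransform_of_riemann_summable`).

At lag 0, replacing λ_ℓ by ϑ₂π²ℓ² turns the series into increments of the Brownian bridge kernel, so
the covariance is cδ on the diagonal, c = σ²/(2ϑ₂), up to O(δ²) in every entry
(`incCov_zero_approx`). Since Mδ ≤ 1, the trace is NM·cδ + O(Nδ). At positive lags ‖S_τ‖_F² ≤ ‖S_τ‖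
tr S_τ, where ‖S_τ‖ = O(δ) and the traces over all lags sum to O(δN), so the off-diagonal blocks add
only O(δ²N²) to the main term NM(cδ)² (`frobenius_incMatrix_approx`). With γ = √(MN)/(NMδ), the
operator norm and the bias are O(√(N/M)), the Frobenius error is O(N/M), and v = c². This is where
N/M → 0 enters. -/

lemma hasDerivAt_mul_exp_sq_half {p : ℝ → ℝ} {p' t : ℝ} (hp : HasDerivAt p p' t) :
    HasDerivAt (fun t => p t * Real.exp (t ^ 2 / 2)) ((p' + t * p t) * Real.exp (t ^ 2 / 2)) t := by
  have h : HasDerivAt (fun t : ℝ => t ^ 2 / 2) t t := by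
    simpa using (hasDerivAt_pow 2 t).div_const 2
  exact (hp.mul h.exp).congr_deriv (by ring)

/-- The fourth moment is the fourth derivative at 0 of the moment generating function e^{t²/2}; each
differentiation replaces the polynomial prefactor p by p' + t p. -/
lemma integral_pow_four_gaussianReal : ∫ x : ℝ, x ^ 4 ∂(gaussianReal 0 1) = 3 := by
  have h := iteratedDeriv_mgf_zero (X := fun x : ℝ => x) (μ := gaussianReal 0 1) (by simp) 4
  have h1 : deriv (fun t : ℝ => Real.exp (t ^ 2 / 2)) = fun t => t * Real.exp (t ^ 2 / 2) := by
    ext t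
    simpa using (hasDerivAt_mul_exp_sq_half (hasDerivAt_const t (1 : ℝ))).deriv
  have h2 : deriv (fun t : ℝ => t * Real.exp (t ^ 2 / 2))
      = fun t => (1 + t * t) * Real.exp (t ^ 2 / 2) := by
    ext t
    exact (hasDerivAt_mul_exp_sq_half (hasDerivAt_id t)).deriv
  have h3 : deriv (fun t : ℝ => (1 + t * t) * Real.exp (t ^ 2 / 2))
      = fun t => (3 * t + t ^ 3) * Real.exp (t ^ 2 / 2) := by
    ext t
    refine (hasDerivAt_mul_exp_sq_half (p := fun t => 1 + t * t)
      (((hasDerivAt_id t).mul (hasDerivAt_id t)).const_add 1)).deriv.trans ?_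
    simp only [id]
    ring
  have h4 : deriv (fun t : ℝ => (3 * t + t ^ 3) * Real.exp (t ^ 2 / 2)) 0 = 3 := by
    refine (hasDerivAt_mul_exp_sq_half (p := fun t => 3 * t + t ^ 3)
      (((hasDerivAt_id (0 : ℝ)).const_mul 3).add (hasDerivAt_pow 3 0))).deriv.trans ?_
    simp
  rw [mgf_fun_id_gaussianReal] at h
  simp only [zero_mul, NNReal.coe_one, one_mul, zero_add, iteratedDeriv_succ, iteratedDeriv_zero,
    h1, h2, h3, h4] at h
  simpa using h.symm

lemma integral_sq_gaussianReal : ∫ x : ℝ, x ^ 2 ∂(gaussianReal 0 1) = 1 := by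
  have h := variance_fun_id_gaussianReal (μ := 0) (v := 1)
  rw [variance_eq_integral (by fun_prop)] at h
  simpa using h

lemma integrable_pow_gaussianReal (n : ℕ) : Integrable (fun x : ℝ => x ^ n) (gaussianReal 0 1) := by
  have h := (memLp_id_gaussianReal (μ := 0) (v := 1) (n : ℝ≥0)).integrable_norm_pow'
  refine h.mono (by fun_prop) (ae_of_all _ fun x => ?_)
  simp

/-- The law of the normalised centred chi-squared variable `(Z² - 1) / √2`. -/
def chiSqLaw : Measure ℝ := (gaussianReal 0 1).map (fun x => (x ^ 2 - 1) / √2)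

instance : IsProbabilityMeasure chiSqLaw :=
  Measure.isProbabilityMeasure_map (by fun_prop)

/-- Both laws have mean 0 and variance 1 (the variance of Z² is 3 - 1 = 2, hence the √2), so their
second order Taylor expansions coincide. -/
lemma charFun_chiSqLaw_sub_isLittleO :
    (fun s : ℝ => charFun chiSqLaw s - charFun (gaussianReal 0 1) s) =o[𝓝 0] fun s => s ^ 2 := by
  have h1 := taylor_charFun_two (P := gaussianReal 0 1) (X := fun x : ℝ => (x ^ 2 - 1) / √2)
    (by fun_prop) (by
      rw [integral_div, integral_sub (integrable_pow_gaussianReal 2) (integrable_const _),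
        integral_sq_gaussianReal]
      simp) (by
      have : ((fun x : ℝ => (x ^ 2 - 1) / √2) ^ 2)
          = fun x : ℝ => (x ^ 4 - 2 * x ^ 2 + 1) / 2 := by
        ext x
        simp only [Pi.pow_apply, div_pow, Real.sq_sqrt zero_le_two]
        ring
      rw [this, integral_div, integral_add, integral_sub, integral_const_mul,
        integral_sq_gaussianReal, integral_pow_four_gaussianReal]
      · simp; norm_num
      · exact integrable_pow_gaussianReal 4
      · exact (integrable_pow_gaussianReal 2).const_mul 2
      · exact (integrable_pow_gaussianReal 4).sub ((integrable_pow_gaussianReal 2).const_mul 2)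
      · exact integrable_const _)
  have h2 := taylor_charFun_two (P := gaussianReal 0 1) (X := fun x : ℝ => x)
    (by fun_prop) (by simp) (by simpa using integral_sq_gaussianReal)
  refine (h1.sub h2).congr_left fun s => ?_
  rw [Measure.map_id', chiSqLaw]
  ring

/-- Lindeberg replacement: the factors are exchanged one at a time, and all the others lie in the
unit disc. -/
lemma norm_prod_sub_prod_le {ι : Type*} (s : Finset ι) (a b : ι → ℂ)
    (ha : ∀ i ∈ s, ‖a i‖ ≤ 1) (hb : ∀ i ∈ s, ‖b i‖ ≤ 1) :
    ‖∏ i ∈ s, a i - ∏ i ∈ s, b i‖ ≤ ∑ i ∈ s, ‖a i - b i‖ := by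
  classical
  induction s using Finset.induction_on with
  | empty => simp
  | insert j s hj ih =>
    rw [Finset.prod_insert hj, Finset.prod_insert hj, Finset.sum_insert hj]
    have e : a j * ∏ i ∈ s, a i - b j * ∏ i ∈ s, b i
        = (a j - b j) * ∏ i ∈ s, a i + b j * (∏ i ∈ s, a i - ∏ i ∈ s, b i) := by ring
    rw [e]
    refine (norm_add_le _ _).trans (add_le_add ?_ ?_)
    · rw [norm_mul]
      refine mul_le_of_le_one_right (norm_nonneg _) ?_
      rw [norm_prod]
      exact Finset.prod_le_one (fun _ _ => norm_nonneg _)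
        fun i hi => ha i (Finset.mem_insert_of_mem hi)
    · rw [norm_mul]
      refine (mul_le_of_le_one_left (norm_nonneg _) (hb j (Finset.mem_insert_self _ _))).trans ?_
      exact ih (fun i hi => ha i (Finset.mem_insert_of_mem hi))
        fun i hi => hb i (Finset.mem_insert_of_mem hi)

/-- A triangular array of weights which are uniformly small, and whose squares sum to `v` in the
limit, turns independent normalised chi-squared variables into a Gaussian one. -/
lemma tendsto_prod_charFun_chiSqLaw {ι : ℕ → Type*} [∀ n, Fintype (ι n)] (d : ∀ n, ι n → ℝ)
    {ε : ℕ → ℝ} (hε : Tendsto ε atTop (𝓝 0)) (hd : ∀ n j, |d n j| ≤ ε n) {v : ℝ}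
    (hv : Tendsto (fun n => ∑ j, d n j ^ 2) atTop (𝓝 v)) :
    Tendsto (fun n => ∏ j, charFun chiSqLaw (d n j)) atTop (𝓝 (Complex.exp (-(v / 2 : ℝ)))) := by
  have hg : ∀ n, ∏ j, charFun (gaussianReal 0 1) (d n j)
      = Complex.exp (-((∑ j, d n j ^ 2) / 2 : ℝ)) := by
    intro n
    simp_rw [charFun_gaussianReal]
    rw [← Complex.exp_sum]
    congr 1
    push_cast
    rw [Finset.sum_div, ← Finset.sum_neg_distrib]
    refine Finset.sum_congr rfl fun j _ => ?_
    simp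
  have h1 : Tendsto (fun n => ∏ j, charFun (gaussianReal 0 1) (d n j)) atTop
      (𝓝 (Complex.exp (-(v / 2 : ℝ)))) := by
    simp_rw [hg]
    refine (Complex.continuous_exp.tendsto _).comp ?_
    refine Tendsto.neg ?_
    exact (Complex.continuous_ofReal.tendsto _).comp (hv.div_const 2)
  have h2 : Tendsto (fun n => ∏ j, charFun chiSqLaw (d n j)
      - ∏ j, charFun (gaussianReal 0 1) (d n j)) atTop (𝓝 0) := by
    rw [Metric.tendsto_atTop]
    intro η hη
    have hv0 : 0 ≤ v := ge_of_tendsto' hv fun n => Finset.sum_nonneg fun _ _ => sq_nonneg _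
    -- Tolerance per unit of d²: since ∑ d² < v + 1 eventually, the total replacement error is at
    -- most η/2.
    have hc : 0 < η / (2 * (v + 1)) := by positivity
    have ho := (charFun_chiSqLaw_sub_isLittleO.bound hc)
    obtain ⟨r, hr, hball⟩ := Metric.eventually_nhds_iff.1 ho
    have e1 : ∀ᶠ n in atTop, ε n < r := hε.eventually_lt_const hr
    have e2 : ∀ᶠ n in atTop, ∑ j, d n j ^ 2 < v + 1 := hv.eventually_lt_const (by linarith)
    obtain ⟨n₀, hn₀⟩ := (e1.and e2).exists_forall_of_atTop
    refine ⟨n₀, fun n hn => ?_⟩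
    obtain ⟨h1, h2⟩ := hn₀ n hn
    rw [dist_zero_right]
    calc _ ≤ ∑ j, ‖charFun chiSqLaw (d n j) - charFun (gaussianReal 0 1) (d n j)‖ :=
          norm_prod_sub_prod_le _ _ _ (fun _ _ => norm_charFun_le_one _)
            fun _ _ => norm_charFun_le_one _
      _ ≤ ∑ j, η / (2 * (v + 1)) * d n j ^ 2 := by
          refine Finset.sum_le_sum fun j _ => ?_
          have := hball (y := d n j) (by
            rw [Real.dist_eq, sub_zero]; exact (hd n j).trans_lt h1)
          simpa using this
      _ = η / (2 * (v + 1)) * ∑ j, d n j ^ 2 := by rw [Finset.mul_sum]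
      _ ≤ η / (2 * (v + 1)) * (v + 1) := by gcongr
      _ = η / 2 := by field_simp
      _ < η := by linarith
  simpa using h2.add h1

/-- With x = √d Z one has s(x² - d) = (√2 s d)(Z² - 1)/√2, also when d = 0. -/
lemma charFun_gaussianReal_sq_sub {d : ℝ} (hd : 0 ≤ d) (s : ℝ) :
    ∫ x, Complex.exp ((s * (x ^ 2 - d) : ℝ) * Complex.I) ∂(gaussianReal 0 d.toNNReal)
      = charFun chiSqLaw (√2 * s * d) := by
  have h : gaussianReal 0 d.toNNReal = (gaussianReal 0 1).map (fun x => √d * x) := by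
    rw [gaussianReal_map_const_mul]
    congr 1
    · simp
    · ext
      simp [Real.sq_sqrt hd, hd]
  rw [h, integral_map (by fun_prop) (by fun_prop), charFun_apply_real, chiSqLaw,
    integral_map (by fun_prop) (by fun_prop)]
  congr 1
  ext x
  congr 1
  rw [mul_pow, Real.sq_sqrt hd]
  have h2 : (√2 : ℂ) ≠ 0 := by
    norm_cast
    positivity
  push_cast
  field_simp

lemma exists_orthogonal_diagonalization {ι : Type*} [Fintype ι] [DecidableEq ι]
    {S : Matrix ι ι ℝ} (hS : S.IsSymm) :
    ∃ (U : Matrix ι ι ℝ) (d : ι → ℝ), U.transpose * U = 1 ∧ U * U.transpose = 1 ∧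
      S = U * Matrix.diagonal d * U.transpose := by
  have hH : S.IsHermitian := by
    rw [Matrix.IsHermitian, Matrix.conjTranspose_eq_transpose_of_trivial]
    exact hS
  refine ⟨hH.eigenvectorUnitary, hH.eigenvalues, ?_, ?_, ?_⟩
  · have := Unitary.coe_star_mul_self hH.eigenvectorUnitary
    rwa [Matrix.star_eq_conjTranspose, Matrix.conjTranspose_eq_transpose_of_trivial] at this
  · have := Unitary.coe_mul_star_self hH.eigenvectorUnitary
    rwa [Unitary.coe_star, Matrix.star_eq_conjTranspose,
      Matrix.conjTranspose_eq_transpose_of_trivial] at this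
  · have := hH.spectral_theorem
    rw [Unitary.conjStarAlgAut_apply, Matrix.star_eq_conjTranspose,
      Matrix.conjTranspose_eq_transpose_of_trivial] at this
    exact this

open scoped Matrix in
/-- The Fourier transform of a weighted sum of squares of a centred Gaussian vector, expressed by
the eigenvalues of its covariance matrix. -/
lemma exists_charFun_sum_sq {Ω : Type*} [MeasurableSpace Ω] {P : Measure Ω}
    [IsProbabilityMeasure P] {ι : Type*} [Fintype ι] [DecidableEq ι] {ξ : ι → Ω → ℝ}
    (hξ : ∀ j, AEMeasurable (ξ j) P) {S : Matrix ι ι ℝ} (hS : S.IsSymm)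
    (hpos : ∀ w : ι → ℝ, 0 ≤ w ⬝ᵥ S *ᵥ w)
    (hchar : ∀ w : ι → ℝ, ∫ ω, Complex.exp ((∑ j, w j * ξ j ω : ℝ) * Complex.I) ∂P
      = Complex.exp (-((w ⬝ᵥ S *ᵥ w) / 2 : ℝ))) {ε : ℝ}
    (hε : ∀ w : ι → ℝ, w ⬝ᵥ S *ᵥ w ≤ ε * (w ⬝ᵥ w)) :
    ∃ d : ι → ℝ, (∀ j, 0 ≤ d j ∧ d j ≤ ε) ∧ ∑ j, d j ^ 2 = ∑ i, ∑ j, S i j ^ 2 ∧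
      ∀ s : ℝ, ∫ ω, Complex.exp ((s * (∑ j, ξ j ω ^ 2 - ∑ j, S j j) : ℝ) * Complex.I) ∂P
        = ∏ j, charFun chiSqLaw (√2 * s * d j) := by
  obtain ⟨U, d, hU1, hU2, hSU⟩ := exists_orthogonal_diagonalization hS
  have hdiag : ∀ w : ι → ℝ, (U *ᵥ w) ⬝ᵥ S *ᵥ (U *ᵥ w) = ∑ j, d j * w j ^ 2 := by
    intro w
    have h1 : S *ᵥ (U *ᵥ w) = U *ᵥ (Matrix.diagonal d *ᵥ w) := by
      rw [hSU, Matrix.mulVec_mulVec, Matrix.mulVec_mulVec, Matrix.mul_assoc, hU1, Matrix.mul_one]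
    rw [h1, Matrix.dotProduct_mulVec, Matrix.vecMul_mulVec, hU1, Matrix.vecMul_one]
    simp only [Matrix.mulVec_diagonal, dotProduct]
    exact Finset.sum_congr rfl fun j _ => by ring
  have hnorm : ∀ w : ι → ℝ, (U *ᵥ w) ⬝ᵥ (U *ᵥ w) = w ⬝ᵥ w := by
    intro w
    rw [Matrix.dotProduct_mulVec, Matrix.vecMul_mulVec, hU1, Matrix.vecMul_one]
  have hd : ∀ j, 0 ≤ d j ∧ d j ≤ ε := by
    intro j
    -- Testing the quadratic form on the j-th eigenvector isolates d j.
    have h1 := hpos (U *ᵥ Pi.single j 1)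
    have h2 := hε (U *ᵥ Pi.single j 1)
    rw [hnorm] at h2
    rw [hdiag] at h1 h2
    simp [Pi.single_apply] at h1 h2
    exact ⟨h1, h2⟩
  have htr : ∑ j, S j j = ∑ j, d j := by
    have : S.trace = (Matrix.diagonal d).trace := by
      rw [hSU, Matrix.trace_mul_comm, ← Matrix.mul_assoc, hU1, Matrix.one_mul]
    simpa [Matrix.trace] using this
  have hfrob : ∑ j, d j ^ 2 = ∑ i, ∑ j, S i j ^ 2 := by
    -- The trace of S² is the squared Frobenius norm by symmetry, and the sum of squared eigenvalues
    -- by cyclicity.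
    have h1 : (S * S).trace = (Matrix.diagonal d * Matrix.diagonal d).trace := by
      have : S * S = U * (Matrix.diagonal d * Matrix.diagonal d) * Uᵀ := by
        calc S * S = U * Matrix.diagonal d * (Uᵀ * U) * (Matrix.diagonal d * Uᵀ) := by
              rw [hSU]; simp only [Matrix.mul_assoc]
          _ = _ := by rw [hU1]; simp only [Matrix.mul_assoc, Matrix.one_mul]
      rw [this, Matrix.trace_mul_comm, ← Matrix.mul_assoc, hU1, Matrix.one_mul]
    rw [Matrix.diagonal_mul_diagonal] at h1
    simp only [Matrix.trace, Matrix.diag, Matrix.mul_apply, Matrix.diagonal_apply_eq] at h1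
    simp_rw [sq]
    rw [← h1]
    refine Finset.sum_congr rfl fun i _ => Finset.sum_congr rfl fun j _ => ?_
    rw [hS.apply i j]
  refine ⟨d, hd, hfrob, fun s => ?_⟩
  set η : Ω → ι → ℝ := fun ω => Uᵀ *ᵥ (fun j => ξ j ω) with hη
  have hηm : AEMeasurable η P := by
    refine aemeasurable_pi_lambda _ fun j => ?_
    simp only [hη, Matrix.mulVec, dotProduct]
    exact Finset.aemeasurable_fun_sum _ fun i _ => (hξ i).const_mul _
  have hlaw : P.map η = Measure.pi fun j => gaussianReal 0 (d j).toNNReal := by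
    have : IsProbabilityMeasure (P.map η) := Measure.isProbabilityMeasure_map hηm
    rw [← charFun_eq_pi_iff]
    intro t
    rw [charFun_apply, integral_map (by fun_prop) (by fun_prop), integral_map hηm (by fun_prop)]
    simp_rw [charFun_gaussianReal]
    rw [← Complex.exp_sum]
    -- Pairing t with Uᵀξ is pairing U t with ξ, and the form is diagonal there: the rotated
    -- coordinates are independent Gaussians.
    have := hchar (U *ᵥ t)
    rw [hdiag] at this
    convert this using 2
    · ext ω
      congr 3
      have h1 : t.ofLp ⬝ᵥ η ω = (U *ᵥ t) ⬝ᵥ fun j => ξ j ω := by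
        rw [hη, Matrix.dotProduct_mulVec, Matrix.vecMul_transpose]
      simp only [dotProduct] at h1
      rw [PiLp.inner_apply, ← h1]
      simp
    · push_cast
      rw [Finset.sum_div, ← Finset.sum_neg_distrib]
      refine Finset.sum_congr rfl fun j _ => ?_
      simp [(hd j).1]
  have hsq : ∀ ω, ∑ j, ξ j ω ^ 2 = ∑ j, η ω j ^ 2 := by
    intro ω
    have : η ω ⬝ᵥ η ω = (fun j => ξ j ω) ⬝ᵥ (fun j => ξ j ω) := by
      rw [hη, Matrix.dotProduct_mulVec, Matrix.vecMul_mulVec, Matrix.transpose_transpose, hU2,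
        Matrix.vecMul_one]
    simp only [dotProduct, ← sq] at this
    exact this.symm
  calc _ = ∫ ω, (fun x : ι → ℝ =>
          Complex.exp ((s * (∑ j, x j ^ 2 - ∑ j, d j) : ℝ) * Complex.I)) (η ω) ∂P := by
        simp only [hsq, htr]
    _ = ∫ x, Complex.exp ((s * (∑ j, x j ^ 2 - ∑ j, d j) : ℝ) * Complex.I)
          ∂(Measure.pi fun j => gaussianReal 0 (d j).toNNReal) := by
        rw [← hlaw, integral_map hηm (Continuous.aestronglyMeasurable (by fun_prop))]
    _ = ∫ x, ∏ j, Complex.exp ((s * (x j ^ 2 - d j) : ℝ) * Complex.I)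
          ∂(Measure.pi fun j => gaussianReal 0 (d j).toNNReal) := by
        congr 1
        ext x
        rw [← Complex.exp_sum, ← Finset.sum_sub_distrib, Finset.mul_sum]
        push_cast
        rw [Finset.sum_mul]
    _ = _ := by
        rw [integral_fintype_prod_eq_prod
          (f := fun j (x : ℝ) => Complex.exp ((s * (x ^ 2 - d j) : ℝ) * Complex.I))]
        exact Finset.prod_congr rfl fun j _ => charFun_gaussianReal_sq_sub (hd j).1 s

open scoped Matrix in
/-- Central limit theorem for the squared norm of centred Gaussian vectors. -/
theorem tendstoInDistribution_sum_sq {Ω : Type*} [MeasurableSpace Ω] {P : Measure Ω}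
    [IsProbabilityMeasure P] {ι : ℕ → Type*} [∀ n, Fintype (ι n)] [∀ n, DecidableEq (ι n)]
    {ξ : ∀ n, ι n → Ω → ℝ} (hξ : ∀ n j, AEMeasurable (ξ n j) P)
    {S : ∀ n, Matrix (ι n) (ι n) ℝ} (hS : ∀ n, (S n).IsSymm)
    (hpos : ∀ n, ∀ w : ι n → ℝ, 0 ≤ w ⬝ᵥ S n *ᵥ w)
    (hchar : ∀ n, ∀ w : ι n → ℝ, ∫ ω, Complex.exp ((∑ j, w j * ξ n j ω : ℝ) * Complex.I) ∂P
      = Complex.exp (-((w ⬝ᵥ S n *ᵥ w) / 2 : ℝ))) {ε γ m : ℕ → ℝ} (hγ : ∀ n, 0 ≤ γ n)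
    (hε : ∀ n, ∀ w : ι n → ℝ, w ⬝ᵥ S n *ᵥ w ≤ ε n * (w ⬝ᵥ w))
    (hε0 : Tendsto (fun n => γ n * ε n) atTop (𝓝 0))
    {v : ℝ} (hv : Tendsto (fun n => γ n ^ 2 * ∑ i, ∑ j, S n i j ^ 2) atTop (𝓝 v))
    (hm : Tendsto (fun n => γ n * ∑ j, S n j j - m n) atTop (𝓝 0)) :
    TendstoInDistribution (fun n ω => γ n * ∑ j, ξ n j ω ^ 2 - m n) atTop (id : ℝ → ℝ)
      (fun _ => P) (gaussianReal 0 (2 * v).toNNReal) where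
  forall_aemeasurable n := by
    refine AEMeasurable.sub_const (AEMeasurable.const_mul ?_ _) _
    exact Finset.aemeasurable_fun_sum _ fun j _ => (hξ n j).pow_const 2
  tendsto := by
    choose d hd hfrob hcf using fun n => exists_charFun_sum_sq (hξ n) (hS n) (hpos n) (hchar n)
      (hε n)
    have hmeas : ∀ n, AEMeasurable (fun ω => γ n * ∑ j, ξ n j ω ^ 2 - m n) P := fun n =>
      AEMeasurable.sub_const (AEMeasurable.const_mul
        (Finset.aemeasurable_fun_sum _ fun j _ => (hξ n j).pow_const 2) _) _
    have hv0 : 0 ≤ v := ge_of_tendsto' hv fun n =>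
      mul_nonneg (sq_nonneg _) (Finset.sum_nonneg fun _ _ => Finset.sum_nonneg fun _ _ =>
        sq_nonneg _)
    refine ProbabilityMeasure.tendsto_iff_tendsto_charFun.2 fun t => ?_
    -- The characteristic function splits into a deterministic phase, the bias, and the product
    -- attached to the centred quadratic form.
    have key : ∀ n, charFun (P.map (fun ω => γ n * ∑ j, ξ n j ω ^ 2 - m n)) t
        = Complex.exp ((t * (γ n * ∑ j, S n j j - m n) : ℝ) * Complex.I)
          * ∏ j, charFun chiSqLaw (√2 * (t * γ n) * d n j) := by
      intro n
      rw [← hcf n (t * γ n), charFun_apply_real, integral_map (hmeas n) (by fun_prop),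
        ← integral_const_mul]
      congr 1
      ext ω
      rw [← Complex.exp_add]
      congr 1
      push_cast
      ring
    simp only [ProbabilityMeasure.coe_mk, Measure.map_id, key]
    have h1 : Tendsto (fun n => Complex.exp ((t * (γ n * ∑ j, S n j j - m n) : ℝ) * Complex.I))
        atTop (𝓝 1) := by
      have : Tendsto (fun n => ((t * (γ n * ∑ j, S n j j - m n) : ℝ) * Complex.I)) atTop
          (𝓝 (((t * 0 : ℝ) : ℂ) * Complex.I)) :=
        ((Complex.continuous_ofReal.tendsto _).comp (hm.const_mul t)).mul_const _
      simpa [Function.comp_def] using (Complex.continuous_exp.tendsto _).comp this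
    have h2 := tendsto_prod_charFun_chiSqLaw (fun n j => √2 * (t * γ n) * d n j)
      (ε := fun n => √2 * |t| * (γ n * ε n)) (by simpa using hε0.const_mul (√2 * |t|))
      (fun n j => by
        rw [abs_mul, abs_mul, abs_mul, abs_of_nonneg (hγ n), abs_of_nonneg (Real.sqrt_nonneg 2),
          abs_of_nonneg (hd n j).1]
        calc √2 * (|t| * γ n) * d n j = √2 * |t| * (γ n * d n j) := by ring
          _ ≤ _ := by
            gcongr
            · exact hγ n
            · exact (hd n j).2)
      (v := 2 * t ^ 2 * v) (by
        refine (hv.const_mul (2 * t ^ 2)).congr fun n => ?_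
        rw [← hfrob n, ← mul_assoc, Finset.mul_sum]
        refine Finset.sum_congr rfl fun j _ => ?_
        rw [mul_pow, mul_pow, Real.sq_sqrt zero_le_two]
        ring)
    have h3 := h1.mul h2
    rw [one_mul] at h3
    convert h3 using 2
    rw [charFun_gaussianReal]
    congr 1
    rw [Real.coe_toNNReal _ (by positivity)]
    push_cast
    ring

/-! ### Sine series of the Brownian bridge kernel and Riemann summability -/

lemma hasSum_of_eq {f g : ℕ → ℝ} {a b : ℝ} (h : HasSum f a) (hg : ∀ n, g n = f n) (hb : b = a) :
    HasSum g b := by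
  rw [hb, funext hg]
  exact h

lemma bernoulliTwo_eval (x : ℝ) :
    (Polynomial.map (algebraMap ℚ ℝ) (Polynomial.bernoulli 2)).eval x = x ^ 2 - x + 1 / 6 := by
  simp [Polynomial.bernoulli, Finset.sum_range_succ, bernoulli_one, bernoulli_two]
  ring

lemma hasSum_cos_div_sq {x : ℝ} (hx : x ∈ Icc (0 : ℝ) 1) :
    HasSum (fun ℓ : ℕ => 1 / ((ℓ : ℝ) + 1) ^ 2 * Real.cos (2 * Real.pi * (ℓ + 1) * x))
      (Real.pi ^ 2 * (x ^ 2 - x + 1 / 6)) := by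
  have h := hasSum_one_div_nat_pow_mul_cos one_ne_zero hx
  rw [mul_one, bernoulliTwo_eval] at h
  rw [← hasSum_nat_add_iff' 1] at h
  refine hasSum_of_eq h (fun ℓ => ?_) ?_
  · push_cast
    rfl
  -- The removed zeroth term vanishes through the convention 1/0 = 0.
  · rw [Finset.sum_range_one, show (1 : ℝ) / ((0 : ℕ) : ℝ) ^ 2 = 0 by norm_num, Nat.factorial_two]
    push_cast
    ring

/-- The sine series of the covariance function of the Brownian bridge. -/
lemma hasSum_bridge {y z : ℝ} (hy : y ∈ Icc (0 : ℝ) 1) (hz : z ∈ Icc (0 : ℝ) 1) :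
    HasSum (fun ℓ : ℕ => 2 / (Real.pi * ((ℓ : ℝ) + 1)) ^ 2 *
      (Real.sin (Real.pi * (ℓ + 1) * y) * Real.sin (Real.pi * (ℓ + 1) * z)))
      (min y z - y * z) := by
  -- Product-to-sum: 2 sin a sin b = cos(a - b) - cos(a + b). The absolute value keeps the argument
  -- in [0,1].
  have h1 := hasSum_cos_div_sq (x := |y - z| / 2) (by
    constructor
    · positivity
    · have : |y - z| ≤ 1 := abs_le.2 ⟨by linarith [hy.1, hz.2], by linarith [hy.2, hz.1]⟩
      linarith)
  have h2 := hasSum_cos_div_sq (x := (y + z) / 2) (by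
    constructor <;> linarith [hy.1, hz.1, hy.2, hz.2])
  have h3 := (h1.sub h2).mul_left (1 / Real.pi ^ 2)
  have hpi := Real.pi_ne_zero
  refine hasSum_of_eq h3 (fun ℓ => ?_) ?_
  · have e1 : Real.cos (2 * Real.pi * (ℓ + 1) * (|y - z| / 2))
        = Real.cos (Real.pi * (ℓ + 1) * y - Real.pi * (ℓ + 1) * z) := by
      rw [← mul_sub]
      rcases abs_cases (y - z) with h | h <;> rw [h.1]
      · ring_nf
      · rw [← Real.cos_neg]; ring_nf
    have e2 : 2 * Real.pi * (ℓ + 1) * ((y + z) / 2)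
        = Real.pi * (ℓ + 1) * y + Real.pi * (ℓ + 1) * z := by ring
    rw [e1, e2, Real.cos_sub, Real.cos_add]
    field_simp
    ring
  · have : min y z = (y + z - |y - z|) / 2 := by
      rcases le_total y z with h | h
      · rw [min_eq_left h, abs_of_nonpos (by linarith)]; ring
      · rw [min_eq_right h, abs_of_nonneg (by linarith)]; ring
    rw [this, div_pow, sq_abs]
    field_simp
    ring

/-- The damping factors `(2 - 2 cos(π ℓ h)) / (π ℓ h)²` of Riemann summation. -/
def riemannFactor (ℓ : ℕ) (h : ℝ) : ℝ :=
  (2 - 2 * Real.cos (Real.pi * (ℓ + 1) * h)) / (Real.pi * (ℓ + 1) * h) ^ 2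

lemma riemannFactor_nonneg (ℓ : ℕ) (h : ℝ) : 0 ≤ riemannFactor ℓ h := by
  unfold riemannFactor
  have := Real.cos_le_one (Real.pi * (ℓ + 1) * h)
  exact div_nonneg (by linarith) (sq_nonneg _)

lemma riemannFactor_le_one (ℓ : ℕ) (h : ℝ) : riemannFactor ℓ h ≤ 1 := by
  unfold riemannFactor
  refine div_le_one_of_le₀ ?_ (sq_nonneg _)
  have := Real.one_sub_sq_div_two_le_cos (x := Real.pi * (ℓ + 1) * h)
  linarith

lemma riemannFactor_le (ℓ : ℕ) {h : ℝ} (hh : 0 < h) :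
    riemannFactor ℓ h ≤ 4 / h ^ 2 * (1 / ((ℓ : ℝ) + 1) ^ 2) := by
  unfold riemannFactor
  have h1 := Real.neg_one_le_cos (Real.pi * (ℓ + 1) * h)
  have h2 : (1 : ℝ) ≤ Real.pi ^ 2 := by nlinarith [Real.pi_gt_three]
  calc _ ≤ 4 / (Real.pi * (ℓ + 1) * h) ^ 2 := by gcongr; linarith
    _ = 4 / h ^ 2 * (1 / ((ℓ : ℝ) + 1) ^ 2) / Real.pi ^ 2 := by
      have := Real.pi_ne_zero
      field_simp
    _ ≤ _ := div_le_self (by positivity) h2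

lemma tendsto_riemannFactor (ℓ : ℕ) : Tendsto (riemannFactor ℓ) (𝓝[>] 0) (𝓝 1) := by
  -- By the half-angle formula the factor is sinc²; only at h = 0 does the convention 0/0 = 0 break
  -- this, hence the limit from the right.
  have hs : ∀ h : ℝ, riemannFactor ℓ h = if h = 0 then 0 else
      Real.sinc (Real.pi * (ℓ + 1) * h / 2) ^ 2 := by
    intro h
    split_ifs with h0
    · simp [riemannFactor, h0]
    · have hne : Real.pi * (ℓ + 1) * h / 2 ≠ 0 := by
        have := Real.pi_ne_zero
        positivity
      rw [Real.sinc_of_ne_zero hne, riemannFactor, div_pow, div_pow, Real.sin_sq_eq_half_sub]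
      have : 2 * (Real.pi * (ℓ + 1) * h / 2) = Real.pi * (ℓ + 1) * h := by ring
      rw [this]
      have h3 : Real.pi * (ℓ + 1) * h ≠ 0 := fun h => hne (by rw [h]; simp)
      field_simp
  have h1 : Tendsto (fun h : ℝ => Real.sinc (Real.pi * (ℓ + 1) * h / 2) ^ 2) (𝓝[>] 0) (𝓝 1) := by
    have : Continuous (fun h : ℝ => Real.sinc (Real.pi * (ℓ + 1) * h / 2) ^ 2) := by
      have := Real.continuous_sinc
      fun_prop
    simpa using (this.tendsto 0).mono_left (nhdsWithin_le_nhds (s := Ioi 0))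
  refine h1.congr' ?_
  filter_upwards [self_mem_nhdsWithin] with h hh
  rw [hs, if_neg (ne_of_gt hh)]

lemma summable_one_div_succ_sq : Summable (fun ℓ : ℕ => 1 / ((ℓ : ℝ) + 1) ^ 2) := by
  have := (summable_nat_add_iff 1).2 (Real.summable_one_div_nat_pow.2 one_lt_two)
  simpa using this

/-- The tent function of width `h` centred at `y`, as an approximate identity. -/
def tent (h y z : ℝ) : ℝ := max 0 (h - |y - z|) / h ^ 2

lemma continuous_tent (h y : ℝ) : Continuous (tent h y) := by
  unfold tent
  fun_prop

/-- The tent is minus the second difference in y, with step h, of the bridge kernel, divided by h²;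
on the ℓ-th sine this difference acts as multiplication by 2 - 2cos(πℓh). The bounds on y keep y ± h
in [0,1]. -/
lemma hasSum_tent {h y z : ℝ} (hh : 0 < h) (h1 : h ≤ y) (h2 : y ≤ 1 - h)
    (hz : z ∈ Icc (0 : ℝ) 1) :
    HasSum (fun ℓ : ℕ => 2 * Real.sin (Real.pi * (ℓ + 1) * z) * Real.sin (Real.pi * (ℓ + 1) * y)
      * riemannFactor ℓ h) (tent h y z) := by
  have a := hasSum_bridge (y := y) (z := z) ⟨by linarith, by linarith⟩ hz
  have b := hasSum_bridge (y := y + h) (z := z) ⟨by linarith, by linarith⟩ hz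
  have c := hasSum_bridge (y := y - h) (z := z) ⟨by linarith, by linarith⟩ hz
  have d := (((a.mul_left 2).sub b).sub c).mul_left (1 / h ^ 2)
  have hpi := Real.pi_ne_zero
  refine hasSum_of_eq d (fun ℓ => ?_) ?_
  · rw [riemannFactor, mul_add (Real.pi * (ℓ + 1)) y h, mul_sub (Real.pi * (ℓ + 1)) y h,
      Real.sin_add, Real.sin_sub]
    field_simp
    ring
  · unfold tent
    rw [div_eq_mul_one_div, mul_comm]
    congr 1
    rcases le_total y z with h3 | h3
    · rw [abs_of_nonpos (by linarith)]
      rcases le_total z (y + h) with h4 | h4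
      · rw [max_eq_right (by linarith), min_eq_left h3, min_eq_right h4,
          min_eq_left (by linarith)]
        ring
      · rw [max_eq_left (by linarith), min_eq_left h3, min_eq_left h4,
          min_eq_left (by linarith)]
        ring
    · rw [abs_of_nonneg (by linarith)]
      rcases le_total (y - h) z with h4 | h4
      · rw [max_eq_right (by linarith), min_eq_right h3, min_eq_right (by linarith),
          min_eq_left h4]
        ring
      · rw [max_eq_left (by linarith), min_eq_right h3, min_eq_right (by linarith),
          min_eq_right h4]
        ring

lemma tent_nonneg (h y z : ℝ) : 0 ≤ tent h y z :=
  div_nonneg (le_max_left _ _) (sq_nonneg _)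

lemma integral_tent {h y : ℝ} (hh : 0 < h) (h1 : h ≤ y) (h2 : y ≤ 1 - h) :
    ∫ z in (0 : ℝ)..1, tent h y z = 1 := by
  have hintg : ∀ a b, IntervalIntegrable (tent h y) volume a b :=
    fun a b => (continuous_tent h y).intervalIntegrable a b
  have i1 : ∫ z in (0 : ℝ)..(y - h), tent h y z = 0 := by
    rw [intervalIntegral.integral_congr (g := fun _ => 0), intervalIntegral.integral_zero]
    intro z hz
    rw [uIcc_of_le (by linarith)] at hz
    simp only [tent]
    rw [abs_of_nonneg (by linarith [hz.2]), max_eq_left (by linarith [hz.2]), zero_div]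
  have i2 : ∫ z in (y - h)..y, tent h y z = 1 / 2 := by
    rw [intervalIntegral.integral_congr (g := fun z => (z - (y - h)) / h ^ 2)]
    · rw [intervalIntegral.integral_div, intervalIntegral.integral_comp_sub_right (fun z => z),
        integral_id]
      field_simp
      ring
    intro z hz
    rw [uIcc_of_le (by linarith)] at hz
    simp only [tent]
    rw [abs_of_nonneg (by linarith [hz.2]), max_eq_right (by linarith [hz.1])]
    ring
  have i3 : ∫ z in y..(y + h), tent h y z = 1 / 2 := by
    rw [intervalIntegral.integral_congr (g := fun z => (y + h - z) / h ^ 2)]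
    · rw [intervalIntegral.integral_div, intervalIntegral.integral_comp_sub_left (fun z => z),
        integral_id]
      field_simp
      ring
    intro z hz
    rw [uIcc_of_le (by linarith)] at hz
    simp only [tent]
    rw [abs_of_nonpos (by linarith [hz.1]), max_eq_right (by linarith [hz.2])]
    ring
  have i4 : ∫ z in (y + h)..1, tent h y z = 0 := by
    rw [intervalIntegral.integral_congr (g := fun _ => 0), intervalIntegral.integral_zero]
    intro z hz
    rw [uIcc_of_le (by linarith)] at hz
    simp only [tent]
    rw [abs_of_nonpos (by linarith [hz.1]), max_eq_left (by linarith [hz.1]), zero_div]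
  rw [← intervalIntegral.integral_add_adjacent_intervals (hintg 0 (y - h)) (hintg _ 1),
    ← intervalIntegral.integral_add_adjacent_intervals (hintg (y - h) y) (hintg _ 1),
    ← intervalIntegral.integral_add_adjacent_intervals (hintg y (y + h)) (hintg _ 1), i1, i2, i3, i4]
  norm_num

lemma tendsto_integral_tent {f : ℝ → ℝ} (hf : ContinuousOn f (Icc 0 1)) {y : ℝ}
    (hy : y ∈ Ioo (0 : ℝ) 1) :
    Tendsto (fun h => ∫ z in (0 : ℝ)..1, f z * tent h y z) (𝓝[>] 0) (𝓝 (f y)) := by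
  rw [Metric.tendsto_nhds]
  intro ε hε
  have hy' : y ∈ Icc (0 : ℝ) 1 := Ioo_subset_Icc_self hy
  obtain ⟨r, hr, hball⟩ := Metric.continuousWithinAt_iff.1 (hf y hy') (ε / 2) (half_pos hε)
  have hpos : 0 < min r (min y (1 - y)) := by
    refine lt_min hr (lt_min hy.1 ?_)
    linarith [hy.2]
  filter_upwards [Ioo_mem_nhdsGT hpos] with h hh
  have hh1 : h < r := hh.2.trans_le (min_le_left _ _)
  have hh2 : h ≤ y := (hh.2.le.trans (min_le_right _ _)).trans (min_le_left _ _)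
  have hh3 : h ≤ 1 - y := (hh.2.le.trans (min_le_right _ _)).trans (min_le_right _ _)
  have hintg := integral_tent hh.1 hh2 (by linarith)
  have hti : IntervalIntegrable (tent h y) volume 0 1 :=
    (continuous_tent h y).intervalIntegrable 0 1
  have hfi : IntervalIntegrable (fun z => f z * tent h y z) volume 0 1 := by
    refine ContinuousOn.intervalIntegrable ?_
    rw [uIcc_of_le zero_le_one]
    exact hf.mul (continuous_tent h y).continuousOn
  have e : (∫ z in (0 : ℝ)..1, f z * tent h y z) - f y
      = ∫ z in (0 : ℝ)..1, (f z * tent h y z - f y * tent h y z) := by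
    rw [intervalIntegral.integral_sub hfi (hti.const_mul _), intervalIntegral.integral_const_mul,
      hintg, mul_one]
  rw [Real.dist_eq, e, ← Real.norm_eq_abs]
  have hbound : ‖∫ z in (0 : ℝ)..1, (f z * tent h y z - f y * tent h y z)‖
      ≤ ∫ z in (0 : ℝ)..1, ε / 2 * tent h y z := by
    refine intervalIntegral.norm_integral_le_of_norm_le zero_le_one (ae_of_all _ fun z hz => ?_)
      (hti.const_mul _)
    rw [← sub_mul, norm_mul, Real.norm_of_nonneg (tent_nonneg _ _ _)]
    by_cases hd : |y - z| < h
    · refine mul_le_mul_of_nonneg_right ?_ (tent_nonneg _ _ _)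
      have := hball (x := z) ⟨hz.1.le, hz.2⟩ (by
        rw [Real.dist_eq, abs_sub_comm]
        exact hd.trans hh1)
      rw [Real.dist_eq] at this
      exact this.le
    · have : tent h y z = 0 := by
        rw [tent, max_eq_left (by linarith), zero_div]
      simp [this]
  rw [intervalIntegral.integral_const_mul, hintg] at hbound
  linarith

/-- Termwise integration of the sine series of the tent function. -/
lemma hasSum_integral_tent {f : ℝ → ℝ} (hf : ContinuousOn f (Icc 0 1)) {h y : ℝ} (hh : 0 < h)
    (h1 : h ≤ y) (h2 : y ≤ 1 - h) :
    HasSum (fun ℓ : ℕ => 2 * (∫ z in (0 : ℝ)..1, f z * Real.sin (Real.pi * (ℓ + 1) * z))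
      * Real.sin (Real.pi * (ℓ + 1) * y) * riemannFactor ℓ h)
      (∫ z in (0 : ℝ)..1, f z * tent h y z) := by
  obtain ⟨C, hC⟩ := isCompact_Icc.exists_bound_of_continuousOn hf
  have key := intervalIntegral.hasSum_integral_of_dominated_convergence (μ := volume)
    (a := (0 : ℝ)) (b := 1)
    (F := fun (ℓ : ℕ) z => f z * (2 * Real.sin (Real.pi * (ℓ + 1) * z)
      * Real.sin (Real.pi * (ℓ + 1) * y) * riemannFactor ℓ h))
    (f := fun z => f z * tent h y z)
    (fun ℓ _ => C * (2 * (4 / h ^ 2 * (1 / ((ℓ : ℝ) + 1) ^ 2))))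
    (fun ℓ => by
      rw [uIoc_of_le zero_le_one]
      refine ContinuousOn.aestronglyMeasurable ?_ measurableSet_Ioc
      exact (hf.mono Ioc_subset_Icc_self).mul (Continuous.continuousOn (by fun_prop)))
    (fun ℓ => ae_of_all _ fun z hz => by
      rw [uIoc_of_le zero_le_one] at hz
      have hfz := hC z ⟨hz.1.le, hz.2⟩
      rw [norm_mul]
      refine mul_le_mul hfz ?_ (norm_nonneg _) ((norm_nonneg _).trans hfz)
      rw [norm_mul, norm_mul, norm_mul, Real.norm_of_nonneg (riemannFactor_nonneg ℓ h),
        Real.norm_eq_abs, Real.norm_eq_abs, Real.norm_eq_abs, abs_two]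
      calc 2 * |Real.sin (Real.pi * (ℓ + 1) * z)| * |Real.sin (Real.pi * (ℓ + 1) * y)|
            * riemannFactor ℓ h
          ≤ 2 * 1 * 1 * (4 / h ^ 2 * (1 / ((ℓ : ℝ) + 1) ^ 2)) := by
            gcongr
            · exact riemannFactor_nonneg ℓ h
            · exact Real.abs_sin_le_one _
            · exact Real.abs_sin_le_one _
            · exact riemannFactor_le ℓ hh
        _ = _ := by ring)
    (ae_of_all _ fun z _ => ((summable_one_div_succ_sq.mul_left _).mul_left _).mul_left _)
    (by simp)
    (ae_of_all _ fun z hz => by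
      rw [uIoc_of_le zero_le_one] at hz
      exact (hasSum_tent hh h1 h2 ⟨hz.1.le, hz.2⟩).mul_left (f z))
  refine hasSum_of_eq key (fun ℓ => ?_) rfl
  rw [← intervalIntegral.integral_const_mul, ← intervalIntegral.integral_mul_const,
    ← intervalIntegral.integral_mul_const]
  congr 1
  ext z
  ring

/-! ### Ornstein-Uhlenbeck processes -/

/-- Stieltjes sums of `e^{λ s}` against the noise of a linear equation `du + λ u ds = dD`. -/
lemma tendsto_stieltjes_sum {u : ℝ → ℝ} (hu : ContinuousOn u (Ici 0)) (lam : ℝ) {Δ : ℝ}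
    (hΔ : 0 ≤ Δ) (m : ℕ) (D : ℕ → ℕ → ℝ)
    (hD : ∀ K j : ℕ, D K j = u ((j + 1) * (Δ / (K + 1))) - u (j * (Δ / (K + 1)))
      + lam * ∫ s in (j * (Δ / (K + 1)))..((j + 1) * (Δ / (K + 1))), u s) :
    Tendsto (fun K : ℕ => ∑ j ∈ Finset.range (m * (K + 1)),
      Real.exp (lam * (j * (Δ / (K + 1)))) * D K j) atTop
      (𝓝 (Real.exp (lam * (m * Δ)) * u (m * Δ) - u 0)) := by
  -- The exponential and u are evaluated at separate times because the error below compares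
  -- e^{λa}u(s) with e^{λs}u(b).
  have huc : UniformContinuousOn (fun p : ℝ × ℝ => Real.exp (lam * p.1) * u p.2)
      (Icc 0 (m * Δ) ×ˢ Icc 0 (m * Δ)) := by
    refine (isCompact_Icc.prod isCompact_Icc).uniformContinuousOn_of_continuous ?_
    refine ContinuousOn.mul (Continuous.continuousOn (by fun_prop)) ?_
    exact hu.comp continuous_snd.continuousOn fun p hp => hp.2.1
  rw [Metric.tendsto_atTop]
  intro ε hε
  set η : ℝ := ε / (2 * (|lam| * (m * Δ) + 1)) with hη
  have hηpos : 0 < η := by positivity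
  obtain ⟨r, hr, hball⟩ := Metric.uniformContinuousOn_iff.1 huc η hηpos
  have hlim : Tendsto (fun K : ℕ => Δ / ((K : ℝ) + 1)) atTop (𝓝 0) := by
    simpa [Function.comp_def] using
      (tendsto_const_div_atTop_nhds_zero_nat Δ).comp (tendsto_add_atTop_nat 1)
  obtain ⟨K₀, hK₀⟩ := (hlim.eventually_lt_const hr).exists_forall_of_atTop
  refine ⟨K₀, fun K hK => ?_⟩
  set h : ℝ := Δ / (K + 1) with hh
  have hh0 : 0 ≤ h := by positivity
  have hhr : h < r := hK₀ K hK
  have hJ : ((m * (K + 1) : ℕ) : ℝ) * h = m * Δ := by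
    rw [hh]
    push_cast
    field_simp
  have htel : Real.exp (lam * (m * Δ)) * u (m * Δ) - u 0
      = ∑ j ∈ Finset.range (m * (K + 1)), (Real.exp (lam * ((j + 1 : ℕ) * h)) * u ((j + 1 : ℕ) * h)
        - Real.exp (lam * (j * h)) * u (j * h)) := by
    rw [Finset.sum_range_sub (fun j : ℕ => Real.exp (lam * (j * h)) * u (j * h)), hJ]
    simp
  rw [htel, Real.dist_eq, ← Finset.sum_sub_distrib, ← Real.norm_eq_abs]
  have hterm : ∀ j ∈ Finset.range (m * (K + 1)),
      ‖Real.exp (lam * (j * h)) * D K j - (Real.exp (lam * ((j + 1 : ℕ) * h)) * u ((j + 1 : ℕ) * h)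
        - Real.exp (lam * (j * h)) * u (j * h))‖ ≤ |lam| * η * h := by
    intro j hj
    have hj1 : ((j : ℝ) + 1) * h ≤ m * Δ := by
      rw [← hJ]
      refine mul_le_mul_of_nonneg_right ?_ hh0
      exact_mod_cast Finset.mem_range.1 hj
    have hj0 : 0 ≤ (j : ℝ) * h := by positivity
    have hjj : (j : ℝ) * h ≤ (j + 1) * h := by nlinarith
    have hintg : IntervalIntegrable u volume (j * h) ((j + 1) * h) := by
      refine ContinuousOn.intervalIntegrable (hu.mono ?_)
      rw [uIcc_of_le hjj]
      exact fun s hs => hj0.trans hs.1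
    have hintg2 : IntervalIntegrable (fun s => Real.exp (lam * s)) volume (j * h) ((j + 1) * h) :=
      Continuous.intervalIntegrable (by fun_prop) _ _
    have hexp : Real.exp (lam * ((j + 1) * h)) - Real.exp (lam * (j * h))
        = lam * ∫ s in (j * h)..((j + 1) * h), Real.exp (lam * s) := by
      rw [← intervalIntegral.integral_const_mul]
      symm
      refine intervalIntegral.integral_eq_sub_of_hasDerivAt
        (f := fun s => Real.exp (lam * s)) (fun s _ => ?_) (hintg2.const_mul lam)
      have := ((hasDerivAt_id s).const_mul lam).exp
      simpa [mul_comm] using this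
    -- Integration by parts on one cell [a, b]: writing e^{λb} - e^{λa} as an integral leaves λ
    -- times an integrand bounded by η.
    have e : Real.exp (lam * (j * h)) * D K j
        - (Real.exp (lam * ((j + 1 : ℕ) * h)) * u ((j + 1 : ℕ) * h)
        - Real.exp (lam * (j * h)) * u (j * h))
        = lam * ∫ s in (j * h)..((j + 1) * h),
          (Real.exp (lam * (j * h)) * u s - Real.exp (lam * s) * u ((j + 1) * h)) := by
      rw [intervalIntegral.integral_sub (hintg.const_mul _) (hintg2.mul_const _),
        intervalIntegral.integral_const_mul, intervalIntegral.integral_mul_const, mul_sub,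
        ← mul_assoc lam (intervalIntegral _ _ _ _), ← hexp, hD K j, ← hh]
      push_cast
      ring
    rw [e, norm_mul, Real.norm_eq_abs, mul_assoc]
    refine mul_le_mul_of_nonneg_left ?_ (abs_nonneg _)
    have hb := intervalIntegral.norm_integral_le_of_norm_le_const (a := j * h) (b := (j + 1) * h)
      (C := η) (f := fun s => Real.exp (lam * (j * h)) * u s
        - Real.exp (lam * s) * u ((j + 1) * h)) (fun s hs => by
        rw [uIoc_of_le hjj] at hs
        have := hball (j * h, s) ⟨⟨hj0, hjj.trans hj1⟩, ⟨hj0.trans hs.1.le, hs.2.trans hj1⟩⟩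
          (s, (j + 1) * h) ⟨⟨hj0.trans hs.1.le, hs.2.trans hj1⟩, ⟨hj0.trans hjj, hj1⟩⟩ (by
            rw [Prod.dist_eq, max_lt_iff, Real.dist_eq, Real.dist_eq]
            constructor
            · rw [abs_of_nonpos (by linarith [hs.1])]
              linarith [hs.2]
            · rw [abs_of_nonpos (by linarith [hs.2])]
              linarith [hs.1])
        rw [Real.dist_eq] at this
        exact this.le)
    refine hb.trans (le_of_eq ?_)
    rw [show ((j : ℝ) + 1) * h - j * h = h by ring, abs_of_nonneg hh0]
  calc _ ≤ ∑ j ∈ Finset.range (m * (K + 1)), |lam| * η * h := norm_sum_le_of_le _ hterm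
    _ = |lam| * (m * Δ) * η := by
      rw [Finset.sum_const, Finset.card_range, nsmul_eq_mul, ← hJ]
      ring
    _ ≤ (|lam| * (m * Δ) + 1) * η := by gcongr; linarith
    _ = ε / 2 := by
      rw [hη]
      field_simp
    _ < ε := by linarith

/-- The previous limit for the constant function 1/a: its increments vanish and the drift term
contributes exactly the cell length. -/
lemma tendsto_geometric_riemann_sum {a : ℝ} (ha : a ≠ 0) {Δ : ℝ} (hΔ : 0 ≤ Δ) (m : ℕ) :
    Tendsto (fun K : ℕ => ∑ j ∈ Finset.range (m * (K + 1)),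
      Real.exp (a * (j * (Δ / (K + 1)))) * (Δ / (K + 1))) atTop
      (𝓝 ((Real.exp (a * (m * Δ)) - 1) / a)) := by
  have := tendsto_stieltjes_sum (u := fun _ => 1 / a) continuousOn_const a hΔ m
    (fun K _ => Δ / (K + 1)) (fun K j => by
      rw [intervalIntegral.integral_const, smul_eq_mul]
      field_simp
      ring)
  convert this using 2
  ring

lemma integral_exp_eq_charFun_one {Ω : Type*} [MeasurableSpace Ω] {P : Measure Ω} {Z : Ω → ℝ}
    (hZ : AEMeasurable Z P) :
    ∫ ω, Complex.exp ((Z ω : ℝ) * Complex.I) ∂P = charFun (P.map Z) 1 := by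
  rw [charFun_apply_real, integral_map hZ (by fun_prop)]
  simp

/-- Fourier transform of a linear combination of Brownian increments on a uniform grid. -/
lemma integral_exp_brownian_increments {Ω : Type*} [MeasurableSpace Ω] {P : Measure Ω}
    {B : ℝ≥0 → Ω → ℝ} (hB : IsPreBrownianReal B P) (h : ℝ≥0) (c : ℕ → ℝ) (J : ℕ) :
    ∫ ω, Complex.exp ((∑ j ∈ Finset.range J,
        c j * (B ((j + 1 : ℕ) * h) ω - B (j * h) ω) : ℝ) * Complex.I) ∂P
      = Complex.exp (-((∑ j ∈ Finset.range J, c j ^ 2 * h) / 2 : ℝ)) := by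
  have : IsProbabilityMeasure P := hB.isGaussianProcess.isProbabilityMeasure
  have hm : ∀ j : ℕ, AEMeasurable (fun ω => c j * (B ((j + 1 : ℕ) * h) ω - B (j * h) ω)) P :=
    fun j => ((hB.aemeasurable _).sub (hB.aemeasurable _)).const_mul _
  have hmono : Monotone (fun j : ℕ => (j : ℝ≥0) * h) := fun i j hij => by
    refine mul_le_mul_left ?_ h
    exact_mod_cast hij
  have hind := ((hB.hasIndepIncrements.nat hmono).comp (fun j x => c j * x)
    (fun j => by fun_prop))
  rw [integral_exp_eq_charFun_one (Finset.aemeasurable_fun_sum _ fun j _ => hm j),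
    iIndepFun.charFun_map_fun_finsetSum_eq_prod
      (X := fun (j : ℕ) ω => c j * (B ((j + 1 : ℕ) * h) ω - B (j * h) ω))
      (fun j _ => hm j) (hind.restrict _), Finset.prod_apply]
  have hcf : ∀ j : ℕ, charFun (P.map (fun ω => c j * (B ((j + 1 : ℕ) * h) ω - B (j * h) ω))) 1
      = Complex.exp (-((c j ^ 2 * h) / 2 : ℝ)) := by
    intro j
    have hl := gaussianReal_const_mul (hB.hasLaw_sub ((j + 1 : ℕ) * h) (j * h)) (c j)
    have e := hl.map_eq
    simp only [Pi.sub_apply] at e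
    rw [e, charFun_gaussianReal]
    congr 1
    have hd : nndist (((j + 1 : ℕ) : ℝ≥0) * h).1 ((j : ℝ≥0) * h).1 = h := by
      ext
      rw [coe_nndist, Real.dist_eq]
      change |((((j + 1 : ℕ) : ℝ≥0) * h : ℝ≥0) : ℝ) - (((j : ℝ≥0) * h : ℝ≥0) : ℝ)| = (h : ℝ)
      push_cast
      rw [show ((j : ℝ) + 1) * h - j * h = h by ring, abs_of_nonneg h.coe_nonneg]
    rw [hd]
    push_cast
    simp
  simp_rw [hcf]
  rw [← Complex.exp_sum]
  congr 1
  push_cast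
  rw [Finset.sum_div, Finset.sum_neg_distrib]

/-- The stochastic convolution of an Ornstein-Uhlenbeck equation driven by a Brownian motion `B` is,
along a time grid, an almost sure limit of Gaussian random variables which are measurable with
respect to `B` and whose variances converge. -/
lemma exists_approx_stochastic_convolution {Ω : Type*} [MeasurableSpace Ω] {P : Measure Ω}
    {B : ℝ≥0 → Ω → ℝ} (hB : IsPreBrownianReal B P) {u : ℝ → Ω → ℝ}
    (hu : ∀ ω, ContinuousOn (fun t => u t ω) (Ici 0)) {lam σ : ℝ} (hlam : lam ≠ 0)
    (hB0 : ∀ t : ℝ≥0, ∀ᵐ ω ∂P, u t ω = u 0 ω + (∫ s in (0 : ℝ)..t, -lam * u s ω) + σ * B t ω)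
    {ι : Type*} [Fintype ι] (m : ι → ℕ) (p : ι → ℝ) (Δ : ℝ≥0) :
    ∃ (Y : ℕ → Ω → ℝ) (v : ℕ → ℝ),
      (∀ K, Measurable[⨆ t : ℝ≥0, MeasurableSpace.comap (B t) inferInstance] (Y K)) ∧
      (∀ K, ∫ ω, Complex.exp ((Y K ω : ℝ) * Complex.I) ∂P = Complex.exp (-(v K / 2 : ℝ))) ∧
      Tendsto v atTop (𝓝 (∑ i, ∑ j, p i * p j * (σ ^ 2 *
        (Real.exp (-lam * (m i * Δ)) * Real.exp (-lam * (m j * Δ)) *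
          ((Real.exp (2 * lam * ((min (m i) (m j) : ℕ) * Δ)) - 1) / (2 * lam)))))) ∧
      ∀ᵐ ω ∂P, Tendsto (fun K => Y K ω) atTop
        (𝓝 (∑ j, p j * (u (m j * Δ) ω - Real.exp (-lam * (m j * Δ)) * u 0 ω))) := by
  -- A common horizon for all grid times: the sums run up to J(K+1), and indicators cut each one at
  -- its own time m j.
  set J : ℕ := ∑ j, m j with hJ
  have hmJ : ∀ j, m j ≤ J := fun j => Finset.single_le_sum (fun _ _ => Nat.zero_le _)
    (Finset.mem_univ j)
  -- Variation of constants: u(t) - e^{-λt}u(0) is e^{-λt} times the σ-weighted integral of e^{λs}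
  -- against B. The random variables below are its left-point sums.
  set q : ι → ℝ := fun j => p j * Real.exp (-lam * (m j * Δ)) with hq
  set c : ℕ → ℕ → ℝ := fun K i => σ * Real.exp (lam * (i * (Δ / (K + 1)))) *
    ∑ j, if i < m j * (K + 1) then q j else 0 with hc
  set h : ℕ → ℝ≥0 := fun K => Δ / (K + 1) with hh
  have hcoe : ∀ K, ((h K : ℝ≥0) : ℝ) = Δ / (K + 1) := fun K => by rw [hh]; push_cast; rfl
  have hfilter : ∀ (K n : ℕ), n ≤ J → ∀ g : ℕ → ℝ,
      ∑ i ∈ Finset.range (J * (K + 1)), (if i < n * (K + 1) then g i else 0)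
        = ∑ i ∈ Finset.range (n * (K + 1)), g i := by
    intro K n hn g
    rw [← Finset.sum_filter]
    congr 1
    ext i
    simp only [Finset.mem_filter, Finset.mem_range]
    have : n * (K + 1) ≤ J * (K + 1) := Nat.mul_le_mul_right _ hn
    omega
  refine ⟨fun K ω => ∑ i ∈ Finset.range (J * (K + 1)),
    c K i * (B ((i + 1 : ℕ) * h K) ω - B (i * h K) ω),
    fun K => ∑ i ∈ Finset.range (J * (K + 1)), c K i ^ 2 * h K, ?_, ?_, ?_, ?_⟩
  · intro K
    have hBm : ∀ t, Measurable[⨆ t : ℝ≥0, MeasurableSpace.comap (B t) inferInstance] (B t) :=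
      fun t => Measurable.mono (comap_measurable (B t))
        (le_iSup (fun t : ℝ≥0 => MeasurableSpace.comap (B t) inferInstance) t) le_rfl
    refine Finset.measurable_fun_sum _ fun i _ => ?_
    exact Measurable.const_mul (Measurable.sub (hBm _) (hBm _)) _
  · intro K
    exact integral_exp_brownian_increments hB (h K) (c K) _
  -- The variance is a double sum of left Riemann sums of e^{2λs} up to the smaller of the two
  -- times.
  · have hlim : ∀ i j, Tendsto (fun K : ℕ => q i * q j * (σ ^ 2 *
        ∑ k ∈ Finset.range (min (m i) (m j) * (K + 1)),
          Real.exp (2 * lam * (k * (Δ / (K + 1)))) * (Δ / (K + 1)))) atTop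
        (𝓝 (q i * q j * (σ ^ 2 *
          ((Real.exp (2 * lam * ((min (m i) (m j) : ℕ) * Δ)) - 1) / (2 * lam))))) := by
      intro i j
      refine Tendsto.const_mul _ (Tendsto.const_mul _ ?_)
      exact tendsto_geometric_riemann_sum (mul_ne_zero two_ne_zero hlam) Δ.coe_nonneg
        (min (m i) (m j))
    have hsum := tendsto_finsetSum Finset.univ fun i _ =>
      tendsto_finsetSum Finset.univ fun j _ => hlim i j
    refine (hsum.congr fun K => ?_).trans (le_of_eq ?_)
    · have e : ∀ k : ℕ, c K k ^ 2 * (h K : ℝ) = ∑ i, ∑ j, q i * q j * σ ^ 2 *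
          (if k < min (m i) (m j) * (K + 1) then
            Real.exp (2 * lam * (k * (Δ / (K + 1)))) * (Δ / (K + 1)) else 0) := by
        intro k
        have e1 : Real.exp (2 * lam * (k * (Δ / (K + 1))))
            = Real.exp (lam * (k * (Δ / (K + 1)))) ^ 2 := by
          rw [sq, ← Real.exp_add]
          congr 1
          ring
        rw [hcoe, hc, mul_pow, mul_pow, sq (∑ j, _), Finset.sum_mul_sum, Finset.mul_sum,
          Finset.sum_mul]
        refine Finset.sum_congr rfl fun i _ => ?_
        rw [Finset.mul_sum, Finset.sum_mul]
        refine Finset.sum_congr rfl fun j _ => ?_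
        have e2 : k < min (m i) (m j) * (K + 1) ↔ k < m i * (K + 1) ∧ k < m j * (K + 1) := by
          rcases le_total (m i) (m j) with h | h
          · have := Nat.mul_le_mul_right (K + 1) h
            rw [min_eq_left h]
            omega
          · have := Nat.mul_le_mul_right (K + 1) h
            rw [min_eq_right h]
            omega
        rw [e1]
        by_cases h1 : k < m i * (K + 1) <;> by_cases h2 : k < m j * (K + 1) <;>
          simp only [e2, h1, h2, if_true, if_false, and_true, and_false, and_self]
        all_goals ring
      simp_rw [e]
      conv_rhs => rw [Finset.sum_comm]
      refine Finset.sum_congr rfl fun i _ => ?_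
      conv_rhs => rw [Finset.sum_comm]
      refine Finset.sum_congr rfl fun j _ => ?_
      rw [← Finset.mul_sum, hfilter K _ ((min_le_left _ _).trans (hmJ i))]
      ring
    · congr 1
      refine Finset.sum_congr rfl fun i _ => Finset.sum_congr rfl fun j _ => ?_
      rw [hq]
      ring
  -- Only countably many grid points occur, so the equation holds at all of them off a single null
  -- set.
  · have hae : ∀ᵐ ω ∂P, ∀ K i : ℕ, u ((i * h K : ℝ≥0) : ℝ) ω = u 0 ω
        + (∫ s in (0 : ℝ)..((i * h K : ℝ≥0) : ℝ), -lam * u s ω) + σ * B (i * h K) ω := by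
      rw [ae_all_iff]
      intro K
      rw [ae_all_iff]
      exact fun i => hB0 _
    filter_upwards [hae] with ω hω
    have hst : ∀ j, Tendsto (fun K : ℕ => q j * ∑ i ∈ Finset.range (m j * (K + 1)),
        Real.exp (lam * (i * (Δ / (K + 1)))) *
          (σ * (B ((i + 1 : ℕ) * h K) ω - B (i * h K) ω))) atTop
        (𝓝 (q j * (Real.exp (lam * (m j * Δ)) * u (m j * Δ) ω - u 0 ω))) := by
      intro j
      refine Tendsto.const_mul _ ?_
      refine tendsto_stieltjes_sum (hu ω) lam Δ.coe_nonneg (m j)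
        (fun K i => σ * (B ((i + 1 : ℕ) * h K) ω - B (i * h K) ω)) fun K i => ?_
      have h1 := hω K (i + 1)
      have h2 := hω K i
      have hintg : ∀ a b : ℝ, 0 ≤ a → 0 ≤ b → IntervalIntegrable (fun s => u s ω) volume a b := by
        intro a b ha hb
        refine ContinuousOn.intervalIntegrable ((hu ω).mono fun s hs => ?_)
        exact (le_min ha hb).trans hs.1
      rw [intervalIntegral.integral_const_mul] at h1 h2
      rw [NNReal.coe_mul, hcoe, NNReal.coe_natCast] at h1 h2
      have h3 := intervalIntegral.integral_interval_sub_left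
        (hintg 0 ((i + 1 : ℕ) * (Δ / (K + 1))) le_rfl (by positivity))
        (hintg 0 (i * (Δ / (K + 1))) le_rfl (by positivity))
      push_cast at h1 h2 h3 ⊢
      rw [← h3, h1, h2]
      ring
    have hsum := tendsto_finsetSum Finset.univ fun j _ => hst j
    refine (hsum.congr fun K => ?_).trans (le_of_eq ?_)
    · simp_rw [Finset.mul_sum]
      have e : ∀ j, ∑ i ∈ Finset.range (m j * (K + 1)), q j *
          (Real.exp (lam * (i * (Δ / (K + 1)))) * (σ * (B ((i + 1 : ℕ) * h K) ω - B (i * h K) ω)))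
          = ∑ i ∈ Finset.range (J * (K + 1)), (if i < m j * (K + 1) then q j *
          (Real.exp (lam * (i * (Δ / (K + 1)))) * (σ * (B ((i + 1 : ℕ) * h K) ω - B (i * h K) ω)))
          else 0) := fun j => (hfilter K _ (hmJ j) _).symm
      simp_rw [e]
      rw [Finset.sum_comm]
      refine Finset.sum_congr rfl fun i _ => ?_
      simp only [hc]
      rw [Finset.mul_sum, Finset.sum_mul]
      refine Finset.sum_congr rfl fun j _ => ?_
      split_ifs <;> ring
    · congr 1
      refine Finset.sum_congr rfl fun j _ => ?_
      have : Real.exp (-lam * (m j * Δ)) * Real.exp (lam * (m j * Δ)) = 1 := by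
        rw [← Real.exp_add, neg_mul, neg_add_cancel, Real.exp_zero]
      rw [hq]
      linear_combination (p j * u (m j * Δ) ω) * this

/-! ### Fourier modes of the weak solution -/

/-- `Z` is a random variable whose characteristic function at `1` is that of a centred Gaussian
variable of variance `v`. -/
structure HasGaussTransform {Ω : Type*} [MeasurableSpace Ω] (Z : Ω → ℝ) (v : ℝ)
    (P : Measure Ω) : Prop where
  aemeasurable : AEMeasurable Z P
  integral_exp : ∫ ω, Complex.exp ((Z ω : ℝ) * Complex.I) ∂P = Complex.exp (-(v / 2 : ℝ))

/-- Dominated convergence, as |e^{iZ}| = 1. The general filter serves both the partial sums of a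
series and the limit h ↓ 0. -/
lemma HasGaussTransform.of_tendsto {Ω : Type*} [MeasurableSpace Ω] {P : Measure Ω}
    [IsProbabilityMeasure P] {α : Type*} {l : Filter α} [l.NeBot] [l.IsCountablyGenerated]
    {Z : α → Ω → ℝ} {v : α → ℝ} {Z' : Ω → ℝ} {v' : ℝ}
    (h : ∀ᶠ n in l, HasGaussTransform (Z n) (v n) P)
    (hZ : ∀ᵐ ω ∂P, Tendsto (fun n => Z n ω) l (𝓝 (Z' ω))) (hv : Tendsto v l (𝓝 v')) :
    HasGaussTransform Z' v' P := by
  obtain ⟨ns, hns, hG⟩ := exists_seq_forall_of_frequently h.frequently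
  have hZ' : ∀ᵐ ω ∂P, Tendsto (fun k => Z (ns k) ω) atTop (𝓝 (Z' ω)) := by
    filter_upwards [hZ] with ω hω using hω.comp hns
  refine ⟨aemeasurable_of_tendsto_metrizable_ae atTop (fun k => (hG k).aemeasurable) hZ', ?_⟩
  have h1 : Tendsto (fun k => ∫ ω, Complex.exp ((Z (ns k) ω : ℝ) * Complex.I) ∂P) atTop
      (𝓝 (∫ ω, Complex.exp ((Z' ω : ℝ) * Complex.I) ∂P)) := by
    refine tendsto_integral_of_dominated_convergence (fun _ => 1) (fun k => ?_)
      (integrable_const _) (fun k => ae_of_all _ fun ω => ?_) ?_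
    · have := (hG k).aemeasurable
      exact AEMeasurable.aestronglyMeasurable (by fun_prop)
    · rw [Complex.norm_exp_ofReal_mul_I]
    · filter_upwards [hZ'] with ω hω
      refine (Complex.continuous_exp.tendsto _).comp (Tendsto.mul_const _ ?_)
      exact (Complex.continuous_ofReal.tendsto _).comp hω
  have h2 : Tendsto (fun k => ∫ ω, Complex.exp ((Z (ns k) ω : ℝ) * Complex.I) ∂P) atTop
      (𝓝 (Complex.exp (-(v' / 2 : ℝ)))) := by
    simp_rw [fun k => (hG k).integral_exp]
    refine (Complex.continuous_exp.tendsto _).comp (Tendsto.neg ?_)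
    exact (Complex.continuous_ofReal.tendsto _).comp ((hv.comp hns).div_const 2)
  exact tendsto_nhds_unique h1 h2

lemma HasGaussTransform.sum {Ω : Type*} [MeasurableSpace Ω] {P : Measure Ω}
    {α : Type*} {Z : α → Ω → ℝ} {v : α → ℝ} (s : Finset α) (hind : iIndepFun Z P)
    (h : ∀ i ∈ s, HasGaussTransform (Z i) (v i) P) :
    HasGaussTransform (fun ω => ∑ i ∈ s, Z i ω) (∑ i ∈ s, v i) P := by
  have hm : AEMeasurable (fun ω => ∑ i ∈ s, Z i ω) P :=
    Finset.aemeasurable_fun_sum _ fun i hi => (h i hi).aemeasurable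
  refine ⟨hm, ?_⟩
  rw [integral_exp_eq_charFun_one hm, iIndepFun.charFun_map_fun_finsetSum_eq_prod
    (fun i hi => (h i hi).aemeasurable) (hind.restrict _), Finset.prod_apply]
  rw [Finset.prod_congr rfl fun i hi => by
    rw [← integral_exp_eq_charFun_one (h i hi).aemeasurable, (h i hi).integral_exp],
    ← Complex.exp_sum]
  congr 1
  push_cast
  rw [Finset.sum_div, Finset.sum_neg_distrib]

lemma hasGaussTransform_of_hasLaw {Ω : Type*} [MeasurableSpace Ω] {P : Measure Ω}
    {Z : Ω → ℝ} {v : ℝ} (hv : 0 ≤ v) (h : HasLaw Z (gaussianReal 0 v.toNNReal) P) (c : ℝ) :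
    HasGaussTransform (fun ω => c * Z ω) (c ^ 2 * v) P := by
  have hm : AEMeasurable (fun ω => c * Z ω) P := h.aemeasurable.const_mul c
  refine ⟨hm, ?_⟩
  rw [integral_exp_eq_charFun_one hm, (gaussianReal_const_mul h c).map_eq, charFun_gaussianReal]
  congr 1
  push_cast
  rw [Real.coe_toNNReal _ hv]
  simp

/-- If Γ ≥ 0 drop it; if Γ < 0 use Γ ≥ Γℓ². The bound yields both positivity of the eigenvalues and
summability of their inverses. -/
lemma eigval_lower_bound {ϑ₂ ϑ₁ ϑ₀ : ℝ} (hϑ₂ : 0 < ϑ₂)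
    (hΓ : 0 < ϑ₁ ^ 2 / (4 * ϑ₂ ^ 2) - ϑ₀ / ϑ₂ + Real.pi ^ 2) :
    ∃ c > 0, ∀ ℓ : ℕ, c * ((ℓ : ℝ) + 1) ^ 2 ≤ eigval ϑ₂ ϑ₁ ϑ₀ (ℓ + 1) := by
  set G := Gam ϑ₂ ϑ₁ ϑ₀ with hG
  have hG' : 0 < G + Real.pi ^ 2 := by rw [hG, Gam]; exact hΓ
  have hpi : 0 < Real.pi ^ 2 := by positivity
  refine ⟨ϑ₂ * min (Real.pi ^ 2) (G + Real.pi ^ 2), by positivity, fun ℓ => ?_⟩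
  rw [eigval, ← hG, mul_assoc]
  refine mul_le_mul_of_nonneg_left ?_ hϑ₂.le
  push_cast
  have h1 : (1 : ℝ) ≤ ((ℓ : ℝ) + 1) ^ 2 := by
    have : (0 : ℝ) ≤ ℓ := Nat.cast_nonneg ℓ
    nlinarith
  rcases le_total 0 G with h | h
  · rw [min_eq_left (by linarith)]
    linarith
  · rw [min_eq_right (by linarith)]
    nlinarith

lemma hasDerivAt_mul_exp_neg_half {p : ℝ → ℝ} {p' x : ℝ} (κ : ℝ) (hp : HasDerivAt p p' x) :
    HasDerivAt (fun x => p x * Real.exp (-κ * x / 2))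
      ((p' - κ / 2 * p x) * Real.exp (-κ * x / 2)) x := by
  have h : HasDerivAt (fun x : ℝ => -κ * x / 2) (-κ / 2) x := by
    simpa using ((hasDerivAt_id x).const_mul (-κ)).div_const 2
  exact (hp.mul h.exp).congr_deriv (by ring)

lemma contDiff_eigfun (κ : ℝ) (ℓ : ℕ) : ContDiff ℝ 2 (eigfun κ ℓ) := by
  unfold eigfun
  fun_prop

/-- The factor e^{-κx/2} cancels the first order term: acting on f e^{-κx/2}, the operator becomes
ϑ₂f'' - ϑ₂Γf times the same factor. -/
lemma opA_eigfun {ϑ₂ ϑ₁ ϑ₀ : ℝ} (hϑ₂ : 0 < ϑ₂) (ℓ : ℕ) (x : ℝ) :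
    opA ϑ₂ ϑ₁ ϑ₀ (eigfun (kappa ϑ₂ ϑ₁) ℓ) x
      = -eigval ϑ₂ ϑ₁ ϑ₀ ℓ * eigfun (kappa ϑ₂ ϑ₁) ℓ x := by
  set κ := kappa ϑ₂ ϑ₁ with hκ
  set a : ℝ := Real.pi * ℓ with ha
  have hs : ∀ x, HasDerivAt (fun x => Real.sin (a * x)) (a * Real.cos (a * x)) x := fun x => by
    simpa [mul_comm] using ((hasDerivAt_id x).const_mul a).sin
  have hc : ∀ x, HasDerivAt (fun x => Real.cos (a * x)) (-(a * Real.sin (a * x))) x := fun x => by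
    simpa [mul_comm] using ((hasDerivAt_id x).const_mul a).cos
  have h1 : deriv (eigfun κ ℓ) = fun x => (√2 * (a * Real.cos (a * x))
      - κ / 2 * (√2 * Real.sin (a * x))) * Real.exp (-κ * x / 2) := by
    ext x
    exact (hasDerivAt_mul_exp_neg_half κ ((hs x).const_mul √2)).deriv
  have h2 : deriv (deriv (eigfun κ ℓ)) x = ((√2 * (a * -(a * Real.sin (a * x)))
      - κ / 2 * (√2 * (a * Real.cos (a * x)))) - κ / 2 * (√2 * (a * Real.cos (a * x))
      - κ / 2 * (√2 * Real.sin (a * x)))) * Real.exp (-κ * x / 2) := by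
    rw [h1]
    exact (hasDerivAt_mul_exp_neg_half κ ((((hc x).const_mul a).const_mul √2).sub
      (((hs x).const_mul √2).const_mul (κ / 2)))).deriv
  have hϑ₁ : ϑ₁ = κ * ϑ₂ := by
    rw [hκ, kappa]
    field_simp
  rw [opA, h2, h1]
  simp only [eigval, eigfun, ← ha, Gam]
  rw [hϑ₁]
  have : Real.pi ^ 2 * (ℓ : ℝ) ^ 2 = a ^ 2 := by rw [ha]; ring
  rw [this]
  field_simp
  ring

lemma integral_sin_sq_pi (ℓ : ℕ) :
    ∫ x in (0 : ℝ)..1, Real.sin (Real.pi * (ℓ + 1) * x) ^ 2 = 1 / 2 := by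
  have hne : Real.pi * ((ℓ : ℝ) + 1) ≠ 0 := by
    have := Real.pi_ne_zero
    positivity
  rw [intervalIntegral.integral_comp_mul_left (fun x => Real.sin x ^ 2) hne, integral_sin_sq]
  have : Real.sin (Real.pi * ((ℓ : ℝ) + 1)) = 0 := by
    have := Real.sin_nat_mul_pi (ℓ + 1)
    push_cast at this
    rwa [mul_comm] at this
  simp only [mul_zero, mul_one, this, Real.sin_zero, zero_mul, sub_zero, zero_add, smul_eq_mul]
  field_simp

/-- The weight e^{κx} cancels the squared exponential of the eigenfunction. Unit norm is what makes
W(e_ℓ) a standard Brownian motion. -/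
lemma norm_toL2_eigfun (κ : ℝ) (ℓ : ℕ) :
    ‖toL2 κ (eigfun κ (ℓ + 1)) (continuous_eigfun κ (ℓ + 1))‖ = 1 := by
  rw [← sq_eq_sq₀ (norm_nonneg _) zero_le_one, one_pow, ← real_inner_self_eq_norm_sq, L2.inner_def]
  have h1 : ∀ᵐ x ∂(wMeasure κ), inner ℝ (toL2 κ (eigfun κ (ℓ + 1)) (continuous_eigfun κ (ℓ + 1)) x)
      (toL2 κ (eigfun κ (ℓ + 1)) (continuous_eigfun κ (ℓ + 1)) x)
      = eigfun κ (ℓ + 1) x ^ 2 := by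
    filter_upwards [(memLp_of_continuous κ (continuous_eigfun κ (ℓ + 1))).coeFn_toLp] with x hx
    rw [toL2, hx]
    simp [sq]
  rw [integral_congr_ae h1, wMeasure,
    integral_withDensity_eq_integral_toReal_smul (by fun_prop) (by simp),
    integral_Icc_eq_integral_Ioc, ← intervalIntegral.integral_of_le zero_le_one]
  have e : ∀ x : ℝ, (ENNReal.ofReal (Real.exp (κ * x))).toReal • eigfun κ (ℓ + 1) x ^ 2
      = 2 * Real.sin (Real.pi * (ℓ + 1) * x) ^ 2 := by
    intro x
    rw [ENNReal.toReal_ofReal (Real.exp_pos _).le, eigfun, smul_eq_mul, mul_pow, mul_pow,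
      Real.sq_sqrt zero_le_two, sq (Real.exp _), ← Real.exp_add]
    have : Real.exp (κ * x) * Real.exp (-κ * x / 2 + -κ * x / 2) = 1 := by
      rw [← Real.exp_add]
      simp
    push_cast
    linear_combination (2 * Real.sin (Real.pi * (ℓ + 1) * x) ^ 2) * this
  simp_rw [e]
  rw [intervalIntegral.integral_const_mul, integral_sin_sq_pi]
  norm_num

/-- The modes are sine coefficients of e^{κz/2}X_t(z), so sine series reconstruct this rescaled
field rather than X itself. -/
lemma mode_eq {Ω : Type*} (κ : ℝ) (X : ℝ → ℝ → Ω → ℝ) (ℓ : ℕ) (t : ℝ) (ω : Ω) :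
    mode κ X (ℓ + 1) t ω = √2 * ∫ z in (0 : ℝ)..1,
      Real.exp (κ * z / 2) * X t z ω * Real.sin (Real.pi * (ℓ + 1) * z) := by
  rw [mode, wInner, ← intervalIntegral.integral_const_mul]
  congr 1
  ext z
  have : Real.exp (-κ * z / 2) * Real.exp (κ * z) = Real.exp (κ * z / 2) := by
    rw [← Real.exp_add]
    congr 1
    ring
  rw [← this, eigfun]
  push_cast
  ring

lemma continuousOn_mode {Ω : Type*} {κ : ℝ} {X : ℝ → ℝ → Ω → ℝ} {ω : Ω}
    (hX : ContinuousOn (fun p : ℝ × ℝ => X p.1 p.2 ω) (Ici 0 ×ˢ Icc 0 1)) (ℓ : ℕ) :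
    ContinuousOn (fun t => mode κ X ℓ t ω) (Ici 0) := by
  -- Clamping both coordinates extends X continuously to the whole plane without changing it on its
  -- domain.
  have hc : Continuous (fun p : ℝ × ℝ => X (max p.1 0) (max 0 (min 1 p.2)) ω
      * eigfun κ ℓ p.2 * Real.exp (κ * p.2)) := by
    have h1 : Continuous (fun p : ℝ × ℝ => X (max p.1 0) (max 0 (min 1 p.2)) ω) := by
      refine hX.comp_continuous (f := fun p : ℝ × ℝ => (max p.1 0, max 0 (min 1 p.2)))
        (by fun_prop) fun p => ⟨mem_Ici.2 (le_max_right _ _), le_max_left _ _, ?_⟩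
      exact max_le zero_le_one (min_le_left _ _)
    exact (h1.mul ((continuous_eigfun κ ℓ).comp continuous_snd)).mul (by fun_prop)
  have hi := intervalIntegral.continuous_parametric_intervalIntegral_of_continuous' (μ := volume)
    (f := fun t z => X (max t 0) (max 0 (min 1 z)) ω * eigfun κ ℓ z * Real.exp (κ * z)) hc 0 1
  refine hi.continuousOn.congr fun t ht => ?_
  rw [mode, wInner]
  refine intervalIntegral.integral_congr fun z hz => ?_
  rw [uIcc_of_le zero_le_one] at hz
  rw [max_eq_left (mem_Ici.1 ht), min_eq_right hz.2, max_eq_right hz.1]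

/-- The modes of the weak solution solve Ornstein-Uhlenbeck equations. -/
lemma mode_equation {Ω : Type*} [MeasurableSpace Ω] {P : Measure Ω} {σ ϑ₂ ϑ₁ ϑ₀ : ℝ}
    (hϑ₂ : 0 < ϑ₂) {W : wL2 (kappa ϑ₂ ϑ₁) → ℝ≥0 → Ω → ℝ} {X : ℝ → ℝ → Ω → ℝ}
    (hX : IsWeakSolution σ ϑ₂ ϑ₁ ϑ₀ W X P) (ℓ : ℕ) (t : ℝ≥0) :
    ∀ᵐ ω ∂P, mode (kappa ϑ₂ ϑ₁) X (ℓ + 1) t ω = mode (kappa ϑ₂ ϑ₁) X (ℓ + 1) 0 ω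
      + (∫ s in (0 : ℝ)..t, -eigval ϑ₂ ϑ₁ ϑ₀ (ℓ + 1) * mode (kappa ϑ₂ ϑ₁) X (ℓ + 1) s ω)
      + σ * coordBM (kappa ϑ₂ ϑ₁) W (ℓ + 1) t ω := by
  have h0 : eigfun (kappa ϑ₂ ϑ₁) (ℓ + 1) 0 = 0 := by simp [eigfun]
  have h1 : eigfun (kappa ϑ₂ ϑ₁) (ℓ + 1) 1 = 0 := by
    have := Real.sin_nat_mul_pi (ℓ + 1)
    rw [mul_comm] at this
    simp only [eigfun, mul_one, this, mul_zero, zero_mul]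
  filter_upwards [hX.weak _ (contDiff_eigfun (kappa ϑ₂ ϑ₁) (ℓ + 1)) h0 h1 t] with ω hω
  have e : ∀ s, wInner (kappa ϑ₂ ϑ₁) (fun x => X s x ω)
      (opA ϑ₂ ϑ₁ ϑ₀ (eigfun (kappa ϑ₂ ϑ₁) (ℓ + 1)))
      = -eigval ϑ₂ ϑ₁ ϑ₀ (ℓ + 1) * mode (kappa ϑ₂ ϑ₁) X (ℓ + 1) s ω := by
    intro s
    rw [mode, wInner, wInner, ← intervalIntegral.integral_const_mul]
    congr 1
    ext x
    rw [opA_eigfun hϑ₂]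
    ring
  simp_rw [e] at hω
  exact hω

/-! ### Gaussianity of the solution field -/

/-- Covariance carried by the initial value plus covariance of the stochastic convolution: with the
stationary variance σ²/(2λ) the sum depends only on the lag. -/
lemma ou_cov_add (lam σ : ℝ) (a b : ℕ) (Δ : ℝ) (hlam : lam ≠ 0) :
    Real.exp (-lam * (a * Δ)) * Real.exp (-lam * (b * Δ)) * (σ ^ 2 / (2 * lam))
      + σ ^ 2 * (Real.exp (-lam * (a * Δ)) * Real.exp (-lam * (b * Δ)) *
          ((Real.exp (2 * lam * ((min a b : ℕ) * Δ)) - 1) / (2 * lam)))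
      = σ ^ 2 / (2 * lam) * Real.exp (-lam * (|(a : ℝ) - b| * Δ)) := by
  have h : Real.exp (-lam * (a * Δ)) * Real.exp (-lam * (b * Δ))
      * Real.exp (2 * lam * ((min a b : ℕ) * Δ)) = Real.exp (-lam * (|(a : ℝ) - b| * Δ)) := by
    rw [← Real.exp_add, ← Real.exp_add]
    congr 1
    rcases le_total a b with h | h
    · have h' : (a : ℝ) ≤ b := by exact_mod_cast h
      rw [min_eq_left h, abs_of_nonpos (by linarith)]
      ring
    · have h' : (b : ℝ) ≤ a := by exact_mod_cast h
      rw [min_eq_right h, abs_of_nonneg (by linarith)]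
      ring
  rw [← h]
  field_simp
  ring

section Field

variable {Ω : Type*} [MeasurableSpace Ω] {P : Measure Ω} [IsProbabilityMeasure P]
  {σ ϑ₂ ϑ₁ ϑ₀ : ℝ} {W : wL2 (kappa ϑ₂ ϑ₁) → ℝ≥0 → Ω → ℝ} {X : ℝ → ℝ → Ω → ℝ}

/-- Finite linear combinations of the modes at grid times are Gaussian, with the covariances of
independent stationary Ornstein-Uhlenbeck processes. -/
lemma hasGaussTransform_modes (hϑ₂ : 0 < ϑ₂)
    (hΓ : 0 < ϑ₁ ^ 2 / (4 * ϑ₂ ^ 2) - ϑ₀ / ϑ₂ + Real.pi ^ 2) (hW : IsCylindricalBrownian W P)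
    (hX : IsWeakSolution σ ϑ₂ ϑ₁ ϑ₀ W X P) (hX₀ : IsStationaryStart σ ϑ₂ ϑ₁ ϑ₀ W X P)
    {ι : Type*} [Fintype ι] (m : ι → ℕ) (Δ : ℝ≥0) (p : ℕ → ι → ℝ) (L : ℕ) :
    HasGaussTransform (fun ω => ∑ ℓ ∈ Finset.range L, ∑ j,
        p ℓ j * mode (kappa ϑ₂ ϑ₁) X (ℓ + 1) (m j * Δ) ω)
      (∑ ℓ ∈ Finset.range L, ∑ i, ∑ j, p ℓ i * p ℓ j *
        (σ ^ 2 / (2 * eigval ϑ₂ ϑ₁ ϑ₀ (ℓ + 1)) *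
          Real.exp (-eigval ϑ₂ ϑ₁ ϑ₀ (ℓ + 1) * (|(m i : ℝ) - m j| * Δ)))) P := by
  obtain ⟨c₀, hc₀, hc₀'⟩ := eigval_lower_bound hϑ₂ hΓ
  have hpos : ∀ ℓ : ℕ, 0 < eigval ϑ₂ ϑ₁ ϑ₀ (ℓ + 1) := fun ℓ =>
    lt_of_lt_of_le (by positivity) (hc₀' ℓ)
  have hBM : ∀ ℓ : ℕ, IsPreBrownianReal (coordBM (kappa ϑ₂ ϑ₁) W (ℓ + 1)) P := fun ℓ =>
    (hW.brownian _ (norm_toL2_eigfun (kappa ϑ₂ ϑ₁) ℓ)).toIsPreBrownianReal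
  choose Y v hYm hYc hYv hYlim using fun ℓ : ℕ =>
    exists_approx_stochastic_convolution (hBM ℓ)
      (u := mode (kappa ϑ₂ ϑ₁) X (ℓ + 1)) (fun ω => continuousOn_mode (hX.continuous ω) (ℓ + 1))
      (hpos ℓ).ne' (mode_equation hϑ₂ hX ℓ) m (p ℓ) Δ
  set α : ℕ → ℝ := fun ℓ => ∑ j, p ℓ j * Real.exp (-eigval ϑ₂ ϑ₁ ϑ₀ (ℓ + 1) * (m j * Δ)) with hα
  set Z : ℕ → ℕ ⊕ ℕ → Ω → ℝ := fun K => Sum.elim (fun ℓ => Y ℓ K)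
    (fun ℓ ω => α ℓ * mode (kappa ϑ₂ ϑ₁) X (ℓ + 1) 0 ω) with hZ
  have hle : ∀ ℓ : ℕ, (⨆ t : ℝ≥0, MeasurableSpace.comap
      (coordBM (kappa ϑ₂ ϑ₁) W (ℓ + 1) t) inferInstance)
      ≤ (inferInstance : MeasurableSpace Ω) := fun ℓ =>
    iSup_le fun t => (hW.measurable _ t).comap_le
  -- Independence is inherited from the generating σ-algebras; for this the approximants had to be
  -- measurable with respect to the noise of their own mode.
  have hZind : ∀ K, iIndepFun (Z K) P := by
    intro K
    rw [iIndepFun_iff_iIndep]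
    refine iIndep_of_iIndep_of_le hX₀.indep fun i => ?_
    rcases i with ℓ | ℓ
    · exact (hYm ℓ K).comap_le
    · refine Measurable.comap_le ?_
      exact Measurable.const_mul (comap_measurable _) _
  set vv : ℕ → ℕ ⊕ ℕ → ℝ := fun K => Sum.elim (fun ℓ => v ℓ K)
    (fun ℓ => α ℓ ^ 2 * (σ ^ 2 / (2 * eigval ϑ₂ ϑ₁ ϑ₀ (ℓ + 1)))) with hvv
  have hZG : ∀ K i, HasGaussTransform (Z K i) (vv K i) P := by
    intro K i
    rcases i with ℓ | ℓ
    · exact ⟨((hYm ℓ K).mono (hle ℓ) le_rfl).aemeasurable, hYc ℓ K⟩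
    · refine hasGaussTransform_of_hasLaw ?_ (hX₀.law ℓ) (α ℓ)
      have := hpos ℓ
      positivity
  have hsum := fun K => HasGaussTransform.sum ((Finset.range L).disjSum (Finset.range L))
    (hZind K) (fun i _ => hZG K i)
  refine HasGaussTransform.of_tendsto (l := atTop) (Eventually.of_forall hsum) ?_ ?_
  · have hall : ∀ᵐ ω ∂P, ∀ ℓ : ℕ, Tendsto (fun K => Y ℓ K ω) atTop
        (𝓝 (∑ j, p ℓ j * (mode (kappa ϑ₂ ϑ₁) X (ℓ + 1) (m j * Δ) ω
          - Real.exp (-eigval ϑ₂ ϑ₁ ϑ₀ (ℓ + 1) * (m j * Δ)) * mode (kappa ϑ₂ ϑ₁) X (ℓ + 1) 0 ω))) :=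
      ae_all_iff.2 hYlim
    filter_upwards [hall] with ω hω
    have h1 := (tendsto_finsetSum (Finset.range L) fun ℓ _ => hω ℓ).add_const
      (∑ ℓ ∈ Finset.range L, α ℓ * mode (kappa ϑ₂ ϑ₁) X (ℓ + 1) 0 ω)
    refine (h1.congr fun K => ?_).trans (le_of_eq ?_)
    · rw [Finset.sum_disjSum]
      simp only [hZ, Sum.elim_inl, Sum.elim_inr]
    · congr 1
      rw [← Finset.sum_add_distrib]
      refine Finset.sum_congr rfl fun ℓ _ => ?_
      rw [hα, Finset.sum_mul, ← Finset.sum_add_distrib]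
      refine Finset.sum_congr rfl fun j _ => ?_
      ring
  · have h1 := (tendsto_finsetSum (Finset.range L) fun ℓ _ => hYv ℓ).add_const
      (∑ ℓ ∈ Finset.range L, α ℓ ^ 2 * (σ ^ 2 / (2 * eigval ϑ₂ ϑ₁ ϑ₀ (ℓ + 1))))
    refine (h1.congr fun K => ?_).trans (le_of_eq ?_)
    · rw [Finset.sum_disjSum]
      simp only [hvv, Sum.elim_inl, Sum.elim_inr]
    · congr 1
      rw [← Finset.sum_add_distrib]
      refine Finset.sum_congr rfl fun ℓ _ => ?_
      rw [hα, sq (∑ j, _), Finset.sum_mul_sum, Finset.sum_mul, ← Finset.sum_add_distrib]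
      refine Finset.sum_congr rfl fun i _ => ?_
      rw [Finset.sum_mul, ← Finset.sum_add_distrib]
      refine Finset.sum_congr rfl fun j _ => ?_
      rw [← ou_cov_add _ σ (m i) (m j) Δ (hpos ℓ).ne']
      ring

lemma summable_div_eigval (hϑ₂ : 0 < ϑ₂)
    (hΓ : 0 < ϑ₁ ^ 2 / (4 * ϑ₂ ^ 2) - ϑ₀ / ϑ₂ + Real.pi ^ 2) {q : ℕ → ℝ} {C : ℝ}
    (hq : ∀ ℓ, |q ℓ| ≤ C) : Summable (fun ℓ : ℕ => σ ^ 2 / eigval ϑ₂ ϑ₁ ϑ₀ (ℓ + 1) * q ℓ) := by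
  obtain ⟨c₀, hc₀, hc₀'⟩ := eigval_lower_bound hϑ₂ hΓ
  refine Summable.of_norm_bounded (summable_one_div_succ_sq.mul_left (σ ^ 2 / c₀ * C)) fun ℓ => ?_
  have h0 : 0 < eigval ϑ₂ ϑ₁ ϑ₀ (ℓ + 1) := lt_of_lt_of_le (by positivity) (hc₀' ℓ)
  have hC : 0 ≤ C := (abs_nonneg _).trans (hq 0)
  rw [norm_mul, Real.norm_eq_abs, Real.norm_eq_abs, abs_of_nonneg (by positivity)]
  calc _ ≤ σ ^ 2 / (c₀ * ((ℓ : ℝ) + 1) ^ 2) * C := by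
        gcongr
        · exact hc₀' ℓ
        · exact hq ℓ
    _ = _ := by field_simp

/-- A family of functionals of the solution which are given, in the sense of Riemann summation, by
sine-type series `∑ √2 u_ℓ a_ℓ` is jointly Gaussian. -/
lemma hasGaussTransform_of_riemann_summable (hϑ₂ : 0 < ϑ₂)
    (hΓ : 0 < ϑ₁ ^ 2 / (4 * ϑ₂ ^ 2) - ϑ₀ / ϑ₂ + Real.pi ^ 2) (hW : IsCylindricalBrownian W P)
    (hX : IsWeakSolution σ ϑ₂ ϑ₁ ϑ₀ W X P) (hX₀ : IsStationaryStart σ ϑ₂ ϑ₁ ϑ₀ W X P)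
    {ι : Type*} [Fintype ι] (m : ι → ℕ) (Δ : ℝ≥0) {a : ℕ → ι → ℝ} {C : ℝ}
    (ha : ∀ ℓ j, |a ℓ j| ≤ C) {g : ℝ → ι → Ω → ℝ} {ζ : ι → Ω → ℝ}
    (hg : ∀ᶠ h in 𝓝[>] 0, ∀ j ω, HasSum (fun ℓ : ℕ =>
      √2 * mode (kappa ϑ₂ ϑ₁) X (ℓ + 1) (m j * Δ) ω * a ℓ j * riemannFactor ℓ h) (g h j ω))
    (hζ : ∀ j ω, Tendsto (fun h => g h j ω) (𝓝[>] 0) (𝓝 (ζ j ω))) (w : ι → ℝ) :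
    HasGaussTransform (fun ω => ∑ j, w j * ζ j ω)
      (∑' ℓ : ℕ, σ ^ 2 / eigval ϑ₂ ϑ₁ ϑ₀ (ℓ + 1) * ∑ i, ∑ j, w i * w j *
        (Real.exp (-eigval ϑ₂ ϑ₁ ϑ₀ (ℓ + 1) * (|(m i : ℝ) - m j| * Δ)) * (a ℓ i * a ℓ j))) P := by
  obtain ⟨c₀, hc₀, hc₀'⟩ := eigval_lower_bound hϑ₂ hΓ
  have hpos : ∀ ℓ : ℕ, 0 < eigval ϑ₂ ϑ₁ ϑ₀ (ℓ + 1) := fun ℓ =>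
    lt_of_lt_of_le (by positivity) (hc₀' ℓ)
  set q : ℕ → ℝ := fun ℓ => ∑ i, ∑ j, w i * w j *
        (Real.exp (-eigval ϑ₂ ϑ₁ ϑ₀ (ℓ + 1) * (|(m i : ℝ) - m j| * Δ)) * (a ℓ i * a ℓ j)) with hq
  have hqb : ∀ ℓ, |q ℓ| ≤ ∑ i, ∑ j, |w i| * |w j| * (1 * (C * C)) := by
    intro ℓ
    refine (Finset.abs_sum_le_sum_abs _ _).trans (Finset.sum_le_sum fun i _ => ?_)
    refine (Finset.abs_sum_le_sum_abs _ _).trans (Finset.sum_le_sum fun j _ => ?_)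
    rw [abs_mul, abs_mul, abs_mul, abs_mul, abs_of_pos (Real.exp_pos _)]
    have hC : 0 ≤ C := (abs_nonneg _).trans (ha 0 i)
    gcongr
    · rw [Real.exp_le_one_iff, neg_mul, neg_nonpos]
      have := hpos ℓ
      positivity
    · exact ha ℓ i
    · exact ha ℓ j
  -- For fixed h the damped series converges pathwise, so the finite mode sums pass to the limit.
  -- The covariance carries the squared damping factor, removed below by domination as h ↓ 0.
  have hfix : ∀ᶠ h in 𝓝[>] 0, HasGaussTransform (fun ω => ∑ j, w j * g h j ω)
      (∑' ℓ : ℕ, σ ^ 2 / eigval ϑ₂ ϑ₁ ϑ₀ (ℓ + 1) * (riemannFactor ℓ h ^ 2 * q ℓ)) P := by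
    filter_upwards [hg] with h hgh
    have hbase := fun L => hasGaussTransform_modes hϑ₂ hΓ hW hX hX₀ m Δ
      (fun ℓ j => w j * (√2 * a ℓ j * riemannFactor ℓ h)) L
    refine HasGaussTransform.of_tendsto (l := atTop) (Eventually.of_forall hbase) ?_ ?_
    · refine ae_of_all _ fun ω => ?_
      have := tendsto_finsetSum Finset.univ fun j _ =>
        ((hgh j ω).tendsto_sum_nat).const_mul (w j)
      refine this.congr fun L => ?_
      simp_rw [Finset.mul_sum]
      rw [Finset.sum_comm]
      refine Finset.sum_congr rfl fun ℓ _ => Finset.sum_congr rfl fun j _ => ?_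
      ring
    · have hs : Summable (fun ℓ : ℕ => σ ^ 2 / eigval ϑ₂ ϑ₁ ϑ₀ (ℓ + 1) *
          (riemannFactor ℓ h ^ 2 * q ℓ)) := by
        refine summable_div_eigval hϑ₂ hΓ (C := ∑ i, ∑ j, |w i| * |w j| * (1 * (C * C)))
          fun ℓ => ?_
        rw [abs_mul, abs_of_nonneg (sq_nonneg _)]
        exact (mul_le_of_le_one_left (abs_nonneg _) (pow_le_one₀ (riemannFactor_nonneg _ _)
          (riemannFactor_le_one _ _))).trans (hqb ℓ)
      refine hs.hasSum.tendsto_sum_nat.congr fun L => ?_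
      refine Finset.sum_congr rfl fun ℓ _ => ?_
      rw [hq]
      simp only [Finset.mul_sum]
      refine Finset.sum_congr rfl fun i _ => Finset.sum_congr rfl fun j _ => ?_
      -- The two factors √2 turn the stationary variance σ²/(2λ) into σ²/λ.
      have h2 : √2 * √2 = 2 := Real.mul_self_sqrt zero_le_two
      have := (hpos ℓ).ne'
      field_simp
      rw [Real.sq_sqrt zero_le_two]
  refine HasGaussTransform.of_tendsto (l := 𝓝[>] (0 : ℝ)) hfix (ae_of_all _ fun ω => ?_) ?_
  · exact tendsto_finsetSum Finset.univ fun j _ => (hζ j ω).const_mul (w j)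
  · refine tendsto_tsum_of_dominated_convergence
      (bound := fun ℓ : ℕ => |σ ^ 2 / eigval ϑ₂ ϑ₁ ϑ₀ (ℓ + 1) * q ℓ|)
      (summable_div_eigval hϑ₂ hΓ hqb).abs (fun ℓ => ?_) (Eventually.of_forall fun h ℓ => ?_)
    · have := ((tendsto_riemannFactor ℓ).pow 2).mul_const (q ℓ)
      rw [one_pow, one_mul] at this
      exact this.const_mul _
    · rw [Real.norm_eq_abs, abs_mul, abs_mul, abs_mul,
        abs_of_nonneg (sq_nonneg (riemannFactor ℓ h))]
      refine mul_le_mul_of_nonneg_left ?_ (abs_nonneg _)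
      exact mul_le_of_le_one_left (abs_nonneg _) (pow_le_one₀ (riemannFactor_nonneg _ _)
          (riemannFactor_le_one _ _))

end Field

/-! ### Point values of the field from its modes. -/

section RiemannMean

variable {Ω : Type*} [MeasurableSpace Ω] {P : Measure Ω}
  {σ ϑ₂ ϑ₁ ϑ₀ : ℝ} {W : wL2 (kappa ϑ₂ ϑ₁) → ℝ≥0 → Ω → ℝ} {X : ℝ → ℝ → Ω → ℝ}

/-- The Riemann means of the rescaled solution `e^{κ y / 2} X_t(y)`. -/
def riemannMean {Ω : Type*} (κ : ℝ) (X : ℝ → ℝ → Ω → ℝ) (h t y : ℝ) (ω : Ω) : ℝ :=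
  if y = 0 ∨ y = 1 then 0 else ∫ z in (0 : ℝ)..1, Real.exp (κ * z / 2) * X t z ω * tent h y z

lemma sin_pi_mul_succ (ℓ : ℕ) : Real.sin (Real.pi * ((ℓ : ℝ) + 1)) = 0 := by
  have := Real.sin_nat_mul_pi (ℓ + 1)
  push_cast at this
  rwa [mul_comm] at this

lemma continuousOn_weighted (hX : IsWeakSolution σ ϑ₂ ϑ₁ ϑ₀ W X P) (κ : ℝ) {t : ℝ} (ht : 0 ≤ t)
    (ω : Ω) : ContinuousOn (fun z => Real.exp (κ * z / 2) * X t z ω) (Icc 0 1) := by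
  refine ContinuousOn.mul (Continuous.continuousOn (by fun_prop)) ?_
  exact (hX.continuous ω).comp (f := fun z : ℝ => (t, z))
    (Continuous.continuousOn (by fun_prop)) fun z hz => ⟨ht, hz⟩

lemma tendsto_riemannMean (hX : IsWeakSolution σ ϑ₂ ϑ₁ ϑ₀ W X P) (κ : ℝ) {t y : ℝ} (ht : 0 ≤ t)
    (hy : y ∈ Icc (0 : ℝ) 1) (ω : Ω) :
    Tendsto (fun h => riemannMean κ X h t y ω) (𝓝[>] 0) (𝓝 (Real.exp (κ * y / 2) * X t y ω)) := by
  by_cases hb : y = 0 ∨ y = 1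
  -- At the endpoints no tent fits inside [0,1]; the Dirichlet condition supplies the value instead.
  · have : X t y ω = 0 := by
      rcases hb with h | h <;> rw [h]
      · exact (hX.boundary t ht ω).1
      · exact (hX.boundary t ht ω).2
    simp only [riemannMean, hb, if_true, this, mul_zero]
    exact tendsto_const_nhds
  · simp only [riemannMean, hb, if_false]
    push Not at hb
    exact tendsto_integral_tent (continuousOn_weighted hX κ ht ω)
      ⟨lt_of_le_of_ne hy.1 hb.1.symm, lt_of_le_of_ne hy.2 hb.2⟩

/-- At an interior point it suffices that h ≤ min(y, 1 - y), a threshold independent of t and ω; at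
an endpoint every sine vanishes. -/
lemma hasSum_riemannMean (hX : IsWeakSolution σ ϑ₂ ϑ₁ ϑ₀ W X P) (κ : ℝ) {y : ℝ}
    (hy : y ∈ Icc (0 : ℝ) 1) :
    ∀ᶠ h in 𝓝[>] 0, ∀ t, 0 ≤ t → ∀ ω, HasSum (fun ℓ : ℕ =>
      √2 * mode κ X (ℓ + 1) t ω * Real.sin (Real.pi * (ℓ + 1) * y) * riemannFactor ℓ h)
      (riemannMean κ X h t y ω) := by
  by_cases hb : y = 0 ∨ y = 1
  · refine Eventually.of_forall fun h t ht ω => ?_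
    have e : ∀ ℓ : ℕ, Real.sin (Real.pi * (ℓ + 1) * y) = 0 := by
      intro ℓ
      rcases hb with h | h <;> rw [h]
      · simp
      · rw [mul_one, sin_pi_mul_succ]
    simp only [riemannMean, hb, if_true, e, mul_zero, zero_mul]
    exact hasSum_zero
  · have hb' := hb
    push Not at hb'
    have hy0 : 0 < y := lt_of_le_of_ne hy.1 hb'.1.symm
    have hy1 : y < 1 := lt_of_le_of_ne hy.2 hb'.2
    have hpos : 0 < min y (1 - y) := lt_min hy0 (by linarith)
    filter_upwards [Ioo_mem_nhdsGT hpos] with h hh t ht ω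
    have h1 : h ≤ y := hh.2.le.trans (min_le_left _ _)
    have h2 : h ≤ 1 - y := hh.2.le.trans (min_le_right _ _)
    simp only [riemannMean, hb, if_false]
    refine hasSum_of_eq (hasSum_integral_tent (continuousOn_weighted hX κ ht ω) hh.1 h1
      (by linarith)) (fun ℓ => ?_) rfl
    rw [mode_eq]
    have h2 : √2 * √2 = 2 := Real.mul_self_sqrt zero_le_two
    rw [← mul_assoc √2 √2, h2]

end RiemannMean

/-! ### Covariances of the spatial increments -/

/-- Sine coefficients of the weighted increment over the `k`-th spatial grid interval. -/
def incCoef (κ b : ℝ) (M ℓ k : ℕ) : ℝ :=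
  Real.exp (-κ * meshSp b M / 2) * Real.sin (Real.pi * (ℓ + 1) * gridSp b M (k + 1))
    - Real.sin (Real.pi * (ℓ + 1) * gridSp b M k)

/-- Covariance of the `k`-th and `l`-th weighted spatial increments at time lag `τ`. -/
def incCov (σ ϑ₂ ϑ₁ ϑ₀ b : ℝ) (M : ℕ) (τ : ℝ) (k l : ℕ) : ℝ :=
  ∑' ℓ : ℕ, σ ^ 2 / eigval ϑ₂ ϑ₁ ϑ₀ (ℓ + 1) * (Real.exp (-eigval ϑ₂ ϑ₁ ϑ₀ (ℓ + 1) * τ) *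
    (incCoef (kappa ϑ₂ ϑ₁) b M ℓ k * incCoef (kappa ϑ₂ ϑ₁) b M ℓ l))

/-! ### Estimates on the spatial grid. -/

section Mesh

variable {b : ℝ} {M : ℕ}

lemma meshSp_pos (hb : b ∈ Ico (0 : ℝ) (1 / 2)) (hM : 1 ≤ M) : 0 < meshSp b M := by
  have : (0 : ℝ) < M := by exact_mod_cast hM
  exact div_pos (by linarith [hb.2]) this

lemma mul_meshSp (hM : 1 ≤ M) : (M : ℝ) * meshSp b M = 1 - 2 * b := by
  have : (0 : ℝ) < M := by exact_mod_cast hM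
  rw [meshSp]
  field_simp

lemma meshSp_le_one (hb : b ∈ Ico (0 : ℝ) (1 / 2)) (hM : 1 ≤ M) : meshSp b M ≤ 1 := by
  have h1 := mul_meshSp (b := b) hM
  have h2 := meshSp_pos hb hM
  have h3 : (1 : ℝ) ≤ M := by exact_mod_cast hM
  nlinarith [hb.1]

lemma gridSp_succ (b : ℝ) (M k : ℕ) : gridSp b M (k + 1) = gridSp b M k + meshSp b M := by
  simp only [gridSp]
  push_cast
  ring

lemma gridSp_mem (hb : b ∈ Ico (0 : ℝ) (1 / 2)) (hM : 1 ≤ M) {k : ℕ} (hk : k ≤ M) :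
    gridSp b M k ∈ Icc (0 : ℝ) 1 := by
  have h1 := mul_meshSp (b := b) hM
  have h2 := meshSp_pos hb hM
  have h3 : (k : ℝ) ≤ M := by exact_mod_cast hk
  have h4 : (k : ℝ) * meshSp b M ≤ M * meshSp b M := mul_le_mul_of_nonneg_right h3 h2.le
  have h5 : 0 ≤ (k : ℝ) * meshSp b M := by positivity
  constructor <;> simp only [gridSp] <;> linarith [hb.1]

lemma one_sub_exp_mesh (κ : ℝ) (hb : b ∈ Ico (0 : ℝ) (1 / 2)) (hM : 1 ≤ M) :
    |1 - Real.exp (-κ * meshSp b M / 2)| ≤ |κ| * Real.exp |κ| * meshSp b M := by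
  have h2 := meshSp_pos hb hM
  have h3 := meshSp_le_one hb hM
  set x : ℝ := -κ * meshSp b M / 2 with hx
  have hxa : |x| = |κ| * meshSp b M / 2 := by
    rw [hx, abs_div, abs_mul, abs_neg, abs_two, abs_of_pos h2]
  have hκ := abs_nonneg κ
  have hle : |x| ≤ |κ| := by
    rw [hxa]
    nlinarith
  have h4 : |1 - Real.exp x| ≤ |x| * Real.exp |x| := by
    rw [abs_sub_comm]
    rcases le_total 0 x with h | h
    · rw [abs_of_nonneg h, abs_of_nonneg (by linarith [Real.one_le_exp h])]
      have h5 := Real.add_one_le_exp (-x)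
      have h6 : Real.exp x * Real.exp (-x) = 1 := by rw [← Real.exp_add]; simp
      nlinarith [Real.exp_pos x]
    · rw [abs_of_nonpos h, abs_of_nonpos (by linarith [Real.exp_le_one_iff.2 h])]
      have h5 := Real.add_one_le_exp x
      have h6 : 1 ≤ Real.exp (-x) := Real.one_le_exp (by linarith)
      nlinarith
  calc _ ≤ |x| * Real.exp |x| := h4
    _ ≤ (|κ| * meshSp b M) * Real.exp |κ| := by
      gcongr
      rw [hxa]
      nlinarith
    _ = _ := by ring

lemma exp_mesh_le (κ : ℝ) (hb : b ∈ Ico (0 : ℝ) (1 / 2)) (hM : 1 ≤ M) :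
    Real.exp (-κ * meshSp b M / 2) ≤ Real.exp |κ| := by
  have h2 := meshSp_pos hb hM
  have h3 := meshSp_le_one hb hM
  rw [Real.exp_le_exp]
  have := neg_abs_le κ
  have := abs_nonneg κ
  nlinarith

lemma abs_incCoef_le_const (κ : ℝ) (b : ℝ) (M ℓ k : ℕ) :
    |incCoef κ b M ℓ k| ≤ Real.exp (-κ * meshSp b M / 2) + 1 := by
  rw [incCoef]
  refine (abs_sub _ _).trans (add_le_add ?_ (Real.abs_sin_le_one _))
  rw [abs_mul, abs_of_pos (Real.exp_pos _)]
  exact mul_le_of_le_one_right (Real.exp_pos _).le (Real.abs_sin_le_one _)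

/-- The coefficient is r times a difference of sines, of size πℓδ, minus (1 - r) times a sine, of
size O(δ). The constant bound above gives summability; this one gives the rates in δ. -/
lemma abs_incCoef_le (κ : ℝ) (hb : b ∈ Ico (0 : ℝ) (1 / 2)) (hM : 1 ≤ M) (ℓ k : ℕ) :
    |incCoef κ b M ℓ k| ≤ Real.exp |κ| * (Real.pi + |κ|) * meshSp b M * (ℓ + 1) := by
  have h2 := meshSp_pos hb hM
  set r := Real.exp (-κ * meshSp b M / 2) with hr
  have hsin : |Real.sin (Real.pi * (ℓ + 1) * gridSp b M (k + 1))
      - Real.sin (Real.pi * (ℓ + 1) * gridSp b M k)| ≤ Real.pi * (ℓ + 1) * meshSp b M := by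
    have := Real.abs_sin_sub_sin_le (Real.pi * (ℓ + 1) * gridSp b M (k + 1))
      (Real.pi * (ℓ + 1) * gridSp b M k)
    refine this.trans (le_of_eq ?_)
    rw [gridSp_succ, ← mul_sub, add_sub_cancel_left, abs_of_nonneg]
    have := Real.pi_pos
    positivity
  have e : incCoef κ b M ℓ k = r * (Real.sin (Real.pi * (ℓ + 1) * gridSp b M (k + 1))
      - Real.sin (Real.pi * (ℓ + 1) * gridSp b M k))
      - (1 - r) * Real.sin (Real.pi * (ℓ + 1) * gridSp b M k) := by
    rw [incCoef, ← hr]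
    ring
  rw [e]
  calc _ ≤ |r| * (Real.pi * (ℓ + 1) * meshSp b M) + |1 - r| * 1 := by
        refine (abs_sub _ _).trans ?_
        rw [abs_mul, abs_mul]
        gcongr
        exact Real.abs_sin_le_one _
    _ ≤ Real.exp |κ| * (Real.pi * (ℓ + 1) * meshSp b M) + |κ| * Real.exp |κ| * meshSp b M := by
        rw [mul_one]
        refine add_le_add ?_ (one_sub_exp_mesh κ hb hM)
        refine mul_le_mul_of_nonneg_right ?_ ?_
        · rw [abs_of_pos (Real.exp_pos _)]
          exact exp_mesh_le κ hb hM
        · have := Real.pi_pos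
          positivity
    _ ≤ Real.exp |κ| * (Real.pi * (ℓ + 1) * meshSp b M)
          + |κ| * Real.exp |κ| * meshSp b M * (ℓ + 1) := by
        refine add_le_add le_rfl (le_mul_of_one_le_right (by positivity) ?_)
        have : (0 : ℝ) ≤ ℓ := Nat.cast_nonneg ℓ
        linarith
    _ = _ := by ring

/-- Increments of the Brownian bridge kernel over the spatial grid. -/
lemma bridge_increments (hb : b ∈ Ico (0 : ℝ) (1 / 2)) (hM : 1 ≤ M) {k l : ℕ} (hk : k < M)
    (hl : l < M) {r A B : ℝ} (hr : |1 - r| ≤ A * meshSp b M) (hr' : |r| ≤ B) :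
    |(r * r * (min (gridSp b M (k + 1)) (gridSp b M (l + 1))
        - gridSp b M (k + 1) * gridSp b M (l + 1))
      - r * (min (gridSp b M (k + 1)) (gridSp b M l) - gridSp b M (k + 1) * gridSp b M l)
      - r * (min (gridSp b M k) (gridSp b M (l + 1)) - gridSp b M k * gridSp b M (l + 1))
      + (min (gridSp b M k) (gridSp b M l) - gridSp b M k * gridSp b M l))
      - (if k = l then meshSp b M else 0)| ≤ (4 * A + A ^ 2 + B) * meshSp b M ^ 2 := by
  have hδ := meshSp_pos hb hM
  have hδ1 := meshSp_le_one hb hM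
  have hA : 0 ≤ A * meshSp b M := (abs_nonneg _).trans hr
  have yk := gridSp_mem hb hM hk.le
  have yl := gridSp_mem hb hM hl.le
  have yk1 := gridSp_mem hb hM (Nat.succ_le_of_lt hk)
  have yl1 := gridSp_mem hb hM (Nat.succ_le_of_lt hl)
  -- The mixed second difference of `min` over two cells is the length of their overlap, and grid
  -- cells either coincide or meet at most at an endpoint.
  have hdd : min (gridSp b M (k + 1)) (gridSp b M (l + 1))
      - min (gridSp b M (k + 1)) (gridSp b M l) - min (gridSp b M k) (gridSp b M (l + 1))
      + min (gridSp b M k) (gridSp b M l) = if k = l then meshSp b M else 0 := by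
    have mono : ∀ i j : ℕ, i ≤ j → gridSp b M i ≤ gridSp b M j := fun i j hij => by
      have : (i : ℝ) ≤ j := by exact_mod_cast hij
      simp only [gridSp]
      nlinarith
    rcases lt_trichotomy k l with h | h | h
    · rw [if_neg h.ne, min_eq_left (mono _ _ (by omega)), min_eq_left (mono _ _ (by omega)),
        min_eq_left (mono _ _ (by omega)), min_eq_left (mono _ _ (by omega))]
      ring
    · subst h
      rw [if_pos rfl, min_self, min_self, min_eq_right (mono _ _ (by omega)),
        min_eq_left (mono _ _ (by omega)), gridSp_succ]
      ring
    · rw [if_neg h.ne', min_eq_right (mono _ _ (by omega)), min_eq_right (mono _ _ (by omega)),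
        min_eq_right (mono _ _ (by omega)), min_eq_right (mono _ _ (by omega))]
      ring
  have hmin : min (gridSp b M (k + 1)) (gridSp b M (l + 1))
      = min (gridSp b M k) (gridSp b M l) + meshSp b M := by
    rw [gridSp_succ, gridSp_succ, min_add_add_right]
  rw [Nat.succ_eq_add_one, gridSp_succ] at yk1 yl1
  set δ := meshSp b M with hδ'
  set y := gridSp b M k with hy
  set z := gridSp b M l with hz
  set I : ℝ := if k = l then δ else 0 with hI
  have hIb : |I| ≤ δ := by
    rw [hI]
    split_ifs
    · rw [abs_of_pos hδ]
    · simpa using hδ.le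
  have hg1 : |(min y z + δ) - (y + δ) * (z + δ)| ≤ 1 := by
    have hm0 : 0 ≤ min y z := le_min yk.1 yl.1
    have hm1 : min y z + δ ≤ 1 := by linarith [min_le_left y z, yk1.2]
    have hp0 : 0 ≤ (y + δ) * (z + δ) := mul_nonneg yk1.1 yl1.1
    have hp1 : (y + δ) * (z + δ) ≤ 1 := mul_le_one₀ yk1.2 yl1.1 yl1.2
    rw [abs_le]
    constructor <;> linarith
  have hg2 : |(min y z - y * z) - ((min y z + δ) - (y + δ) * (z + δ))| ≤ 3 * δ := by
    have e : (min y z - y * z) - ((min y z + δ) - (y + δ) * (z + δ))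
        = δ * ((y + δ) + z - 1) := by ring
    rw [e, abs_mul, abs_of_pos hδ, mul_comm]
    refine mul_le_mul_of_nonneg_right ?_ hδ.le
    rw [abs_le]
    constructor <;> linarith [yk1.1, yk1.2, yl.1, yl.2]
  -- Expansion about r = 1, where the expression minus I is exactly -δ²; every other term has a
  -- factor 1 - r = O(δ).
  have key : (r * r * (min (gridSp b M (k + 1)) (gridSp b M (l + 1))
        - gridSp b M (k + 1) * gridSp b M (l + 1))
      - r * (min (gridSp b M (k + 1)) z - gridSp b M (k + 1) * z)
      - r * (min y (gridSp b M (l + 1)) - y * gridSp b M (l + 1)) + (min y z - y * z)) - I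
      = -(1 - r) * I - r * δ ^ 2
        + (1 - r) * ((min y z - y * z) - ((min y z + δ) - (y + δ) * (z + δ)))
        + (1 - r) ^ 2 * ((min y z + δ) - (y + δ) * (z + δ)) := by
    have e1 : gridSp b M (k + 1) = y + δ := gridSp_succ b M k
    have e2 : gridSp b M (l + 1) = z + δ := gridSp_succ b M l
    rw [hmin] at hdd ⊢
    rw [e1, e2] at hdd ⊢
    linear_combination r * hdd
  rw [key]
  have b1 : |-(1 - r) * I| ≤ A * δ * δ := by
    rw [abs_mul, abs_neg]
    exact mul_le_mul hr hIb (abs_nonneg _) hA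
  have b2 : |r * δ ^ 2| ≤ B * δ ^ 2 := by
    rw [abs_mul, abs_of_nonneg (sq_nonneg δ)]
    exact mul_le_mul_of_nonneg_right hr' (sq_nonneg _)
  have b3 : |(1 - r) * ((min y z - y * z) - ((min y z + δ) - (y + δ) * (z + δ)))|
      ≤ A * δ * (3 * δ) := by
    rw [abs_mul]
    exact mul_le_mul hr hg2 (abs_nonneg _) hA
  have b4 : |(1 - r) ^ 2 * ((min y z + δ) - (y + δ) * (z + δ))| ≤ (A * δ) ^ 2 * 1 := by
    rw [abs_mul, abs_pow]
    exact mul_le_mul (pow_le_pow_left₀ (abs_nonneg _) hr 2) hg1 (abs_nonneg _) (sq_nonneg _)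
  calc _ ≤ |-(1 - r) * I| + |r * δ ^ 2|
        + |(1 - r) * ((min y z - y * z) - ((min y z + δ) - (y + δ) * (z + δ)))|
        + |(1 - r) ^ 2 * ((min y z + δ) - (y + δ) * (z + δ))| := by
        refine (abs_add_le _ _).trans (add_le_add_left ?_ _)
        refine (abs_add_le _ _).trans (add_le_add_left ?_ _)
        exact abs_sub _ _
    _ ≤ A * δ * δ + B * δ ^ 2 + A * δ * (3 * δ) + (A * δ) ^ 2 * 1 := by gcongr
    _ = _ := by ring

end Mesh

/-! ### Equal-time covariances and quadratic forms. -/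

section Covariance

variable {σ ϑ₂ ϑ₁ ϑ₀ b : ℝ}

lemma hasSum_incCov (hϑ₂ : 0 < ϑ₂)
    (hΓ : 0 < ϑ₁ ^ 2 / (4 * ϑ₂ ^ 2) - ϑ₀ / ϑ₂ + Real.pi ^ 2) (b : ℝ) (M : ℕ) {τ : ℝ}
    (hτ : 0 ≤ τ) (k l : ℕ) :
    HasSum (fun ℓ : ℕ => σ ^ 2 / eigval ϑ₂ ϑ₁ ϑ₀ (ℓ + 1) *
      (Real.exp (-eigval ϑ₂ ϑ₁ ϑ₀ (ℓ + 1) * τ) *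
      (incCoef (kappa ϑ₂ ϑ₁) b M ℓ k * incCoef (kappa ϑ₂ ϑ₁) b M ℓ l)))
      (incCov σ ϑ₂ ϑ₁ ϑ₀ b M τ k l) := by
  obtain ⟨c₀, hc₀, hc₀'⟩ := eigval_lower_bound hϑ₂ hΓ
  refine (summable_div_eigval (C := 1 * ((Real.exp (-kappa ϑ₂ ϑ₁ * meshSp b M / 2) + 1) *
    (Real.exp (-kappa ϑ₂ ϑ₁ * meshSp b M / 2) + 1))) hϑ₂ hΓ fun ℓ => ?_).hasSum
  have h0 : 0 < eigval ϑ₂ ϑ₁ ϑ₀ (ℓ + 1) := lt_of_lt_of_le (by positivity) (hc₀' ℓ)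
  rw [abs_mul, abs_mul, abs_of_pos (Real.exp_pos _)]
  gcongr
  · rw [Real.exp_le_one_iff, neg_mul, neg_nonpos]
    positivity
  · exact abs_incCoef_le_const _ _ _ _ _
  · exact abs_incCoef_le_const _ _ _ _ _

/-- At equal times the weighted increments are nearly uncorrelated. -/
lemma incCov_zero_approx (hϑ₂ : 0 < ϑ₂)
    (hΓ : 0 < ϑ₁ ^ 2 / (4 * ϑ₂ ^ 2) - ϑ₀ / ϑ₂ + Real.pi ^ 2) (hb : b ∈ Ico (0 : ℝ) (1 / 2)) :
    ∃ C, 0 ≤ C ∧ ∀ M : ℕ, 1 ≤ M → ∀ k l : ℕ, k < M → l < M →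
      |incCov σ ϑ₂ ϑ₁ ϑ₀ b M 0 k l - (if k = l then σ ^ 2 / (2 * ϑ₂) * meshSp b M else 0)|
        ≤ C * meshSp b M ^ 2 := by
  obtain ⟨c₀, hc₀, hc₀'⟩ := eigval_lower_bound hϑ₂ hΓ
  set κ := kappa ϑ₂ ϑ₁ with hκ
  set G := Gam ϑ₂ ϑ₁ ϑ₀ with hG
  set c := σ ^ 2 / (2 * ϑ₂) with hc
  set Ca := Real.exp |κ| * (Real.pi + |κ|) with hCa
  set A := |κ| * Real.exp |κ| with hA
  set D := σ ^ 2 * |G| / c₀ * Ca ^ 2 with hD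
  have hpi := Real.pi_pos
  have hc0 : 0 ≤ c := by positivity
  have hA0 : 0 ≤ A := by positivity
  have hD0 : 0 ≤ D := by positivity
  have hz0 : 0 ≤ ∑' ℓ : ℕ, 1 / ((ℓ : ℝ) + 1) ^ 2 := tsum_nonneg fun ℓ => by positivity
  refine ⟨D * (∑' ℓ : ℕ, 1 / ((ℓ : ℝ) + 1) ^ 2) + c * (4 * A + A ^ 2 + Real.exp |κ|),
    by positivity, fun M hM k l hk hl => ?_⟩
  set δ := meshSp b M with hδ
  have hδ0 : 0 < δ := meshSp_pos hb hM
  set r := Real.exp (-κ * δ / 2) with hr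
  set B : ℝ := r * r * (min (gridSp b M (k + 1)) (gridSp b M (l + 1))
        - gridSp b M (k + 1) * gridSp b M (l + 1))
      - r * (min (gridSp b M (k + 1)) (gridSp b M l) - gridSp b M (k + 1) * gridSp b M l)
      - r * (min (gridSp b M k) (gridSp b M (l + 1)) - gridSp b M k * gridSp b M (l + 1))
      + (min (gridSp b M k) (gridSp b M l) - gridSp b M k * gridSp b M l) with hB
  have hBb : |B - if k = l then δ else 0| ≤ (4 * A + A ^ 2 + Real.exp |κ|) * δ ^ 2 := by
    refine bridge_increments hb hM hk hl (one_sub_exp_mesh κ hb hM) ?_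
    rw [abs_of_pos (Real.exp_pos _)]
    exact exp_mesh_le κ hb hM
  have yk := gridSp_mem hb hM hk.le
  have yl := gridSp_mem hb hM hl.le
  have yk1 := gridSp_mem hb hM (Nat.succ_le_of_lt hk)
  have yl1 := gridSp_mem hb hM (Nat.succ_le_of_lt hl)
  have hBs : HasSum (fun ℓ : ℕ => 2 / (Real.pi * ((ℓ : ℝ) + 1)) ^ 2 *
      (incCoef κ b M ℓ k * incCoef κ b M ℓ l)) B := by
    refine hasSum_of_eq (((((hasSum_bridge yk1 yl1).mul_left (r * r)).sub
      ((hasSum_bridge yk1 yl).mul_left r)).sub ((hasSum_bridge yk yl1).mul_left r)).add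
      (hasSum_bridge yk yl)) (fun ℓ => ?_) rfl
    simp only [incCoef, Nat.succ_eq_add_one, ← hδ, ← hr]
    ring
  -- c·B is the covariance series with λ_ℓ replaced by ϑ₂π²ℓ². The termwise difference is of order
  -- Γℓ⁻⁴ times coefficients of order (δℓ)², hence summable with total O(δ²).
  have hdiff := (hasSum_incCov (σ := σ) hϑ₂ hΓ b M le_rfl k l).sub (hBs.mul_left c)
  have hbound : |incCov σ ϑ₂ ϑ₁ ϑ₀ b M 0 k l - c * B|
      ≤ D * (∑' ℓ : ℕ, 1 / ((ℓ : ℝ) + 1) ^ 2) * δ ^ 2 := by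
    rw [← hdiff.tsum_eq, ← Real.norm_eq_abs]
    have hg := (summable_one_div_succ_sq.hasSum.mul_left D).mul_right (δ ^ 2)
    refine tsum_of_norm_bounded hg fun ℓ => ?_
    have hlam := hc₀' ℓ
    have h0 : 0 < eigval ϑ₂ ϑ₁ ϑ₀ (ℓ + 1) := lt_of_lt_of_le (by positivity) hlam
    have e : σ ^ 2 / eigval ϑ₂ ϑ₁ ϑ₀ (ℓ + 1) * (Real.exp (-eigval ϑ₂ ϑ₁ ϑ₀ (ℓ + 1) * 0) *
        (incCoef κ b M ℓ k * incCoef κ b M ℓ l)) - c * (2 / (Real.pi * ((ℓ : ℝ) + 1)) ^ 2 *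
        (incCoef κ b M ℓ k * incCoef κ b M ℓ l))
        = -(σ ^ 2 * G / (eigval ϑ₂ ϑ₁ ϑ₀ (ℓ + 1) * (Real.pi * ((ℓ : ℝ) + 1)) ^ 2)) *
          (incCoef κ b M ℓ k * incCoef κ b M ℓ l) := by
      have e1 : ϑ₂ * G = eigval ϑ₂ ϑ₁ ϑ₀ (ℓ + 1) - ϑ₂ * (Real.pi * ((ℓ : ℝ) + 1)) ^ 2 := by
        rw [eigval, ← hG]
        push_cast
        ring
      have e2 : G = (eigval ϑ₂ ϑ₁ ϑ₀ (ℓ + 1) - ϑ₂ * (Real.pi * ((ℓ : ℝ) + 1)) ^ 2) / ϑ₂ := by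
        rw [← e1]
        field_simp
      rw [e2, mul_zero, Real.exp_zero, hc]
      field_simp
      ring
    rw [e, norm_mul, norm_neg, norm_mul, Real.norm_eq_abs, Real.norm_eq_abs, Real.norm_eq_abs,
      abs_div, abs_mul, abs_of_nonneg (sq_nonneg σ),
      abs_of_pos (by positivity : 0 < eigval ϑ₂ ϑ₁ ϑ₀ (ℓ + 1) * (Real.pi * ((ℓ : ℝ) + 1)) ^ 2)]
    have ha1 := abs_incCoef_le κ hb hM ℓ k
    have ha2 := abs_incCoef_le κ hb hM ℓ l
    have hn : (0 : ℝ) < (ℓ : ℝ) + 1 := by positivity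
    calc _ ≤ σ ^ 2 * |G| / (c₀ * ((ℓ : ℝ) + 1) ^ 2 * ((ℓ : ℝ) + 1) ^ 2) *
          ((Ca * δ * (ℓ + 1)) * (Ca * δ * (ℓ + 1))) := by
          gcongr
          nlinarith [Real.pi_gt_three]
      _ = _ := by
          rw [hD]
          field_simp
  have hsplit : incCov σ ϑ₂ ϑ₁ ϑ₀ b M 0 k l - (if k = l then c * δ else 0)
      = (incCov σ ϑ₂ ϑ₁ ϑ₀ b M 0 k l - c * B) + c * (B - if k = l then δ else 0) := by
    split_ifs <;> ring
  rw [hsplit]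
  refine (abs_add_le _ _).trans ?_
  rw [abs_mul, abs_of_nonneg hc0]
  calc _ ≤ D * (∑' ℓ : ℕ, 1 / ((ℓ : ℝ) + 1) ^ 2) * δ ^ 2
        + c * ((4 * A + A ^ 2 + Real.exp |κ|) * δ ^ 2) := by gcongr
    _ = _ := by ring

/-- Quadratic forms of the covariance matrix at lag `τ`. -/
lemma hasSum_quadForm_incCov (hϑ₂ : 0 < ϑ₂)
    (hΓ : 0 < ϑ₁ ^ 2 / (4 * ϑ₂ ^ 2) - ϑ₀ / ϑ₂ + Real.pi ^ 2) (b : ℝ) {M : ℕ} {τ : ℝ}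
    (hτ : 0 ≤ τ) (x x' : Fin M → ℝ) :
    HasSum (fun ℓ : ℕ => σ ^ 2 / eigval ϑ₂ ϑ₁ ϑ₀ (ℓ + 1) *
      (Real.exp (-eigval ϑ₂ ϑ₁ ϑ₀ (ℓ + 1) * τ) *
      ((∑ k, x k * incCoef (kappa ϑ₂ ϑ₁) b M ℓ k) * ∑ k, x' k * incCoef (kappa ϑ₂ ϑ₁) b M ℓ k)))
      (∑ k, ∑ l, x k * x' l * incCov σ ϑ₂ ϑ₁ ϑ₀ b M τ k l) := by
  refine hasSum_of_eq (hasSum_sum fun (k : Fin M) _ => hasSum_sum fun (l : Fin M) _ =>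
    (hasSum_incCov hϑ₂ hΓ b M hτ k l).mul_left (x k * x' l)) (fun ℓ => ?_) rfl
  rw [Finset.sum_mul_sum, Finset.mul_sum, Finset.mul_sum]
  refine Finset.sum_congr rfl fun k _ => ?_
  rw [Finset.mul_sum, Finset.mul_sum]
  refine Finset.sum_congr rfl fun l _ => ?_
  ring

/-- Each mode contributes a square times e^{-λτ}, so the form is largest at τ = 0. There the
diagonal gives order δ, and the O(δ²) entries give O(Mδ²) = O(δ) by Cauchy-Schwarz. The bound is
uniform in τ. -/
lemma quadForm_incCov_le (hϑ₂ : 0 < ϑ₂)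
    (hΓ : 0 < ϑ₁ ^ 2 / (4 * ϑ₂ ^ 2) - ϑ₀ / ϑ₂ + Real.pi ^ 2) (hb : b ∈ Ico (0 : ℝ) (1 / 2)) :
    ∃ C, 0 ≤ C ∧ ∀ M : ℕ, 1 ≤ M → ∀ τ, 0 ≤ τ → ∀ x : Fin M → ℝ,
      ∑ k, ∑ l, x k * x l * incCov σ ϑ₂ ϑ₁ ϑ₀ b M τ k l ≤ C * meshSp b M * ∑ k, x k ^ 2 := by
  obtain ⟨c₀, hc₀, hc₀'⟩ := eigval_lower_bound hϑ₂ hΓ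
  obtain ⟨C, hC, hap⟩ := incCov_zero_approx (σ := σ) hϑ₂ hΓ hb
  refine ⟨σ ^ 2 / (2 * ϑ₂) + C, by positivity, fun M hM τ hτ x => ?_⟩
  have hδ0 := meshSp_pos hb hM
  have hMδ : (M : ℝ) * meshSp b M ≤ 1 := by
    rw [mul_meshSp hM]
    linarith [hb.1]
  have hmono : ∑ k, ∑ l, x k * x l * incCov σ ϑ₂ ϑ₁ ϑ₀ b M τ k l
      ≤ ∑ k, ∑ l, x k * x l * incCov σ ϑ₂ ϑ₁ ϑ₀ b M 0 k l := by
    refine hasSum_le (fun ℓ => ?_) (hasSum_quadForm_incCov hϑ₂ hΓ b hτ x x)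
      (hasSum_quadForm_incCov hϑ₂ hΓ b le_rfl x x)
    have h0 : 0 < eigval ϑ₂ ϑ₁ ϑ₀ (ℓ + 1) := lt_of_lt_of_le (by positivity) (hc₀' ℓ)
    refine mul_le_mul_of_nonneg_left ?_ (by positivity)
    refine mul_le_mul_of_nonneg_right ?_ (mul_self_nonneg _)
    rw [mul_zero, Real.exp_zero, Real.exp_le_one_iff, neg_mul, neg_nonpos]
    positivity
  refine hmono.trans ?_
  have hentry : ∀ k l : Fin M, x k * x l * incCov σ ϑ₂ ϑ₁ ϑ₀ b M 0 k l
      ≤ (if k = l then σ ^ 2 / (2 * ϑ₂) * meshSp b M * x k ^ 2 else 0)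
        + C * meshSp b M ^ 2 * (|x k| * |x l|) := by
    intro k l
    have h := hap M hM k l k.2 l.2
    have h1 : x k * x l * (incCov σ ϑ₂ ϑ₁ ϑ₀ b M 0 k l
        - (if (k : ℕ) = l then σ ^ 2 / (2 * ϑ₂) * meshSp b M else 0))
        ≤ C * meshSp b M ^ 2 * (|x k| * |x l|) := by
      refine (le_abs_self _).trans ?_
      rw [abs_mul, abs_mul, mul_comm]
      exact mul_le_mul_of_nonneg_right h (by positivity)
    by_cases hkl : k = l
    · subst hkl
      simp only [if_true] at h1 ⊢
      nlinarith
    · have hkl' : (k : ℕ) ≠ l := fun h => hkl (Fin.ext h)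
      simp only [hkl, hkl', if_false] at h1 ⊢
      linarith
  calc _ ≤ ∑ k, ∑ l, ((if k = l then σ ^ 2 / (2 * ϑ₂) * meshSp b M * x k ^ 2 else 0)
        + C * meshSp b M ^ 2 * (|x k| * |x l|)) :=
        Finset.sum_le_sum fun k _ => Finset.sum_le_sum fun l _ => hentry k l
    _ = σ ^ 2 / (2 * ϑ₂) * meshSp b M * ∑ k, x k ^ 2 + C * meshSp b M ^ 2 * (∑ k, |x k|) ^ 2 := by
        simp only [Finset.sum_add_distrib, Finset.sum_ite_eq, Finset.mem_univ, if_true]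
        rw [sq (∑ k, |x k|), Finset.sum_mul_sum, Finset.mul_sum, Finset.mul_sum]
        simp only [Finset.mul_sum]
    _ ≤ σ ^ 2 / (2 * ϑ₂) * meshSp b M * ∑ k, x k ^ 2
        + C * meshSp b M ^ 2 * (M * ∑ k, x k ^ 2) := by
        gcongr
        have := sq_sum_le_card_mul_sum_sq (s := Finset.univ) (f := fun k : Fin M => |x k|)
        simpa using this
    _ = (σ ^ 2 / (2 * ϑ₂) + C * (M * meshSp b M)) * meshSp b M * ∑ k, x k ^ 2 := by ring
    _ ≤ (σ ^ 2 / (2 * ϑ₂) + C * 1) * meshSp b M * ∑ k, x k ^ 2 := by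
        have : 0 ≤ ∑ k, x k ^ 2 := Finset.sum_nonneg fun _ _ => sq_nonneg _
        gcongr
    _ = _ := by ring

end Covariance

/-! ### Operator norm, trace and Frobenius norm of the space-time covariance. -/

section Frobenius

variable {σ ϑ₂ ϑ₁ ϑ₀ b : ℝ}

/-- This is ‖S‖_F² ≤ ‖S‖ tr S for positive semidefinite S: expanding one factor of S in modes makes
the ℓ-th term a multiple of the quadratic form of S at the coefficient vector of mode ℓ. -/
lemma frobenius_incCov_le (hϑ₂ : 0 < ϑ₂)
    (hΓ : 0 < ϑ₁ ^ 2 / (4 * ϑ₂ ^ 2) - ϑ₀ / ϑ₂ + Real.pi ^ 2) {M : ℕ} {τ C : ℝ} (hτ : 0 ≤ τ)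
    (hC : ∀ x : Fin M → ℝ, ∑ k, ∑ l, x k * x l * incCov σ ϑ₂ ϑ₁ ϑ₀ b M τ k l ≤ C * ∑ k, x k ^ 2) :
    ∑ k : Fin M, ∑ l : Fin M, incCov σ ϑ₂ ϑ₁ ϑ₀ b M τ k l ^ 2
      ≤ C * ∑ k : Fin M, incCov σ ϑ₂ ϑ₁ ϑ₀ b M τ k k := by
  obtain ⟨c₀, hc₀, hc₀'⟩ := eigval_lower_bound hϑ₂ hΓ
  have h1 := hasSum_sum (s := Finset.univ) fun (k : Fin M) _ =>
    hasSum_sum (s := Finset.univ) fun (l : Fin M) _ =>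
    (hasSum_incCov (σ := σ) hϑ₂ hΓ b M hτ k l).mul_left (incCov σ ϑ₂ ϑ₁ ϑ₀ b M τ k l)
  have h2 := (hasSum_sum (s := Finset.univ) fun (k : Fin M) _ =>
    hasSum_incCov (σ := σ) hϑ₂ hΓ b M hτ k k).mul_left C
  simp_rw [sq]
  refine hasSum_le (fun ℓ => ?_) h1 h2
  have h0 : 0 < eigval ϑ₂ ϑ₁ ϑ₀ (ℓ + 1) := lt_of_lt_of_le (by positivity) (hc₀' ℓ)
  have hx := hC fun k => incCoef (kappa ϑ₂ ϑ₁) b M ℓ k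
  set e := σ ^ 2 / eigval ϑ₂ ϑ₁ ϑ₀ (ℓ + 1) * Real.exp (-eigval ϑ₂ ϑ₁ ϑ₀ (ℓ + 1) * τ) with he
  have he0 : 0 ≤ e := by positivity
  have hx' := mul_le_mul_of_nonneg_left hx he0
  calc _ = e * ∑ k : Fin M, ∑ l : Fin M, incCoef (kappa ϑ₂ ϑ₁) b M ℓ k *
          incCoef (kappa ϑ₂ ϑ₁) b M ℓ l * incCov σ ϑ₂ ϑ₁ ϑ₀ b M τ k l := by
        simp_rw [Finset.mul_sum]
        refine Finset.sum_congr rfl fun k _ => Finset.sum_congr rfl fun l _ => ?_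
        rw [he]
        ring
    _ ≤ _ := hx'
    _ = _ := by
        simp_rw [Finset.mul_sum]
        refine Finset.sum_congr rfl fun k _ => ?_
        rw [he]
        ring

/-- Since e^x ≥ 1 + x, x times each term is at most a telescoping difference. -/
lemma sum_exp_neg_mul_le {x : ℝ} (hx : 0 < x) (N : ℕ) :
    ∑ n ∈ Finset.range N, Real.exp (-x * ((n : ℝ) + 1)) ≤ 1 / x := by
  rw [le_div_iff₀ hx, Finset.sum_mul]
  have h : ∀ n : ℕ, Real.exp (-x * ((n : ℝ) + 1)) * x
      ≤ Real.exp (-x * n) - Real.exp (-x * ((n + 1 : ℕ) : ℝ)) := by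
    intro n
    have e : Real.exp (-x * n) = Real.exp (-x * ((n : ℝ) + 1)) * Real.exp x := by
      rw [← Real.exp_add]
      congr 1
      ring
    rw [e]
    push_cast
    nlinarith [Real.add_one_le_exp x, Real.exp_pos (-x * ((n : ℝ) + 1))]
  calc _ ≤ ∑ n ∈ Finset.range N, (Real.exp (-x * n) - Real.exp (-x * ((n + 1 : ℕ) : ℝ))) :=
        Finset.sum_le_sum fun n _ => h n
    _ = Real.exp (-x * ((0 : ℕ) : ℝ)) - Real.exp (-x * N) :=
        Finset.sum_range_sub' (fun n : ℕ => Real.exp (-x * n)) N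
    _ ≤ 1 := by
        simp only [Nat.cast_zero, mul_zero, Real.exp_zero]
        linarith [Real.exp_pos (-x * N)]

/-- Summing e^{-λτ} over the positive lags gains a factor N/(Tλ_ℓ). With ∑_k a_{ℓk}² = O(δℓ²) the
modes then contribute O(δNℓ²/λ_ℓ²), which is summable; bounding each trace separately would lose the
factor δ. -/
lemma sum_trace_incCov_le (hϑ₂ : 0 < ϑ₂)
    (hΓ : 0 < ϑ₁ ^ 2 / (4 * ϑ₂ ^ 2) - ϑ₀ / ϑ₂ + Real.pi ^ 2) (hb : b ∈ Ico (0 : ℝ) (1 / 2))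
    {T : ℝ} (hT : 0 < T) :
    ∃ C, 0 ≤ C ∧ ∀ M N : ℕ, 1 ≤ M → 1 ≤ N → ∑ n ∈ Finset.range N, ∑ k : Fin M,
      incCov σ ϑ₂ ϑ₁ ϑ₀ b M (((n : ℝ) + 1) * (T / N)) k k ≤ C * meshSp b M * N := by
  obtain ⟨c₀, hc₀, hc₀'⟩ := eigval_lower_bound hϑ₂ hΓ
  have hpi := Real.pi_pos
  set κ := kappa ϑ₂ ϑ₁ with hκ
  set Ca := Real.exp |κ| * (Real.pi + |κ|) with hCa
  have hz0 : 0 ≤ ∑' ℓ : ℕ, 1 / ((ℓ : ℝ) + 1) ^ 2 := tsum_nonneg fun ℓ => by positivity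
  refine ⟨σ ^ 2 / c₀ * Ca ^ 2 / (T * c₀) * ∑' ℓ : ℕ, 1 / ((ℓ : ℝ) + 1) ^ 2, by positivity,
    fun M N hM hN => ?_⟩
  have hN0 : (0 : ℝ) < N := by exact_mod_cast hN
  set δ := meshSp b M with hδ
  have hδ0 : 0 < δ := meshSp_pos hb hM
  have hMδ : (M : ℝ) * δ ≤ 1 := by
    rw [hδ, mul_meshSp hM]
    linarith [hb.1]
  have h1 := hasSum_sum (s := Finset.range N) fun n _ =>
    hasSum_sum (s := Finset.univ) fun (k : Fin M) _ =>
    hasSum_incCov (σ := σ) hϑ₂ hΓ b M (τ := ((n : ℝ) + 1) * (T / N)) (by positivity) k k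
  have h2 := (summable_one_div_succ_sq.hasSum.mul_left
    (σ ^ 2 / c₀ * Ca ^ 2 / (T * c₀))).mul_right (δ * N)
  refine (hasSum_le (fun ℓ => ?_) h1 h2).trans (le_of_eq (by ring))
  set lam := eigval ϑ₂ ϑ₁ ϑ₀ (ℓ + 1) with hlam
  have hlam' : c₀ * ((ℓ : ℝ) + 1) ^ 2 ≤ lam := hc₀' ℓ
  have h0 : 0 < lam := lt_of_lt_of_le (by positivity) hlam'
  have hsq : ∑ k : Fin M, incCoef κ b M ℓ k * incCoef κ b M ℓ k
      ≤ Ca ^ 2 * δ * ((ℓ : ℝ) + 1) ^ 2 := by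
    calc _ ≤ ∑ k : Fin M, (Ca * δ * (ℓ + 1)) ^ 2 := by
          refine Finset.sum_le_sum fun k _ => ?_
          rw [← sq, ← sq_abs]
          exact pow_le_pow_left₀ (abs_nonneg _) (abs_incCoef_le κ hb hM ℓ k) 2
      _ = (M * δ) * (Ca ^ 2 * δ * ((ℓ : ℝ) + 1) ^ 2) := by
          rw [Finset.sum_const, Finset.card_univ, Fintype.card_fin, nsmul_eq_mul]
          ring
      _ ≤ _ := mul_le_of_le_one_left (by positivity) hMδ
  have hexp : ∑ n ∈ Finset.range N, Real.exp (-lam * (((n : ℝ) + 1) * (T / N)))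
      ≤ N / (T * c₀ * ((ℓ : ℝ) + 1) ^ 2) := by
    have hx : 0 < lam * (T / N) := by positivity
    calc _ = ∑ n ∈ Finset.range N, Real.exp (-(lam * (T / N)) * ((n : ℝ) + 1)) := by
          refine Finset.sum_congr rfl fun n _ => ?_
          congr 1
          ring
      _ ≤ 1 / (lam * (T / N)) := sum_exp_neg_mul_le hx N
      _ ≤ 1 / (c₀ * ((ℓ : ℝ) + 1) ^ 2 * (T / N)) := by gcongr
      _ = _ := by field_simp
  calc _ = σ ^ 2 / lam * ((∑ n ∈ Finset.range N, Real.exp (-lam * (((n : ℝ) + 1) * (T / N)))) *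
          ∑ k : Fin M, incCoef κ b M ℓ k * incCoef κ b M ℓ k) := by
        rw [Finset.sum_mul_sum]
        simp_rw [Finset.mul_sum]
        rfl
    _ ≤ σ ^ 2 / (c₀ * ((ℓ : ℝ) + 1) ^ 2) * ((N / (T * c₀ * ((ℓ : ℝ) + 1) ^ 2)) *
          (Ca ^ 2 * δ * ((ℓ : ℝ) + 1) ^ 2)) := by
        have : 0 ≤ ∑ k : Fin M, incCoef κ b M ℓ k * incCoef κ b M ℓ k :=
          Finset.sum_nonneg fun k _ => mul_self_nonneg _
        gcongr
    _ = _ := by field_simp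

/-- With truncated subtraction (i - j) + (j - i) is |i - j|, and each positive lag from i occurs at
most twice. -/
lemma sum_lag_le {f : ℕ → ℝ} (hf : ∀ n, 0 ≤ f n) {i N : ℕ} (hi : i < N) :
    ∑ j ∈ Finset.range N, f ((i - j) + (j - i)) ≤ f 0 + 2 * ∑ n ∈ Finset.range N, f (n + 1) := by
  obtain ⟨m, rfl⟩ : ∃ m, N = i + 1 + m := ⟨N - (i + 1), by omega⟩
  rw [Finset.sum_range_add, Finset.sum_range_succ]
  have h1 : ∑ j ∈ Finset.range i, f ((i - j) + (j - i))
      = ∑ n ∈ Finset.range i, f (n + 1) := by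
    rw [← Finset.sum_range_reflect]
    refine Finset.sum_congr rfl fun j hj => ?_
    have := Finset.mem_range.1 hj
    congr 1
    omega
  have h2 : ∑ x ∈ Finset.range m, f ((i - (i + 1 + x)) + ((i + 1 + x) - i))
      = ∑ n ∈ Finset.range m, f (n + 1) := by
    refine Finset.sum_congr rfl fun j _ => ?_
    congr 1
    omega
  have h3 : ∀ n ≤ i + 1 + m, ∑ n ∈ Finset.range n, f (n + 1)
      ≤ ∑ n ∈ Finset.range (i + 1 + m), f (n + 1) := fun n hn =>
    Finset.sum_le_sum_of_subset_of_nonneg (Finset.range_mono hn) fun _ _ _ => hf _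
  have h4 := h3 i (by omega)
  have h5 := h3 m (by omega)
  rw [h1, h2]
  simp only [Nat.sub_self, add_zero]
  linarith

/-- Covariance matrix of the weighted increments on the space-time grid. -/
def incMatrix (σ ϑ₂ ϑ₁ ϑ₀ b T : ℝ) (M N : ℕ) : Matrix (Fin N × Fin M) (Fin N × Fin M) ℝ :=
  fun p q => incCov σ ϑ₂ ϑ₁ ϑ₀ b M (|((p.1 : ℕ) : ℝ) - (q.1 : ℕ)| * (T / N)) p.2 q.2

lemma incCov_comm (τ : ℝ) (M k l : ℕ) :
    incCov σ ϑ₂ ϑ₁ ϑ₀ b M τ k l = incCov σ ϑ₂ ϑ₁ ϑ₀ b M τ l k := by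
  simp only [incCov, mul_comm (incCoef (kappa ϑ₂ ϑ₁) b M _ k)]

lemma incMatrix_isSymm (T : ℝ) (M N : ℕ) : (incMatrix σ ϑ₂ ϑ₁ ϑ₀ b T M N).IsSymm := by
  ext p q
  simp only [Matrix.transpose_apply, incMatrix]
  rw [abs_sub_comm, incCov_comm]

open scoped Matrix in
lemma dotProduct_incMatrix (T : ℝ) (M N : ℕ) (w : Fin N × Fin M → ℝ) :
    w ⬝ᵥ incMatrix σ ϑ₂ ϑ₁ ϑ₀ b T M N *ᵥ w
      = ∑ i : Fin N, ∑ j : Fin N, ∑ k : Fin M, ∑ l : Fin M, w (i, k) * w (j, l) *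
        incCov σ ϑ₂ ϑ₁ ϑ₀ b M (|((i : ℕ) : ℝ) - (j : ℕ)| * (T / N)) k l := by
  simp only [dotProduct, Matrix.mulVec, Fintype.sum_prod_type, Finset.mul_sum]
  refine Finset.sum_congr rfl fun i _ => ?_
  rw [Finset.sum_comm]
  refine Finset.sum_congr rfl fun j _ => Finset.sum_congr rfl fun k _ =>
    Finset.sum_congr rfl fun l _ => ?_
  simp only [incMatrix]
  ring

open scoped Matrix in
-- Mode by mode, AB ≤ (A² + B²)/2 and e^{-λτ} ≤ 1 reduce every block to lag 0. The resulting factor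
-- N is crude but harmless, because γNδ is of order √(N/M).
lemma dotProduct_incMatrix_le (hϑ₂ : 0 < ϑ₂)
    (hΓ : 0 < ϑ₁ ^ 2 / (4 * ϑ₂ ^ 2) - ϑ₀ / ϑ₂ + Real.pi ^ 2) {T : ℝ} (hT : 0 < T)
    {M N : ℕ} {C : ℝ}
    (hC : ∀ x : Fin M → ℝ, ∑ k, ∑ l, x k * x l * incCov σ ϑ₂ ϑ₁ ϑ₀ b M 0 k l ≤ C * ∑ k, x k ^ 2)
    (w : Fin N × Fin M → ℝ) :
    w ⬝ᵥ incMatrix σ ϑ₂ ϑ₁ ϑ₀ b T M N *ᵥ w ≤ N * C * (w ⬝ᵥ w) := by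
  obtain ⟨c₀, hc₀, hc₀'⟩ := eigval_lower_bound hϑ₂ hΓ
  set Q : Fin N → ℝ := fun i => ∑ k : Fin M, ∑ l : Fin M, w (i, k) * w (i, l) *
    incCov σ ϑ₂ ϑ₁ ϑ₀ b M 0 k l with hQ
  have hij : ∀ i j : Fin N, ∑ k : Fin M, ∑ l : Fin M, w (i, k) * w (j, l) *
        incCov σ ϑ₂ ϑ₁ ϑ₀ b M (|((i : ℕ) : ℝ) - (j : ℕ)| * (T / N)) k l ≤ (Q i + Q j) / 2 := by
    intro i j
    have h1 := hasSum_quadForm_incCov (σ := σ) hϑ₂ hΓ b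
      (τ := |((i : ℕ) : ℝ) - (j : ℕ)| * (T / N)) (by positivity)
      (fun k => w (i, k)) (fun k => w (j, k))
    have h2 := ((hasSum_quadForm_incCov (σ := σ) hϑ₂ hΓ b le_rfl (fun k => w (i, k))
      (fun k => w (i, k))).add (hasSum_quadForm_incCov (σ := σ) hϑ₂ hΓ b le_rfl
      (fun k => w (j, k)) (fun k => w (j, k)))).div_const 2
    refine hasSum_le (fun ℓ => ?_) h1 h2
    have h0 : 0 < eigval ϑ₂ ϑ₁ ϑ₀ (ℓ + 1) := lt_of_lt_of_le (by positivity) (hc₀' ℓ)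
    set A := ∑ k : Fin M, w (i, k) * incCoef (kappa ϑ₂ ϑ₁) b M ℓ k
    set B := ∑ k : Fin M, w (j, k) * incCoef (kappa ϑ₂ ϑ₁) b M ℓ k
    set e := Real.exp (-eigval ϑ₂ ϑ₁ ϑ₀ (ℓ + 1) * (|((i : ℕ) : ℝ) - (j : ℕ)| * (T / N))) with he
    have he1 : e ≤ 1 := by
      rw [he, Real.exp_le_one_iff, neg_mul, neg_nonpos]
      positivity
    have he0 : 0 < e := Real.exp_pos _
    rw [mul_zero, Real.exp_zero, one_mul, one_mul, ← mul_add, mul_div_assoc]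
    refine mul_le_mul_of_nonneg_left ?_ (by positivity)
    have h3 : A * B ≤ (A * A + B * B) / 2 := by nlinarith [sq_nonneg (A - B)]
    have h4 : 0 ≤ (A * A + B * B) / 2 := by nlinarith [sq_nonneg A, sq_nonneg B]
    nlinarith
  have hQi : ∀ i, Q i ≤ C * ∑ k : Fin M, w (i, k) ^ 2 := fun i => hC fun k => w (i, k)
  rw [dotProduct_incMatrix]
  calc _ ≤ ∑ i : Fin N, ∑ j : Fin N, (Q i + Q j) / 2 :=
        Finset.sum_le_sum fun i _ => Finset.sum_le_sum fun j _ => hij i j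
    _ = N * ∑ i, Q i := by
        simp only [← Finset.sum_div, Finset.sum_add_distrib, Finset.sum_const, Finset.card_univ,
          Fintype.card_fin, nsmul_eq_mul, ← Finset.mul_sum]
        ring
    _ ≤ N * ∑ i, C * ∑ k : Fin M, w (i, k) ^ 2 := by
        gcongr with i
        exact hQi i
    _ = _ := by
        simp only [dotProduct, Fintype.sum_prod_type, ← sq, ← Finset.mul_sum]
        ring

lemma trace_incMatrix_approx {T : ℝ} {M N : ℕ} {c C : ℝ} (hMδ : (M : ℝ) * meshSp b M ≤ 1)
    (hδ : 0 ≤ meshSp b M) (hC0 : 0 ≤ C)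
    (hC : ∀ k l : ℕ, k < M → l < M → |incCov σ ϑ₂ ϑ₁ ϑ₀ b M 0 k l -
      (if k = l then c * meshSp b M else 0)| ≤ C * meshSp b M ^ 2) :
    |∑ p, incMatrix σ ϑ₂ ϑ₁ ϑ₀ b T M N p p - N * M * (c * meshSp b M)| ≤ N * (C * meshSp b M) := by
  have e : ∑ p, incMatrix σ ϑ₂ ϑ₁ ϑ₀ b T M N p p - N * M * (c * meshSp b M)
      = ∑ _i : Fin N, ∑ k : Fin M, (incCov σ ϑ₂ ϑ₁ ϑ₀ b M 0 k k - c * meshSp b M) := by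
    simp only [incMatrix, sub_self, abs_zero, zero_mul, Fintype.sum_prod_type,
      Finset.sum_sub_distrib, Finset.sum_const, Finset.card_univ, Fintype.card_fin, nsmul_eq_mul]
    ring
  rw [e]
  calc _ ≤ ∑ _i : Fin N, ∑ k : Fin M, C * meshSp b M ^ 2 := by
        refine (Finset.abs_sum_le_sum_abs _ _).trans (Finset.sum_le_sum fun i _ => ?_)
        refine (Finset.abs_sum_le_sum_abs _ _).trans (Finset.sum_le_sum fun k _ => ?_)
        simpa using hC k k k.2 k.2
    _ = N * ((M * meshSp b M) * (C * meshSp b M)) := by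
        simp only [Finset.sum_const, Finset.card_univ, Fintype.card_fin, nsmul_eq_mul]
        ring
    _ ≤ _ := mul_le_mul_of_nonneg_left (mul_le_of_le_one_left (mul_nonneg hC0 hδ) hMδ)
        (Nat.cast_nonneg N)

/-- The M² squared errors of size δ⁴ and the M diagonal cross terms of size δ³ are both O(δ²),
because Mδ ≤ 1. -/
lemma frobenius_incCov_zero {M : ℕ} {c C : ℝ} (hMδ : (M : ℝ) * meshSp b M ≤ 1)
    (hδ : 0 ≤ meshSp b M) (hc : 0 ≤ c) (hC0 : 0 ≤ C)
    (hC : ∀ k l : ℕ, k < M → l < M → |incCov σ ϑ₂ ϑ₁ ϑ₀ b M 0 k l -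
      (if k = l then c * meshSp b M else 0)| ≤ C * meshSp b M ^ 2) :
    |∑ k : Fin M, ∑ l : Fin M, incCov σ ϑ₂ ϑ₁ ϑ₀ b M 0 k l ^ 2 - M * (c * meshSp b M) ^ 2|
      ≤ (2 * c * C + C ^ 2) * meshSp b M ^ 2 := by
  set δ := meshSp b M with hδ'
  set R : Fin M → Fin M → ℝ := fun k l => incCov σ ϑ₂ ϑ₁ ϑ₀ b M 0 k l -
    (if k = l then c * δ else 0) with hR
  have hRb : ∀ k l, |R k l| ≤ C * δ ^ 2 := by
    intro k l
    have := hC k l k.2 l.2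
    simpa only [hR, Fin.ext_iff] using this
  have e : ∑ k : Fin M, ∑ l : Fin M, incCov σ ϑ₂ ϑ₁ ϑ₀ b M 0 k l ^ 2 - M * (c * δ) ^ 2
      = ∑ k : Fin M, ((∑ l, R k l ^ 2) + 2 * (c * δ) * R k k) := by
    have h1 : ∀ k l : Fin M, incCov σ ϑ₂ ϑ₁ ϑ₀ b M 0 k l ^ 2
        = R k l ^ 2 + (if k = l then 2 * (c * δ) * R k k + (c * δ) ^ 2 else 0) := by
      intro k l
      simp only [hR]
      by_cases h : k = l
      · subst h
        simp only [if_true]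
        ring
      · simp only [h, if_false]
        ring
    simp only [h1, Finset.sum_add_distrib, Finset.sum_ite_eq, Finset.mem_univ, if_true,
      Finset.sum_const, Finset.card_univ, Fintype.card_fin, nsmul_eq_mul]
    ring
  rw [e]
  calc _ ≤ ∑ k : Fin M, ((∑ _l : Fin M, (C * δ ^ 2) ^ 2) + 2 * (c * δ) * (C * δ ^ 2)) := by
        refine (Finset.abs_sum_le_sum_abs _ _).trans (Finset.sum_le_sum fun k _ => ?_)
        refine (abs_add_le _ _).trans (add_le_add ?_ ?_)
        · rw [abs_of_nonneg (Finset.sum_nonneg fun _ _ => sq_nonneg _)]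
          refine Finset.sum_le_sum fun l _ => ?_
          rw [← sq_abs]
          exact pow_le_pow_left₀ (abs_nonneg _) (hRb k l) 2
        · rw [abs_mul, abs_of_nonneg (by positivity)]
          exact mul_le_mul_of_nonneg_left (hRb k k) (by positivity)
    _ = (M * δ) * (M * δ) * (C ^ 2 * δ ^ 2) + (M * δ) * (2 * c * C * δ ^ 2) := by
        simp only [Finset.sum_const, Finset.card_univ, Fintype.card_fin, nsmul_eq_mul]
        ring
    _ ≤ 1 * 1 * (C ^ 2 * δ ^ 2) + 1 * (2 * c * C * δ ^ 2) := by gcongr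
    _ = _ := by ring

/-- The squared Frobenius norm of the covariance matrix. -/
lemma frobenius_incMatrix_approx (hϑ₂ : 0 < ϑ₂)
    (hΓ : 0 < ϑ₁ ^ 2 / (4 * ϑ₂ ^ 2) - ϑ₀ / ϑ₂ + Real.pi ^ 2) (hb : b ∈ Ico (0 : ℝ) (1 / 2))
    {T : ℝ} (hT : 0 < T) :
    ∃ C, 0 ≤ C ∧ ∀ M N : ℕ, 1 ≤ M → 1 ≤ N →
      |∑ p, ∑ q, incMatrix σ ϑ₂ ϑ₁ ϑ₀ b T M N p q ^ 2
        - N * M * (σ ^ 2 / (2 * ϑ₂) * meshSp b M) ^ 2| ≤ C * meshSp b M ^ 2 * (N * N) := by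
  obtain ⟨C₁, hC₁, h₁⟩ := incCov_zero_approx (σ := σ) hϑ₂ hΓ hb
  obtain ⟨C₂, hC₂, h₂⟩ := quadForm_incCov_le (σ := σ) hϑ₂ hΓ hb
  obtain ⟨C₃, hC₃, h₃⟩ := sum_trace_incCov_le (σ := σ) hϑ₂ hΓ hb hT
  set c := σ ^ 2 / (2 * ϑ₂) with hc
  have hc0 : 0 ≤ c := by positivity
  refine ⟨(2 * c * C₁ + C₁ ^ 2) + 2 * C₂ * C₃, by positivity, fun M N hM hN => ?_⟩
  have hδ0 := meshSp_pos hb hM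
  have hN1 : (1 : ℝ) ≤ N := by exact_mod_cast hN
  have hMδ : (M : ℝ) * meshSp b M ≤ 1 := by
    rw [mul_meshSp hM]
    linarith [hb.1]
  have hF0 := frobenius_incCov_zero hMδ hδ0.le hc0 hC₁ (h₁ M hM)
  set δ := meshSp b M with hδ
  set F : ℕ → ℝ := fun n => ∑ k : Fin M, ∑ l : Fin M,
    incCov σ ϑ₂ ϑ₁ ϑ₀ b M ((n : ℝ) * (T / N)) k l ^ 2 with hF
  have hFn : ∀ n, 0 ≤ F n := fun n =>
    Finset.sum_nonneg fun _ _ => Finset.sum_nonneg fun _ _ => sq_nonneg _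
  have hF00 : F 0 = ∑ k : Fin M, ∑ l : Fin M, incCov σ ϑ₂ ϑ₁ ϑ₀ b M 0 k l ^ 2 := by
    simp only [hF, Nat.cast_zero, zero_mul]
  rw [← hF00] at hF0
  have htot : ∑ p, ∑ q, incMatrix σ ϑ₂ ϑ₁ ϑ₀ b T M N p q ^ 2
      = ∑ i : Fin N, ∑ j ∈ Finset.range N, F (((i : ℕ) - j) + (j - (i : ℕ))) := by
    simp only [Fintype.sum_prod_type, incMatrix]
    refine Finset.sum_congr rfl fun i _ => ?_
    rw [Finset.sum_comm, ← Fin.sum_univ_eq_sum_range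
      (fun j => F (((i : ℕ) - j) + (j - (i : ℕ))))]
    refine Finset.sum_congr rfl fun j _ => ?_
    have : (((((i : ℕ) - (j : ℕ)) + ((j : ℕ) - (i : ℕ)) : ℕ)) : ℝ) = |((i : ℕ) : ℝ) - (j : ℕ)| := by
      rcases le_total (i : ℕ) (j : ℕ) with h | h
      · have h' : ((i : ℕ) : ℝ) ≤ (j : ℕ) := by exact_mod_cast h
        rw [abs_of_nonpos (by linarith), Nat.sub_eq_zero_of_le h, zero_add, Nat.cast_sub h]
        ring
      · have h' : ((j : ℕ) : ℝ) ≤ (i : ℕ) := by exact_mod_cast h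
        rw [abs_of_nonneg (by linarith), Nat.sub_eq_zero_of_le h, add_zero, Nat.cast_sub h]
    simp only [hF, this]
  -- Operator norm O(δ) at each lag, times the summed traces O(δN).
  have hlags : ∑ n ∈ Finset.range N, F (n + 1) ≤ C₂ * δ * (C₃ * δ * N) := by
    calc _ ≤ ∑ n ∈ Finset.range N, C₂ * δ * ∑ k : Fin M,
          incCov σ ϑ₂ ϑ₁ ϑ₀ b M (((n : ℝ) + 1) * (T / N)) k k := by
          refine Finset.sum_le_sum fun n _ => ?_
          have := frobenius_incCov_le (σ := σ) (b := b) hϑ₂ hΓ (M := M)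
            (τ := ((n : ℝ) + 1) * (T / N)) (C := C₂ * δ) (by positivity)
            (h₂ M hM _ (by positivity))
          simpa [hF] using this
      _ = C₂ * δ * ∑ n ∈ Finset.range N, ∑ k : Fin M,
          incCov σ ϑ₂ ϑ₁ ϑ₀ b M (((n : ℝ) + 1) * (T / N)) k k := by rw [Finset.mul_sum]
      _ ≤ _ := mul_le_mul_of_nonneg_left (h₃ M N hM hN) (by positivity)
  -- Keeping only the diagonal blocks suffices from below, as all other squares are nonnegative.
  have hlow : N * F 0 ≤ ∑ p, ∑ q, incMatrix σ ϑ₂ ϑ₁ ϑ₀ b T M N p q ^ 2 := by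
    rw [htot]
    calc (N : ℝ) * F 0 = ∑ _i : Fin N, F 0 := by simp
      _ ≤ _ := by
        refine Finset.sum_le_sum fun i _ => ?_
        have := Finset.single_le_sum (f := fun j => F (((i : ℕ) - j) + (j - (i : ℕ))))
          (fun j _ => hFn _) (Finset.mem_range.2 i.2)
        simpa using this
  have hup : ∑ p, ∑ q, incMatrix σ ϑ₂ ϑ₁ ϑ₀ b T M N p q ^ 2
      ≤ N * (F 0 + 2 * (C₂ * δ * (C₃ * δ * N))) := by
    rw [htot]
    calc _ ≤ ∑ _i : Fin N, (F 0 + 2 * (C₂ * δ * (C₃ * δ * N))) := by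
          refine Finset.sum_le_sum fun i _ => (sum_lag_le hFn i.2).trans ?_
          linarith
      _ = _ := by rw [Finset.sum_const, Finset.card_univ, Fintype.card_fin, nsmul_eq_mul]
  have hF0' := abs_le.1 hF0
  have hNN : (N : ℝ) ≤ N * N := by nlinarith
  have hKN : (N : ℝ) * ((2 * c * C₁ + C₁ ^ 2) * δ ^ 2)
      ≤ (2 * c * C₁ + C₁ ^ 2) * δ ^ 2 * (N * N) := by
    rw [mul_comm]
    exact mul_le_mul_of_nonneg_left hNN (by positivity)
  have hX : 0 ≤ 2 * C₂ * C₃ * δ ^ 2 * (N * N) := by positivity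
  have hN0 : (0 : ℝ) ≤ N := by linarith
  have l1 := mul_le_mul_of_nonneg_left hF0'.1 hN0
  have l2 := mul_le_mul_of_nonneg_left hF0'.2 hN0
  rw [abs_le]
  constructor
  · linarith
  · linarith

end Frobenius

/-! ### Gaussianity of the weighted increments -/

/-- A characteristic function has modulus at most 1. This yields positive semidefiniteness of the
covariance matrix without a separate computation. -/
lemma HasGaussTransform.nonneg {Ω : Type*} [MeasurableSpace Ω] {P : Measure Ω}
    [IsProbabilityMeasure P] {Z : Ω → ℝ} {v : ℝ} (h : HasGaussTransform Z v P) : 0 ≤ v := by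
  have h1 : ‖∫ ω, Complex.exp ((Z ω : ℝ) * Complex.I) ∂P‖ ≤ 1 := by
    refine (norm_integral_le_of_norm_le_const (C := 1) (Eventually.of_forall fun ω => ?_)).trans
      (by simp)
    rw [Complex.norm_exp_ofReal_mul_I]
  rw [h.integral_exp, Complex.norm_exp] at h1
  have h2 : (-((v / 2 : ℝ) : ℂ)).re = -(v / 2) := by simp
  rw [h2, Real.exp_le_one_iff] at h1
  linarith

section Increments

variable {Ω : Type*} [MeasurableSpace Ω] {P : Measure Ω}
  {σ ϑ₂ ϑ₁ ϑ₀ b : ℝ} {W : wL2 (kappa ϑ₂ ϑ₁) → ℝ≥0 → Ω → ℝ} {X : ℝ → ℝ → Ω → ℝ}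

/-- The weighted increments `e^{κ y_k / 2} (X_{t_i}(y_{k+1}) - X_{t_i}(y_k))`. -/
def increment (κ b T : ℝ) (X : ℝ → ℝ → Ω → ℝ) (M N : ℕ) (p : Fin N × Fin M) (ω : Ω) : ℝ :=
  Real.exp (κ * gridSp b M p.2 / 2) * (X (gridT T N p.1) (gridSp b M (p.2 + 1)) ω
    - X (gridT T N p.1) (gridSp b M p.2) ω)

lemma gridT_nonneg {T : ℝ} (hT : 0 < T) (N i : ℕ) : 0 ≤ gridT T N i := by
  unfold gridT
  positivity

lemma measurable_increment (hX : IsWeakSolution σ ϑ₂ ϑ₁ ϑ₀ W X P) (κ : ℝ)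
    (hb : b ∈ Ico (0 : ℝ) (1 / 2)) {T : ℝ} (hT : 0 < T) (M N : ℕ) (p : Fin N × Fin M) :
    Measurable (increment κ b T X M N p) := by
  have hM : 1 ≤ M := Nat.one_le_of_lt p.2.2
  exact ((hX.measurable _ (gridT_nonneg hT N _) _ (gridSp_mem hb hM p.2.2)).sub
    (hX.measurable _ (gridT_nonneg hT N _) _ (gridSp_mem hb hM p.2.2.le))).const_mul _

open scoped Matrix in
lemma hasSum_dotProduct_incMatrix (hϑ₂ : 0 < ϑ₂)
    (hΓ : 0 < ϑ₁ ^ 2 / (4 * ϑ₂ ^ 2) - ϑ₀ / ϑ₂ + Real.pi ^ 2) {T : ℝ} (hT : 0 < T) (M N : ℕ)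
    (w : Fin N × Fin M → ℝ) :
    HasSum (fun ℓ : ℕ => σ ^ 2 / eigval ϑ₂ ϑ₁ ϑ₀ (ℓ + 1) * ∑ p, ∑ q, w p * w q *
      (Real.exp (-eigval ϑ₂ ϑ₁ ϑ₀ (ℓ + 1) * (|((p.1 : ℕ) : ℝ) - (q.1 : ℕ)| * (T / N))) *
        (incCoef (kappa ϑ₂ ϑ₁) b M ℓ p.2 * incCoef (kappa ϑ₂ ϑ₁) b M ℓ q.2)))
      (w ⬝ᵥ incMatrix σ ϑ₂ ϑ₁ ϑ₀ b T M N *ᵥ w) := by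
  refine hasSum_of_eq (hasSum_sum (s := Finset.univ) fun (p : Fin N × Fin M) _ =>
    hasSum_sum (s := Finset.univ) fun (q : Fin N × Fin M) _ =>
    (hasSum_incCov (σ := σ) hϑ₂ hΓ b M
      (τ := |((p.1 : ℕ) : ℝ) - (q.1 : ℕ)| * (T / N)) (by positivity) p.2 q.2).mul_left
      (w p * w q)) (fun ℓ => ?_) ?_
  · simp only [Finset.mul_sum]
    refine Finset.sum_congr rfl fun p _ => Finset.sum_congr rfl fun q _ => ?_
    ring
  · simp only [dotProduct, Matrix.mulVec, Finset.mul_sum, incMatrix]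
    refine Finset.sum_congr rfl fun p _ => Finset.sum_congr rfl fun q _ => ?_
    ring

open scoped Matrix in
-- Since e^{κy_k/2} = r e^{κy_{k+1}/2}, a weighted increment is r times the rescaled field at
-- y_{k+1} minus the rescaled field at y_k, whose sine coefficients are `incCoef`. Arbitrary w makes
-- this a statement about the joint law.
lemma hasGaussTransform_increment [IsProbabilityMeasure P] (hϑ₂ : 0 < ϑ₂)
    (hΓ : 0 < ϑ₁ ^ 2 / (4 * ϑ₂ ^ 2) - ϑ₀ / ϑ₂ + Real.pi ^ 2) (hW : IsCylindricalBrownian W P)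
    (hX : IsWeakSolution σ ϑ₂ ϑ₁ ϑ₀ W X P) (hX₀ : IsStationaryStart σ ϑ₂ ϑ₁ ϑ₀ W X P)
    (hb : b ∈ Ico (0 : ℝ) (1 / 2)) {T : ℝ} (hT : 0 < T) (M N : ℕ) (w : Fin N × Fin M → ℝ) :
    HasGaussTransform (fun ω => ∑ p, w p * increment (kappa ϑ₂ ϑ₁) b T X M N p ω)
      (w ⬝ᵥ incMatrix σ ϑ₂ ϑ₁ ϑ₀ b T M N *ᵥ w) P := by
  obtain ⟨κ, hκ⟩ : ∃ κ, κ = kappa ϑ₂ ϑ₁ := ⟨_, rfl⟩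
  obtain ⟨Δ, hΔ⟩ : ∃ Δ : ℝ≥0, (Δ : ℝ) = T / N := ⟨⟨T / N, by positivity⟩, rfl⟩
  set r : ℝ := Real.exp (-κ * meshSp b M / 2) with hr
  have hM : ∀ p : Fin N × Fin M, 1 ≤ M := fun p => Nat.one_le_of_lt p.2.2
  have hy : ∀ p : Fin N × Fin M, gridSp b M p.2 ∈ Icc (0 : ℝ) 1 := fun p =>
    gridSp_mem hb (hM p) p.2.2.le
  have hy' : ∀ p : Fin N × Fin M, gridSp b M (p.2 + 1) ∈ Icc (0 : ℝ) 1 := fun p =>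
    gridSp_mem hb (hM p) p.2.2
  have hg : ∀ᶠ h in 𝓝[>] (0 : ℝ), ∀ (p : Fin N × Fin M) (ω : Ω), HasSum (fun ℓ : ℕ =>
      √2 * mode κ X (ℓ + 1) (((p.1 : ℕ) : ℝ) * Δ) ω *
        incCoef κ b M ℓ p.2 * riemannFactor ℓ h)
      (r * riemannMean κ X h (gridT T N p.1) (gridSp b M (p.2 + 1)) ω
        - riemannMean κ X h (gridT T N p.1) (gridSp b M p.2) ω) := by
    refine eventually_all.2 fun p => ?_
    filter_upwards [hasSum_riemannMean hX κ (hy p), hasSum_riemannMean hX κ (hy' p)]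
      with h h1 h2 ω
    refine hasSum_of_eq (((h2 _ (gridT_nonneg hT N p.1) ω).mul_left r).sub
      (h1 _ (gridT_nonneg hT N p.1) ω)) (fun ℓ => ?_) rfl
    simp only [incCoef, gridT, hΔ, ← hr]
    ring
  have hζ : ∀ (p : Fin N × Fin M) (ω : Ω), Tendsto (fun h =>
      r * riemannMean κ X h (gridT T N p.1) (gridSp b M (p.2 + 1)) ω
        - riemannMean κ X h (gridT T N p.1) (gridSp b M p.2) ω) (𝓝[>] 0)
      (𝓝 (increment κ b T X M N p ω)) := by
    intro p ω
    have h1 := tendsto_riemannMean hX κ (gridT_nonneg hT N p.1) (hy p) ω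
    have h2 := tendsto_riemannMean hX κ (gridT_nonneg hT N p.1) (hy' p) ω
    have e : r * Real.exp (κ * gridSp b M (p.2 + 1) / 2) = Real.exp (κ * gridSp b M p.2 / 2) := by
      rw [hr, ← Real.exp_add, gridSp_succ]
      congr 1
      ring
    have h3 := (h2.const_mul r).sub h1
    rwa [← mul_assoc, e, ← mul_sub] at h3
  subst hκ
  have := hasGaussTransform_of_riemann_summable hϑ₂ hΓ hW hX hX₀
    (fun p : Fin N × Fin M => (p.1 : ℕ)) Δ
    (a := fun ℓ p => incCoef (kappa ϑ₂ ϑ₁) b M ℓ p.2)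
    (fun ℓ p => abs_incCoef_le_const (kappa ϑ₂ ϑ₁) b M ℓ p.2) hg hζ w
  rw [hΔ] at this
  rwa [(hasSum_dotProduct_incMatrix hϑ₂ hΓ hT M N w).tsum_eq] at this

end Increments

/-! ### The central limit theorem -/

lemma sqrt_mul_div (x : ℝ) {y : ℝ} (hy : 0 < y) : √(y * x) / y = √(x / y) := by
  rw [← Real.sqrt_sq hy.le, ← Real.sqrt_div' _ (sq_nonneg y), Real.sqrt_sq hy.le]
  congr 1
  field_simp

/-- The factor by which the sum of the squared increments is multiplied. -/
def scaleFactor (b : ℝ) (M N : ℕ) : ℝ :=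
  √((M : ℝ) * N) * (1 / N * (1 / (M * meshSp b M)))

lemma scaleFactor_nonneg {b : ℝ} (hb : b ∈ Ico (0 : ℝ) (1 / 2)) (M N : ℕ) :
    0 ≤ scaleFactor b M N := by
  have : 0 ≤ meshSp b M := div_nonneg (by linarith [hb.2]) (Nat.cast_nonneg M)
  unfold scaleFactor
  positivity

/-- Errors of size Nδ, in the trace and in the operator norm, become √(N/M) after scaling. -/
lemma scaleFactor_mul {b : ℝ} (hb : b ∈ Ico (0 : ℝ) (1 / 2)) {M N : ℕ} (hM : 1 ≤ M)
    (hN : 1 ≤ N) (C : ℝ) :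
    scaleFactor b M N * (N * (C * meshSp b M)) = C * √((N : ℝ) / M) := by
  have hM0 : (0 : ℝ) < M := by exact_mod_cast hM
  have hN0 : (0 : ℝ) < N := by exact_mod_cast hN
  have hδ := meshSp_pos hb hM
  rw [← sqrt_mul_div _ hM0, scaleFactor]
  field_simp

lemma scaleFactor_sq {b : ℝ} {M N : ℕ} (hM : 1 ≤ M) (hN : 1 ≤ N) :
    scaleFactor b M N ^ 2 = 1 / (N * M * meshSp b M ^ 2) := by
  have hM0 : (0 : ℝ) < M := by exact_mod_cast hM
  have hN0 : (0 : ℝ) < N := by exact_mod_cast hN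
  rw [scaleFactor, mul_pow, Real.sq_sqrt (by positivity)]
  rcases eq_or_ne (meshSp b M) 0 with h | h
  · simp [h]
  · field_simp

lemma scaleFactor_mul_sum {Ω : Type*} (κ b T c : ℝ) (X : ℝ → ℝ → Ω → ℝ) (M N : ℕ) (ω : Ω) :
    scaleFactor b M N * ∑ p, increment κ b T X M N p ω ^ 2 - √((M : ℝ) * N) * c
      = √((M : ℝ) * N) * (Vsp κ b T X M N ω - c) := by
  have e : ∀ (i : Fin N) (k : Fin M), increment κ b T X M N (i, k) ω ^ 2
      = Real.exp (κ * gridSp b M k) * (X (gridT T N i) (gridSp b M (k + 1)) ω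
        - X (gridT T N i) (gridSp b M k) ω) ^ 2 := by
    intro i k
    rw [increment, mul_pow, ← Real.exp_nat_mul]
    congr 2
    push_cast
    ring
  simp only [Vsp, VspAt, Fintype.sum_prod_type, e, Finset.sum_range, ← Finset.mul_sum, scaleFactor]
  ring

end SPDE

theorem mainTheorem2 {Ω : Type*} [MeasurableSpace Ω] (P : Measure Ω) [IsProbabilityMeasure P]
    (σ ϑ₂ ϑ₁ ϑ₀ : ℝ) (hσ : 0 < σ ^ 2) (hϑ₂ : 0 < ϑ₂)
    (hΓ : 0 < ϑ₁ ^ 2 / (4 * ϑ₂ ^ 2) - ϑ₀ / ϑ₂ + Real.pi ^ 2)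
    (W : SPDE.wL2 (SPDE.kappa ϑ₂ ϑ₁) → ℝ≥0 → Ω → ℝ) (hW : SPDE.IsCylindricalBrownian W P)
    (X : ℝ → ℝ → Ω → ℝ) (hX : SPDE.IsWeakSolution σ ϑ₂ ϑ₁ ϑ₀ W X P)
    (hX₀ : SPDE.IsStationaryStart σ ϑ₂ ϑ₁ ϑ₀ W X P)
    (T : ℝ) (hT : 0 < T) (b : ℝ) (hb : b ∈ Ico (0 : ℝ) (1 / 2))
    (M N : ℕ → ℕ) (hM : Tendsto M atTop atTop) (hN : Tendsto N atTop atTop)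
    (hNM : Tendsto (fun n => (N n : ℝ) / (M n : ℝ)) atTop (𝓝 0)) :
    TendstoInDistribution
      (fun n ω => √((M n : ℝ) * (N n : ℝ)) *
        (SPDE.Vsp (SPDE.kappa ϑ₂ ϑ₁) b T X (M n) (N n) ω - σ ^ 2 / (2 * ϑ₂)))
      atTop (id : ℝ → ℝ) (fun _ => P)
      (gaussianReal 0 (σ ^ 4 / (2 * ϑ₂ ^ 2)).toNNReal) := by
  obtain ⟨C₁, hC₁, h₁⟩ := SPDE.incCov_zero_approx (σ := σ) hϑ₂ hΓ hb
  obtain ⟨C₂, hC₂, h₂⟩ := SPDE.quadForm_incCov_le (σ := σ) hϑ₂ hΓ hb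
  obtain ⟨C₃, hC₃, h₃⟩ := SPDE.frobenius_incMatrix_approx (σ := σ) hϑ₂ hΓ hb hT
  set c := σ ^ 2 / (2 * ϑ₂) with hc
  have hgauss := fun n => SPDE.hasGaussTransform_increment hϑ₂ hΓ hW hX hX₀ hb hT (M n) (N n)
  have hsq : Tendsto (fun n => √((N n : ℝ) / M n)) atTop (𝓝 0) := by
    simpa using hNM.sqrt
  -- The scaled squared Frobenius norm tends to c², and the limiting variance is twice that.
  have hv : 2 * c ^ 2 = σ ^ 4 / (2 * ϑ₂ ^ 2) := by
    rw [hc]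
    field_simp
  rw [← hv]
  simp only [← SPDE.scaleFactor_mul_sum]
  refine SPDE.tendstoInDistribution_sum_sq
    (S := fun n => SPDE.incMatrix σ ϑ₂ ϑ₁ ϑ₀ b T (M n) (N n))
    (ε := fun n => N n * (C₂ * SPDE.meshSp b (M n)))
    (fun n p => (SPDE.measurable_increment hX _ hb hT _ _ p).aemeasurable)
    (fun n => SPDE.incMatrix_isSymm T (M n) (N n)) (fun n w => (hgauss n w).nonneg)
    (fun n w => (hgauss n w).integral_exp) (fun n => SPDE.scaleFactor_nonneg hb _ _)
    (fun n w => ?_) ?_ ?_ ?_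
  -- The bound is required for every n, while the estimate needs M ≥ 1; for M = 0 there are no
  -- increments.
  · rcases Nat.eq_zero_or_pos (M n) with h | h
    · have : IsEmpty (Fin (N n) × Fin (M n)) := by
        rw [h]
        infer_instance
      simp
    · refine SPDE.dotProduct_incMatrix_le hϑ₂ hΓ hT (fun x => h₂ (M n) h 0 le_rfl x) w
  -- No eigenvalue dominates: the scaled operator norm bound is C₂√(N/M).
  · have := hsq.const_mul C₂
    rw [mul_zero] at this
    refine this.congr' ?_
    filter_upwards [hM.eventually_ge_atTop 1, hN.eventually_ge_atTop 1] with n hMn hNn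
    exact (SPDE.scaleFactor_mul hb hMn hNn C₂).symm
  -- Frobenius norm: γ² = 1/(NMδ²) turns the error C₃δ²N² into C₃N/M.
  · rw [tendsto_iff_norm_sub_tendsto_zero]
    have := hNM.const_mul C₃
    rw [mul_zero] at this
    refine squeeze_zero' (Eventually.of_forall fun n => norm_nonneg _) ?_ this
    filter_upwards [hM.eventually_ge_atTop 1, hN.eventually_ge_atTop 1] with n hMn hNn
    have hM0 : (0 : ℝ) < M n := by exact_mod_cast hMn
    have hN0 : (0 : ℝ) < N n := by exact_mod_cast hNn
    have hδ := SPDE.meshSp_pos hb hMn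
    rw [Real.norm_eq_abs, SPDE.scaleFactor_sq hMn hNn]
    have e : c ^ 2 = 1 / (N n * M n * SPDE.meshSp b (M n) ^ 2) *
        (N n * M n * (c * SPDE.meshSp b (M n)) ^ 2) := by
      field_simp
    rw [e, ← mul_sub, abs_mul, abs_of_pos (by positivity)]
    refine (mul_le_mul_of_nonneg_left (h₃ (M n) (N n) hMn hNn) (by positivity)).trans
      (le_of_eq ?_)
    field_simp
  -- Bias: the trace misses NM·cδ by at most N·C₁δ, which scales to C₁√(N/M).
  · have := hsq.const_mul C₁
    rw [mul_zero] at this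
    refine squeeze_zero_norm' ?_ this
    filter_upwards [hM.eventually_ge_atTop 1, hN.eventually_ge_atTop 1] with n hMn hNn
    have hM0 : (0 : ℝ) < M n := by exact_mod_cast hMn
    have hN0 : (0 : ℝ) < N n := by exact_mod_cast hNn
    have hδ := SPDE.meshSp_pos hb hMn
    have hMδ : (M n : ℝ) * SPDE.meshSp b (M n) ≤ 1 := by
      rw [SPDE.mul_meshSp hMn]
      linarith [hb.1]
    have e : √((M n : ℝ) * N n) * c = SPDE.scaleFactor b (M n) (N n) *
        (N n * M n * (c * SPDE.meshSp b (M n))) := by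
      rw [SPDE.scaleFactor]
      field_simp
    rw [e, ← mul_sub, Real.norm_eq_abs, abs_mul,
      abs_of_nonneg (SPDE.scaleFactor_nonneg hb _ _), ← SPDE.scaleFactor_mul hb hMn hNn]
    exact mul_le_mul_of_nonneg_left (SPDE.trace_incMatrix_approx hMδ hδ.le hC₁ (h₁ (M n) hMn))
      (SPDE.scaleFactor_nonneg hb _ _)

end
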